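/- **Setting.** Let $(\Omega,\mathcal A,\mathbb P)$ be a probability space, $T:\Omega\to\Omega$ a bijective bi-measurable transformation preserving $\mathbb P$, $\mathcal F_0\subseteq\mathcal A$ a sub-$\sigma$-algebra with $\mathcal F_0\subseteq T^{-1}(\mathcal F_0)$, and $Y_0$ an $\mathcal F_0$-measurable integrable real random variable with distribution $P_{Y_0}$. Put $Y_i=Y_0\circ T^i$ for $i\in\mathbb Z$ and $\mathbf Y=(Y_i)_{i\in\mathbb Z}$. For integrable $Z$ write $Z^{(0)}=Z-\mathbb E(Z)$. For a random vector $V=(V_1,\dots,V_k)$ and a $\sigma$-algebra $\mathcal F\subseteq\mathcal A$ let $$\alpha(\mathcal F,V)=\sup_{(x_1,\dots,x_k)\in\mathbb R^k}\Big\|\mathbb E\Big(\prod_{j=1}^k(\mathbf 1_{V_j\le x_j})^{(0)}\Big|\mathcal F\Big)-\mathbb E\Big(\prod_{j=1}^k(\mathbf 1_{V_j\le x_j})^{(0)}\Big)\Big\|_1 ,$$ and let $\alpha_{2,\mathbf Y}(0)=1/2$ and, for $n>0$, $\alpha_{2,\mathbf Y}(n)=\max_{1\le l\le2}\ \sup_{n\le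 i_1\le\dots\le i_l}\alpha(\mathcal F_0,(Y_{i_1},\dots,Y_{i_l}))$. For $u\in[0,1]$ put $\alpha_{2,\mathbf Y}^{-1}(u)=\min\{q\in\mathbb N:\alpha_{2,\mathbf Y}(q)\le u\}$ (with $\min\emptyset=\infty$). Let $H:[0,\infty)\to[0,1]$ be non-increasing, right-continuous and convergent to $0$ at infinity, let $Q(u)=\inf\{t\ge0:H(t)\le u\}$ for $u\in[0,1]$ (with $\inf\emptyset=\infty$), and assume $\int_0^1Q(u)\,du<\infty$. Let $\mathrm{Mon}$ be the set of functions $g:\mathbb R\to\mathbb R$ that are monotonic on some open interval of $\mathbb R$, null elsewhere, and such that $P_{Y_0}(|g|>t)\le H(t)$ for all $t\ge0$. Let $f$ belong to the closure in $\mathbb L^1(P_{Y_0})$ of the set of finite sums $\sum_{\ell=1}^La_\ell f_\ell$ with $\sum_{\ell=1}^L|a_\ell|\le1$ and $f_\ell\in\mathrm{Mon}$. Put $X_i=f(Y_i)-\mathbb E(f(Y_i))$, $S_n=\sum_{k=1}^nX_k$ and $R(u)=\alpha_{2,\mathbf Y}^{-1}(u)\,Q(u)$ (with $\infty\cdot0=0$,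 here and below). **Theorem 3.2.** 1. Let $p\ge2$ and assume that $$\sup_{x>0}x^{p-1}\int_0^1Q(u)\mathbf 1_{R(u)>x}\,du<\infty .$$ If $p>2$, then for every $a\in(p-1,p)$ there is a constant $C>0$, not depending on $n$ nor $x$, such that for all integers $n\ge1$ and all real $x>0$, $$\mathbb P\Big(\frac1n\max_{1\le k\le n}|S_k|\ge x\Big)\le C\Big(\frac1{n^ax^{2a}}+\frac1{n^{p-1}x^p}\Big).$$ If $p=2$, then for every $a\in(1,2)$ and $c\in(0,1)$ there is a constant $C>0$, not depending on $n$ nor $x$, such that for all integers $n\ge1$ and all real $x>0$, $$\mathbb P\Big(\frac1n\max_{1\le k\le n}|S_k|\ge x\Big)\le C\Big(\frac1{n^{ac}x^{a(1+c)}}+\frac1{nx^2}\Big).$$ 2. Let $p\ge2$ and assume that $\int_0^1(\alpha_{2,\mathbf Y}^{-1}(u))^{p-1}Q^p(u)\,du<\infty$. Then for every $a\in(p-1,p)$ there is a constant $C>0$, not depending on $x$, such that for all real $x>0$, $$\sum_{n>0}n^{p-2}\,\mathbb P\Big(\frac1n\max_{1\le k\le n}|S_k|\ge x\Big)\le C\Big(\frac1{x^{2a}}+\frac1{x^p}\Big).$$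 -/

import Mathlib

open MeasureTheory Set Filter Topology
open scoped NNReal ENNReal

noncomputable section

namespace AlphaDep

variable {Ω : Type*}

/-- `Y_i = Y₀ ∘ T^i`, `i ∈ ℤ`, for a bijective bi-measurable map `T`. -/
def shifted [MeasurableSpace Ω] (T : Ω ≃ᵐ Ω) (Y₀ : Ω → ℝ) (i : ℤ) : Ω → ℝ :=
  fun ω => Y₀ (((T.toEquiv : Equiv.Perm Ω) ^ i) ω)

/-- `Z⁽⁰⁾ = Z - E(Z)`. -/
def centered [MeasurableSpace Ω] (P : Measure Ω) (Z : Ω → ℝ) : Ω → ℝ :=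
  fun ω => Z ω - ∫ ω', Z ω' ∂P

/-- `∏_j (1_{V_j ≤ x_j})⁽⁰⁾`. -/
def centeredProd [MeasurableSpace Ω] (P : Measure Ω) {k : ℕ} (V : Fin k → Ω → ℝ)
    (x : Fin k → ℝ) : Ω → ℝ :=
  fun ω => ∏ j, centered P ({ω' | V j ω' ≤ x j}.indicator (fun _ => (1 : ℝ))) ω

/-- `α(F, V) = sup_x ‖ E(∏_j (1_{V_j ≤ x_j})⁽⁰⁾ | F) - E(∏_j (1_{V_j ≤ x_j})⁽⁰⁾) ‖₁`. -/
def alphaVec (F : MeasurableSpace Ω) [mΩ : MeasurableSpace Ω] (P : Measure Ω) {k : ℕ}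
    (V : Fin k → Ω → ℝ) : ℝ≥0∞ :=
  ⨆ x : Fin k → ℝ,
    eLpNorm (fun ω => (P[centeredProd P V x | F]) ω - ∫ ω', centeredProd P V x ω' ∂P) 1 P

/-- The dependency coefficients `α_{k,Y}(n)`: `1/2` for `n = 0`, and for `n > 0`
`max_{1 ≤ l ≤ k} sup_{n ≤ i_1 ≤ … ≤ i_l} α(F, (Y_{i_1}, …, Y_{i_l}))`. -/
def alpha (F : MeasurableSpace Ω) [mΩ : MeasurableSpace Ω] (P : Measure Ω) (Y : ℤ → Ω → ℝ)
    (k n : ℕ) : ℝ≥0∞ :=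
  if n = 0 then 1 / 2
  else ⨆ l ∈ Finset.Icc 1 k, ⨆ (i : Fin l → ℤ) (_ : Monotone i ∧ ∀ j, (n : ℤ) ≤ i j),
    alphaVec F P (fun j => Y (i j))

/-- `α_{k,Y}⁻¹(u) = min {q ∈ ℕ : α_{k,Y}(q) ≤ u}`, equal to `∞` if there is no such `q`. -/
def alphaInv (F : MeasurableSpace Ω) [mΩ : MeasurableSpace Ω] (P : Measure Ω) (Y : ℤ → Ω → ℝ)
    (k : ℕ) (u : ℝ) : ℝ≥0∞ :=
  ⨅ (q : ℕ) (_ : alpha F P Y k q ≤ ENNReal.ofReal u), (q : ℝ≥0∞)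

/-- Tail functions `H : [0, ∞) → [0, 1]`. -/
structure IsTailFunction (H : ℝ≥0 → ℝ) : Prop where
  mem_Icc : ∀ t, H t ∈ Icc (0 : ℝ) 1
  antitone : Antitone H
  right_continuous : ∀ t, ContinuousWithinAt H (Ioi t) t
  tendsto_zero : Tendsto H atTop (𝓝 0)

/-- The quantile function `Q(u) = inf {t ≥ 0 : H(t) ≤ u}`, with `inf ∅ = ∞`. -/
def quantile (H : ℝ≥0 → ℝ) (u : ℝ) : ℝ≥0∞ :=
  ⨅ (t : ℝ≥0) (_ : H t ≤ u), (t : ℝ≥0∞)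

/-- The class `Mon(Q, μ)`, `Q = H⁻¹`: functions that are monotonic on some open interval, null
elsewhere, and such that `μ(|g| > t) ≤ H(t)` for all `t ≥ 0`. -/
def MemMon (H : ℝ≥0 → ℝ) (μ : Measure ℝ) (g : ℝ → ℝ) : Prop :=
  (∃ I : Set ℝ, IsOpen I ∧ I.OrdConnected ∧ (MonotoneOn g I ∨ AntitoneOn g I) ∧
    ∀ y ∉ I, g y = 0) ∧
  ∀ t : ℝ≥0, μ {y | (t : ℝ) < |g y|} ≤ ENNReal.ofReal (H t)

/-- The class `F(Q, μ)`, `Q = H⁻¹`: the closure in `L¹(μ)` of the set of finite sums `∑ a_l f_l`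
with `∑ |a_l| ≤ 1` and `f_l ∈ Mon(Q, μ)`. -/
def MemF (H : ℝ≥0 → ℝ) (μ : Measure ℝ) (f : ℝ → ℝ) : Prop :=
  Integrable f μ ∧ ∀ ε : ℝ≥0∞, 0 < ε →
    ∃ (L : ℕ) (a : Fin L → ℝ) (g : Fin L → ℝ → ℝ),
      ∑ l, |a l| ≤ 1 ∧ (∀ l, MemMon H μ (g l)) ∧
      eLpNorm (fun y => f y - ∑ l, a l * g l y) 1 μ < ε

/-- `X_i = f(Y_i) - E(f(Y_i))`. -/
def obs [MeasurableSpace Ω] (P : Measure Ω) (Y : ℤ → Ω → ℝ) (f : ℝ → ℝ) (i : ℤ) : Ω → ℝ :=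
  centered P (fun ω => f (Y i ω))

/-- `S_n = X_1 + … + X_n`. -/
def partialSum (X : ℤ → Ω → ℝ) (n : ℕ) (ω : Ω) : ℝ :=
  ∑ k ∈ Finset.Icc 1 n, X (k : ℤ) ω

/-- `max_{1 ≤ k ≤ n} |S_k|` (for `n ≥ 1`). -/
def maxPartialSum (X : ℤ → Ω → ℝ) (n : ℕ) (ω : Ω) : ℝ :=
  ((Finset.Icc 1 n).sup fun k => ‖partialSum X k ω‖₊ : ℝ≥0)

/-- The event `(1/n) max_{1 ≤ k ≤ n} |S_k| ≥ x`. -/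
def deviation (X : ℤ → Ω → ℝ) (n : ℕ) (x : ℝ) : Set Ω :=
  {ω | x ≤ (1 / (n : ℝ)) * maxPartialSum X n ω}

/-- `R(u) = α_{2,Y}⁻¹(u) Q(u)`. -/
def R (F : MeasurableSpace Ω) [mΩ : MeasurableSpace Ω] (P : Measure Ω) (Y : ℤ → Ω → ℝ)
    (H : ℝ≥0 → ℝ) (u : ℝ) : ℝ≥0∞ :=
  alphaInv F P Y 2 u * quantile H u

/-- `sup_{x > 0} x^{p-1} ∫_0^1 Q(u) 1_{R(u) > x} du < ∞`. -/
def WeakCond (F : MeasurableSpace Ω) [mΩ : MeasurableSpace Ω] (P : Measure Ω) (Y : ℤ → Ω → ℝ)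
    (H : ℝ≥0 → ℝ) (p : ℝ) : Prop :=
  (⨆ (x : ℝ) (_ : 0 < x), ENNReal.ofReal (x ^ (p - 1)) *
    ∫⁻ u in Icc (0 : ℝ) 1,
      {v | ENNReal.ofReal x < R F P Y H v}.indicator (quantile H) u) < ∞

/-- `∫_0^1 (α_{2,Y}⁻¹(u))^{p-1} Q(u)^p du < ∞`. -/
def StrongCond (F : MeasurableSpace Ω) [mΩ : MeasurableSpace Ω] (P : Measure Ω)
    (Y : ℤ → Ω → ℝ) (H : ℝ≥0 → ℝ) (p : ℝ) : Prop :=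
  (∫⁻ u in Icc (0 : ℝ) 1, alphaInv F P Y 2 u ^ (p - 1) * quantile H u ^ p) < ∞

end AlphaDep

end

/-!
# Deviation inequalities under `α`-dependence

Everything follows from one maximal inequality of Fuk–Nagaev type
(`exists_measureReal_maxEvent_le`), in which `y` is the level for the maximum of the `|S_k|`:
`P (max_{k ≤ n} |S_k| ≥ y) ≤ A ((n / y^s)^a + (n / y) ∫_0^1 Q(u) min (1, R(u) / y)^m du)`
for `1 ≤ s ≤ 2`, provided `∫ Q R^(s-1)` is finite. Taking `y = n x`, the first term is the first
term of the claims, for `s = 2`, or `s = 1 + c` in the critical case `p = 2`. The second term is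
evaluated from the hypothesis on `R`: a dyadic decomposition of the levels of `R` under the weak
condition, and an exact summation over `n` under the strong one.

Positive parts of monotone functions on intervals have intervals as superlevel sets, and so do
those of their opposites. The maximal inequality is hence proved for combinations of such *layered*
functions (`IsLayered`, `IsComb`); the constant is uniform over the combinations, so that it passes
to the `L¹` closure. For layered functions, the layer-cake formula reduces correlations to
indicators of intervals, which are differences of limits of indicators of half-lines; the dependence
coefficients therefore bound, by duality, correlations of one or two observables with the past
(`dual_single_comb`, `dual_pair_comb`).

For combinations the proof goes by strong induction on `n`.

* Let `v` be the point where `R` crosses a small multiple of `y`. Truncate at `M = Q(v)`, and cut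
  time into blocks of length `q = α⁻¹(v)`, so that `q M` is a small multiple of `y`
  (`exists_truncation`). The truncation error and the dependence between blocks at distance `q` are
  both controlled by `∫_0^v Q`, hence by the tail integral.
* The even-numbered blocks, and likewise the odd-numbered ones, are nearly independent of their
  past: their conditional variance is deterministic up to an error governed by the dependence
  coefficient. A good-`λ` inequality (`good_lambda`), which compares the probabilities that the
  walk exceeds `2 l` and `l`, applies to each of the two walks and is iterated over the levels
  `y / 2^j`. The number of iterations is chosen so that what is left is at most `(n / y^s)^a`
  (`exists_pow_four_le`).
* The iteration leaves the probabilities that a single block is large at small levels. Truncation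
  makes the first ones vanish. The others are bounded by the induction hypothesis, since a block
  has length `q < n`. They sum to at most a fixed fraction of the bound to be proved, because the
  gain `4^(-E)` at each step beats the growth of the bound when the level is halved
  (`alternate_blocks_le`).
-/

noncomputable section

namespace AlphaDep

/-! ### A good-`λ` inequality -/

theorem integrable_of_abs_le {Ω : Type*} [MeasurableSpace Ω] {P : Measure Ω}
    [IsFiniteMeasure P] {Z : Ω → ℝ} (hZ : Measurable Z) (b : ℝ) (hb : ∀ ω, |Z ω| ≤ b) :
    Integrable Z P :=
  Integrable.of_bound hZ.aestronglyMeasurable b (ae_of_all _ hb)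

/-- If the times at which a condition holds form the window `[i, j)`, then the sum of `u` over those
times is an increment of the partial sums of `u`. -/
theorem sum_indicator_window {s : ℕ → Prop} [DecidablePred s] {u : ℕ → ℝ} {i j n : ℕ}
    (hij : i ≤ j) (hjn : j ≤ n) (h : ∀ l < n, s l ↔ i ≤ l ∧ l < j) :
    ∑ l ∈ Finset.range n, (if s l then u l else 0)
      = ∑ l ∈ Finset.range j, u l - ∑ l ∈ Finset.range i, u l := by
  rw [← Finset.sum_Ico_eq_sub _ hij, ← Finset.sum_filter]
  apply Finset.sum_congr _ (fun _ _ => rfl)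
  ext l
  simp only [Finset.mem_filter, Finset.mem_range, Finset.mem_Ico]
  constructor
  · rintro ⟨h1, h2⟩; exact (h l h1).1 h2
  · intro h1; exact ⟨by omega, (h l (by omega)).2 h1⟩

theorem measurableSet_lt_abs {Ω : Type*} {m : MeasurableSpace Ω} {g : Ω → ℝ} (hg : Measurable g)
    (c : ℝ) : MeasurableSet {ω | c < |g ω|} :=
  measurableSet_lt measurable_const (measurable_norm.comp hg)

/-- A good-`λ` inequality for the walk with increments `U k`. The conditional mean and variance of
`U k` are controlled, in dual form and up to errors `e₁` and `e₂`, given a `σ`-algebra `G k` which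
knows the walk up to time `k`; the reference variance `σ` is deterministic. Going from level `l` to
level `2 l` requires either a large increment, or that the increments between the first passages
above `l` and above `2 l` add up to at least `l / 2`; the latter has small second moment. -/
theorem good_lambda {Ω : Type*} [mΩ : MeasurableSpace Ω] (P : Measure Ω)
    [IsProbabilityMeasure P] (U : ℕ → Ω → ℝ) (G : ℕ → MeasurableSpace Ω) (N : ℕ)
    (hG : ∀ k, G k ≤ mΩ) (hU : ∀ k, Measurable (U k))
    (hM : ∀ k, ∀ i ≤ k, Measurable[G k] (fun ω => ∑ l ∈ Finset.range i, U l ω))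
    (b : ℝ) (hb : ∀ k ω, |U k ω| ≤ b) (e₁ e₂ σ : ℝ) (hσ : 0 ≤ σ)
    (h1 : ∀ k < N, ∀ Z : Ω → ℝ, Measurable[G k] Z → (∀ ω, |Z ω| ≤ 1) →
      ∫ ω, Z ω * U k ω ∂P ≤ e₁)
    (h2 : ∀ k < N, ∀ s : Set Ω, MeasurableSet[G k] s →
      ∫ ω in s, U k ω ^ 2 ∂P ≤ σ * P.real s + e₂)
    (l δ : ℝ) (hl : 0 < l) (hδ : δ ≤ 1 / 2) :
    P.real {ω | ∃ j ≤ N, 2 * l < |∑ i ∈ Finset.range j, U i ω|} ≤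
      P.real {ω | ∃ k < N, δ * l < |U k ω|} +
      4 / l ^ 2 * (N * σ * P.real {ω | ∃ j ≤ N, l < |∑ i ∈ Finset.range j, U i ω|}
        + N * (e₂ + 8 * l * e₁)) := by
  classical
  set M : ℕ → Ω → ℝ := fun j ω => ∑ i ∈ Finset.range j, U i ω with hMdef
  -- `S k` is the event that the walk has passed `l`, but not yet `2 l`, at time `k`.
  set S : ℕ → Set Ω := fun k => {ω | (∃ i ≤ k, l < |M i ω|) ∧ ∀ i ≤ k, |M i ω| ≤ 2 * l} with hS
  have hSm : ∀ k, MeasurableSet[G k] (S k) := by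
    intro k
    have e : S k = (⋃ i ∈ Finset.Iic k, {ω | l < |M i ω|}) ∩
        ⋂ i ∈ Finset.Iic k, {ω | |M i ω| ≤ 2 * l} := by
      ext ω; simp [hS]
    rw [e]
    refine MeasurableSet.inter ?_ ?_
    · refine Finset.measurableSet_biUnion _ fun i hi => ?_
      have := hM k i (Finset.mem_Iic.1 hi)
      exact measurableSet_lt_abs this l
    · refine Finset.measurableSet_biInter _ fun i hi => ?_
      have := hM k i (Finset.mem_Iic.1 hi)
      have h3 := (measurableSet_lt_abs this (2 * l)).compl
      simpa only [compl_ofPred, not_lt] using h3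
  -- The increments of the walk between its first passages above `l` and above `2 l`.
  set W : ℕ → Ω → ℝ := fun n ω => ∑ k ∈ Finset.range n, if ω ∈ S k then U k ω else 0 with hW
  have hWm : ∀ k, Measurable (W k) := by
    intro k
    refine Finset.measurable_sum _ fun i _ => ?_
    exact Measurable.ite (hG i _ (hSm i)) (hU i) measurable_const
  -- On `S k` the sum `W k` is an increment of the walk `M`.
  have hWS : ∀ k ω, ω ∈ S k → ∃ i ≤ k, (∀ i' < i, |M i' ω| ≤ l) ∧ W k ω = M k ω - M i ω := by
    intro k ω hω
    have hex : ∃ i, l < |M i ω| := by obtain ⟨i, _, hi⟩ := hω.1; exact ⟨i, hi⟩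
    have hfind : Nat.find hex ≤ k := by
      obtain ⟨i, hi, hi'⟩ := hω.1; exact (Nat.find_min' hex hi').trans hi
    refine ⟨Nat.find hex, hfind, fun i' hi' => not_lt.1 (Nat.find_min hex hi'), ?_⟩
    refine sum_indicator_window hfind le_rfl fun m hm => ?_
    constructor
    · rintro ⟨⟨i, hi, hi'⟩, _⟩
      exact ⟨(Nat.find_min' hex hi').trans hi, hm⟩
    · rintro ⟨hi, _⟩
      exact ⟨⟨_, hi, Nat.find_spec hex⟩, fun i hi => hω.2 i (by omega)⟩
  have hW4 : ∀ k ω, ω ∈ S k → |W k ω| ≤ 4 * l := by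
    intro k ω hω
    obtain ⟨i, hi, _, h⟩ := hWS k ω hω
    rw [h]
    have := abs_sub (M k ω) (M i ω)
    have := hω.2 i hi
    have := hω.2 k le_rfl
    linarith
  have hWSm : ∀ k, Measurable[G k] ((S k).indicator (W k)) := by
    intro k
    have e : (S k).indicator (W k) = (S k).indicator (fun ω => ∑ m ∈ Finset.range k,
        (if ω ∈ {ω | ∃ i ≤ m, l < |M i ω|} then (M (m + 1) ω - M m ω) else 0)) := by
      ext ω
      by_cases hω : ω ∈ S k
      · simp only [indicator_of_mem hω, hW]
        refine Finset.sum_congr rfl fun m hm => ?_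
        have hmk := Finset.mem_range.1 hm
        have : M (m + 1) ω - M m ω = U m ω := by
          simp [hMdef, Finset.sum_range_succ]
        rw [this]
        congr 1
        simp only [hS, mem_ofPred_eq, eq_iff_iff, and_iff_left_iff_imp]
        intro _ i hi
        exact hω.2 i (by omega)
      · simp [indicator_of_notMem hω]
    rw [e]
    refine Measurable.indicator ?_ (hSm k)
    refine Finset.measurable_sum _ fun m hm => ?_
    have hmk := Finset.mem_range.1 hm
    refine Measurable.ite ?_ ((hM k (m + 1) (by omega)).sub (hM k m (by omega)))
      (@measurable_const _ _ _ (G k) _)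
    have e : {ω | ∃ i ≤ m, l < |M i ω|} = ⋃ i ∈ Finset.Iic m, {ω | l < |M i ω|} := by
      ext ω; simp
    rw [e]
    refine Finset.measurableSet_biUnion _ fun i hi => ?_
    have := hM k i ((Finset.mem_Iic.1 hi).trans hmk.le)
    exact measurableSet_lt_abs this l
  have hWb : ∀ k ω, |W k ω| ≤ k * |b| := by
    intro k ω
    refine (Finset.abs_sum_le_sum_abs _ _).trans ?_
    calc ∑ i ∈ Finset.range k, |if ω ∈ S i then U i ω else 0| ≤ ∑ i ∈ Finset.range k, |b| := by
          refine Finset.sum_le_sum fun i _ => ?_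
          split_ifs
          · exact (hb i ω).trans (le_abs_self b)
          · simp
      _ = k * |b| := by simp
  set A : Set Ω := {ω | ∃ j ≤ N, l < |M j ω|} with hA
  have hW2i : ∀ k, Integrable (fun ω => W k ω ^ 2) P := by
    intro k
    refine integrable_of_abs_le ((hWm k).pow_const 2) ((k * |b|) ^ 2) fun ω => ?_
    rw [abs_pow]
    exact pow_le_pow_left₀ (abs_nonneg _) (hWb k ω) 2
  have hW2 : ∀ k ≤ N, ∫ ω, W k ω ^ 2 ∂P ≤ k * (σ * P.real A + e₂ + 8 * l * e₁) := by
    intro k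
    induction k with
    | zero => intro _; simp [hW]
    | succ k ih =>
      intro hk
      have ih := ih (by omega)
      have hU2i : Integrable (fun ω => U k ω ^ 2) P := by
        refine integrable_of_abs_le ((hU k).pow_const 2) (|b| ^ 2) fun ω => ?_
        rw [abs_pow]
        exact pow_le_pow_left₀ (abs_nonneg _) ((hb k ω).trans (le_abs_self b)) 2
      -- The cross term `W k * U k` on `S k`: there `W k` is measurable and at most `4 l`.
      have hZ := h1 k (by omega) (fun ω => (S k).indicator (W k) ω / (4 * l))
        ((hWSm k).div_const _) (by
          intro ω
          by_cases hω : ω ∈ S k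
          · rw [indicator_of_mem hω, abs_div, abs_of_pos (by positivity : 0 < 4 * l)]
            exact div_le_one_of_le₀ (hW4 k ω hω) (by positivity)
          · simp [indicator_of_notMem hω])
      have hsq := h2 k (by omega) (S k) (hSm k)
      rw [← integral_indicator (hG k _ (hSm k))] at hsq
      have hZi : Integrable (fun ω => (S k).indicator (W k) ω / (4 * l) * U k ω) P := by
        refine integrable_of_abs_le
          ((((hWSm k).mono (hG k) le_rfl).div_const _).mul (hU k)) (1 * |b|) fun ω => ?_
        rw [abs_mul]
        refine mul_le_mul ?_ ((hb k ω).trans (le_abs_self b)) (abs_nonneg _) zero_le_one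
        by_cases hω : ω ∈ S k
        · rw [indicator_of_mem hω, abs_div, abs_of_pos (by positivity : 0 < 4 * l)]
          exact div_le_one_of_le₀ (hW4 k ω hω) (by positivity)
        · simp [indicator_of_notMem hω]
      have e : ∀ ω, W (k + 1) ω ^ 2 = W k ω ^ 2 +
          (8 * l * ((S k).indicator (W k) ω / (4 * l) * U k ω)
            + (S k).indicator (fun ω => U k ω ^ 2) ω) := by
        intro ω
        have : W (k + 1) ω = W k ω + if ω ∈ S k then U k ω else 0 := by
          simp [hW, Finset.sum_range_succ]
        rw [this]
        by_cases hω : ω ∈ S k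
        · simp only [hω, if_true, indicator_of_mem]
          field_simp
          ring
        · simp [hω]
      have hPS : P.real (S k) ≤ P.real A := by
        refine measureReal_mono ?_
        rintro ω ⟨⟨i, hi, hi'⟩, _⟩
        exact ⟨i, by omega, hi'⟩
      simp_rw [e]
      have i1 := hZi.const_mul (8 * l)
      have i2 := hU2i.indicator (hG k _ (hSm k))
      have i3 : Integrable (fun ω => 8 * l * ((S k).indicator (W k) ω / (4 * l) * U k ω)
            + (S k).indicator (fun ω => U k ω ^ 2) ω) P := i1.add i2
      rw [integral_add (hW2i k) i3, integral_add i1 i2, integral_const_mul]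
      push_cast
      nlinarith [mul_le_mul_of_nonneg_left hPS hσ, mul_le_mul_of_nonneg_left hZ
        (by positivity : 0 ≤ 8 * l)]
  have hcheb : P.real {ω | l ^ 2 / 4 ≤ W N ω ^ 2} ≤
      4 / l ^ 2 * (N * σ * P.real A + N * (e₂ + 8 * l * e₁)) := by
    have := mul_meas_ge_le_integral_of_nonneg (ae_of_all P fun ω => sq_nonneg (W N ω)) (hW2i N)
      (l ^ 2 / 4)
    have h3 := this.trans (hW2 N le_rfl)
    rw [div_mul_eq_mul_div, le_div_iff₀ (by positivity)]
    linarith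
  have hsub : {ω | ∃ j ≤ N, 2 * l < |M j ω|} ⊆
      {ω | ∃ k < N, δ * l < |U k ω|} ∪ {ω | l ^ 2 / 4 ≤ W N ω ^ 2} := by
    rintro ω ⟨j, hj, hjl⟩
    by_cases hd : ∃ k < N, δ * l < |U k ω|
    · exact Or.inl hd
    right
    push Not at hd
    have hex : ∃ i, l < |M i ω| := ⟨j, by linarith⟩
    have hex2 : ∃ i, 2 * l < |M i ω| := ⟨j, hjl⟩
    have hle : Nat.find hex ≤ Nat.find hex2 :=
      Nat.find_min' hex (by linarith [Nat.find_spec hex2])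
    have hleN : Nat.find hex2 ≤ N := (Nat.find_min' hex2 hjl).trans hj
    have hWN : W N ω = M (Nat.find hex2) ω - M (Nat.find hex) ω := by
      refine sum_indicator_window hle hleN fun m hm => ?_
      constructor
      · rintro ⟨⟨i, hi, hi'⟩, h3⟩
        refine ⟨(Nat.find_min' hex hi').trans hi, ?_⟩
        by_contra hcon
        exact absurd (Nat.find_spec hex2) (not_lt.2 (h3 _ (not_lt.1 hcon)))
      · rintro ⟨hi, h3⟩
        exact ⟨⟨_, hi, Nat.find_spec hex⟩,
          fun i hi => not_lt.1 (Nat.find_min hex2 (lt_of_le_of_lt hi h3))⟩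
    -- The overshoot above `l` at the first passage is at most `δ l ≤ l / 2`.
    have h0 : Nat.find hex ≠ 0 := by
      intro h0
      have := Nat.find_spec hex
      rw [h0] at this
      simp only [hMdef, Finset.range_zero, Finset.sum_empty, abs_zero] at this
      linarith
    obtain ⟨i, hi⟩ := Nat.exists_eq_succ_of_ne_zero h0
    have hMi : |M i ω| ≤ l := not_lt.1 (Nat.find_min hex (by omega))
    have hMf : M (Nat.find hex) ω = M i ω + U i ω := by
      rw [hi]; simp [hMdef, Finset.sum_range_succ]
    have hUi := hd i (by omega)
    have ht := Nat.find_spec hex2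
    have hge : l / 2 ≤ |W N ω| := by
      rw [hWN]
      have h4 := abs_sub_abs_le_abs_sub (M (Nat.find hex2) ω) (M (Nat.find hex) ω)
      have h5 : |M (Nat.find hex) ω| ≤ l + δ * l := by
        rw [hMf]; exact (abs_add_le _ _).trans (by linarith)
      nlinarith
    show l ^ 2 / 4 ≤ W N ω ^ 2
    rw [← sq_abs (W N ω)]
    nlinarith
  calc _ ≤ _ := measureReal_mono hsub
    _ ≤ _ := measureReal_union_le _ _
    _ ≤ _ := by gcongr

/-- Unrolling a recursion `p j ≤ c j + θ p (j + 1)`. -/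
theorem le_sum_of_recursion {p c : ℕ → ℝ} {θ : ℝ} (hθ : 0 ≤ θ) (J : ℕ)
    (h : ∀ j < J, p j ≤ c j + θ * p (j + 1)) :
    p 0 ≤ ∑ j ∈ Finset.range J, θ ^ j * c j + θ ^ J * p J := by
  induction J with
  | zero => simp
  | succ J ih =>
    have ih := ih fun j hj => h j (by omega)
    have := mul_le_mul_of_nonneg_left (h J (by omega)) (pow_nonneg hθ J)
    rw [Finset.sum_range_succ, pow_succ]
    linarith

/-! ### Quantiles and inverse dependence coefficients -/

section Quantile
variable {H : ℝ≥0 → ℝ}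

theorem quantile_antitone (H : ℝ≥0 → ℝ) : Antitone (quantile H) := by
  intro u u' huu'
  refine le_iInf₂ fun t ht => ?_
  exact iInf₂_le t (ht.trans huu')

theorem quantile_le {u : ℝ} {t : ℝ≥0} (h : H t ≤ u) : quantile H u ≤ t :=
  iInf₂_le (f := fun (t : ℝ≥0) (_ : H t ≤ u) => (t : ℝ≥0∞)) t h

theorem measurable_quantile (H : ℝ≥0 → ℝ) : Measurable (quantile H) :=
  (quantile_antitone H).measurable

theorem le_quantile_of_lt (hH : IsTailFunction H) {u : ℝ} {s : ℝ≥0} (h : u < H s) :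
    (s : ℝ≥0∞) ≤ quantile H u := by
  refine le_iInf₂ fun t ht => ?_
  rw [ENNReal.coe_le_coe]
  by_contra hcon
  have := hH.antitone (not_le.1 hcon).le
  linarith

theorem quantile_lt_top (hH : IsTailFunction H) {u : ℝ} (hu : 0 < u) : quantile H u < ⊤ := by
  obtain ⟨t, ht⟩ := (hH.tendsto_zero.eventually (gt_mem_nhds hu)).exists
  exact (quantile_le ht.le).trans_lt ENNReal.coe_lt_top

end Quantile

section AlphaInv
variable {Ω : Type*} {F₀ : MeasurableSpace Ω} [mΩ : MeasurableSpace Ω] {P : Measure Ω}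
  {Y : ℤ → Ω → ℝ} {H : ℝ≥0 → ℝ}

theorem alpha_zero : alpha F₀ P Y 2 0 = 1 / 2 := by simp [alpha]

theorem alpha_anti {m n : ℕ} (hm : 1 ≤ m) (hmn : m ≤ n) :
    alpha F₀ P Y 2 n ≤ alpha F₀ P Y 2 m := by
  rw [alpha, alpha, if_neg (by omega), if_neg (by omega)]
  refine iSup₂_mono fun l hl => ?_
  refine iSup_mono fun i => ?_
  refine iSup_mono' fun h => ⟨⟨h.1, fun j => le_trans (by exact_mod_cast hmn) (h.2 j)⟩, le_rfl⟩

theorem alphaInv_antitone : Antitone (alphaInv F₀ P Y 2) := by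
  intro u u' huu'
  refine le_iInf₂ fun q hq => ?_
  exact iInf₂_le q (hq.trans (ENNReal.ofReal_le_ofReal huu'))

theorem alphaInv_le {u : ℝ} {q : ℕ} (h : alpha F₀ P Y 2 q ≤ ENNReal.ofReal u) :
    alphaInv F₀ P Y 2 u ≤ q :=
  iInf₂_le (f := fun (q : ℕ) (_ : alpha F₀ P Y 2 q ≤ ENNReal.ofReal u) => (q : ℝ≥0∞)) q h

variable (F₀ P Y) in
theorem alphaInv_eq (u : ℝ) : alphaInv F₀ P Y 2 u = ⊤ ∨
    ∃ q : ℕ, alphaInv F₀ P Y 2 u = q ∧ alpha F₀ P Y 2 q ≤ ENNReal.ofReal u := by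
  classical
  by_cases h : ∃ q, alpha F₀ P Y 2 q ≤ ENNReal.ofReal u
  · right
    refine ⟨Nat.find h, le_antisymm (alphaInv_le (Nat.find_spec h)) ?_, Nat.find_spec h⟩
    refine le_iInf₂ fun q hq => ?_
    exact_mod_cast Nat.find_min' h hq
  · left
    push Not at h
    simp only [alphaInv, iInf_eq_top]
    intro q hq
    exact absurd hq (not_le.2 (h q))

theorem one_le_of_alpha_le {u : ℝ} (hu : u < 1 / 2) {q : ℕ}
    (h : alpha F₀ P Y 2 q ≤ ENNReal.ofReal u) : 1 ≤ q := by
  by_contra hq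
  obtain rfl : q = 0 := by omega
  rw [alpha_zero] at h
  have h2 : ENNReal.ofReal (1 / 2) ≤ ENNReal.ofReal u := by
    refine le_trans (le_of_eq ?_) h
    rw [ENNReal.ofReal_div_of_pos (by norm_num)]; simp
  rw [ENNReal.ofReal_le_ofReal_iff'] at h2
  rcases h2 with h2 | h2 <;> linarith

theorem one_le_alphaInv {u : ℝ} (hu : u < 1 / 2) : 1 ≤ alphaInv F₀ P Y 2 u := by
  refine le_iInf₂ fun q hq => ?_
  exact_mod_cast one_le_of_alpha_le hu hq

theorem alphaInv_of_half_le {u : ℝ} (hu : 1 / 2 ≤ u) : alphaInv F₀ P Y 2 u = 0 := by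
  refine le_antisymm ?_ bot_le
  have : alpha F₀ P Y 2 0 ≤ ENNReal.ofReal u := by
    rw [alpha_zero]
    refine le_trans (le_of_eq ?_) (ENNReal.ofReal_le_ofReal hu)
    rw [ENNReal.ofReal_div_of_pos (by norm_num)]; simp
  simpa using alphaInv_le this

/-- The coefficients are capped by the value `1 / 2` at time `0`: they need not be monotone between
the times `0` and `1`. -/
theorem lt_alphaInv {u : ℝ} {k : ℕ} (h : ENNReal.ofReal u < min (alpha F₀ P Y 2 k) (1 / 2)) :
    (k : ℝ≥0∞) < alphaInv F₀ P Y 2 u := by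
  have hu : u < 1 / 2 := by
    by_contra hcon
    refine absurd (h.trans_le (min_le_right _ _)) (not_lt.2 ?_)
    refine le_trans (le_of_eq ?_) (ENNReal.ofReal_le_ofReal (not_lt.1 hcon))
    rw [ENNReal.ofReal_div_of_pos (by norm_num)]; simp
  rcases alphaInv_eq F₀ P Y u with h1 | ⟨q, h1, h2⟩
  · rw [h1]; exact ENNReal.natCast_lt_top k
  · rw [h1]
    have hq := one_le_of_alpha_le hu h2
    by_contra hcon
    have hqk : q ≤ k := by exact_mod_cast not_lt.1 hcon
    exact absurd ((alpha_anti hq hqk).trans h2) (not_le.2 (h.trans_le (min_le_left _ _)))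

open Classical in
/-- The number of coefficients above a level, among the first `q`. -/
theorem sum_alpha_le (u : ℝ) (q : ℕ) :
    ∑ k ∈ Finset.range q, (if ENNReal.ofReal u < min (alpha F₀ P Y 2 k) (1 / 2) then 1 else 0 : ℝ≥0∞)
      ≤ min (q : ℝ≥0∞) (alphaInv F₀ P Y 2 u) := by
  rw [Finset.sum_ite, Finset.sum_const_zero, add_zero, Finset.sum_const, nsmul_eq_mul, mul_one]
  refine le_min ?_ ?_
  · exact_mod_cast (Finset.card_filter_le _ _).trans (by simp)
  · rcases alphaInv_eq F₀ P Y u with h1 | ⟨r, h1, _⟩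
    · rw [h1]; exact le_top
    · rw [h1]
      have : (Finset.range q).filter
          (fun k => ENNReal.ofReal u < min (alpha F₀ P Y 2 k) (1 / 2)) ⊆ Finset.range r := by
        intro k hk
        have := lt_alphaInv (Finset.mem_filter.1 hk).2
        rw [h1] at this
        exact Finset.mem_range.2 (by exact_mod_cast this)
      exact_mod_cast (Finset.card_le_card this).trans (by simp)

theorem R_antitone : Antitone (R F₀ P Y H) := fun _ _ h =>
  mul_le_mul' (alphaInv_antitone h) (quantile_antitone H h)

theorem measurable_R : Measurable (R F₀ P Y H) := R_antitone.measurable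

/-- Lower semicontinuity from the right of the quantile function. -/
theorem exists_gt_lt_quantile (hH : IsTailFunction H) {v : ℝ} {b : ℝ≥0∞}
    (hb : b < quantile H v) : ∃ u > v, b < quantile H u := by
  obtain ⟨c, hbc, hcv⟩ := ENNReal.lt_iff_exists_nnreal_btwn.1 hb
  have hHc : v < H c := by
    by_contra hcon
    exact absurd (quantile_le (not_lt.1 hcon)) (not_le.2 hcv)
  obtain ⟨u, hu, hu'⟩ := exists_between hHc
  exact ⟨u, hu, hbc.trans_le (le_quantile_of_lt hH hu')⟩

/-- Lower semicontinuity from the right of the inverse of the coefficients. The bound `v < 1 / 2`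
keeps the index `0` out of the infimum, as the coefficients are monotone only from time `1` on. -/
theorem exists_gt_lt_alphaInv {v : ℝ} {a : ℝ≥0∞} (hv : v < 1 / 2)
    (ha : a < alphaInv F₀ P Y 2 v) : ∃ u > v, a < alphaInv F₀ P Y 2 u := by
  by_contra! hcon
  refine absurd ha (not_lt.2 ?_)
  by_cases hat : a = ⊤
  · simp [hat]
  lift a to ℝ≥0 using hat
  set n : ℕ := ⌊a⌋₊ with hn
  have key : ∀ u, v < u → u < 1 / 2 → alpha F₀ P Y 2 n ≤ ENNReal.ofReal u := by
    intro u h1 h2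
    have h3 := hcon u h1
    rcases alphaInv_eq F₀ P Y u with h4 | ⟨q, h4, h5⟩
    · rw [h4] at h3; simp at h3
    · rw [h4] at h3
      have hq : q ≤ n := Nat.le_floor (by exact_mod_cast h3)
      exact (alpha_anti (one_le_of_alpha_le h2 h5) hq).trans h5
  have hle : alpha F₀ P Y 2 n ≤ ENNReal.ofReal v := by
    have ht : Tendsto (fun u => ENNReal.ofReal u) (𝓝[>] v) (𝓝 (ENNReal.ofReal v)) :=
      (ENNReal.continuous_ofReal.tendsto v).mono_left nhdsWithin_le_nhds
    refine ge_of_tendsto ht ?_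
    filter_upwards [Ioo_mem_nhdsGT hv] with u hu using key u hu.1 hu.2
  refine (alphaInv_le hle).trans ?_
  exact_mod_cast Nat.floor_le a.2

theorem R_le_of_forall_gt (hH : IsTailFunction H) {v : ℝ} {z : ℝ≥0∞} (hv : v < 1 / 2)
    (h : ∀ u > v, R F₀ P Y H u ≤ z) : R F₀ P Y H v ≤ z := by
  refine ENNReal.mul_le_of_forall_lt fun a ha b hb => ?_
  obtain ⟨u₁, h1, h1'⟩ := exists_gt_lt_alphaInv hv ha
  obtain ⟨u₂, h2, h2'⟩ := exists_gt_lt_quantile hH hb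
  refine le_trans ?_ (h (min u₁ u₂) (lt_min h1 h2))
  exact mul_le_mul' (h1'.le.trans (alphaInv_antitone (min_le_left _ _)))
    (h2'.le.trans (quantile_antitone H (min_le_right _ _)))

variable (F₀ P Y) in
/-- The crossing point of `R` with a level `z`. -/
theorem exists_crossing (hH : IsTailFunction H) (z : ℝ≥0∞) : ∃ v : ℝ, 0 ≤ v ∧ v ≤ 1 / 2 ∧
    (∀ u, 0 ≤ u → u < v → z < R F₀ P Y H u) ∧ (v < 1 / 2 → R F₀ P Y H v ≤ z) := by
  set A : Set ℝ := {u | 0 ≤ u ∧ R F₀ P Y H u ≤ z} with hA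
  have hmem : (1 / 2 : ℝ) ∈ A := ⟨by norm_num, by simp [R, alphaInv_of_half_le]⟩
  have hbdd : BddBelow A := ⟨0, fun u hu => hu.1⟩
  refine ⟨sInf A, le_csInf ⟨_, hmem⟩ fun u hu => hu.1, csInf_le hbdd hmem, ?_, ?_⟩
  · intro u hu hlt
    by_contra hcon
    exact absurd (csInf_le hbdd ⟨hu, not_lt.1 hcon⟩) (not_le.2 hlt)
  · intro hlt
    refine R_le_of_forall_gt hH hlt fun u hu => ?_
    obtain ⟨u', hu', hlt'⟩ := exists_lt_of_csInf_lt ⟨_, hmem⟩ hu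
    exact (R_antitone hlt'.le).trans hu'.2

end AlphaInv

/-! ### Exchange of levels, and the tail integral -/

section Layers
variable {H : ℝ≥0 → ℝ}

/-- The tail function on the real line, extended-nonnegative valued. -/
def tail (H : ℝ≥0 → ℝ) (t : ℝ) : ℝ≥0∞ := ENNReal.ofReal (H t.toNNReal)

theorem measurable_tail (hH : IsTailFunction H) : Measurable (tail H) :=
  ENNReal.measurable_ofReal.comp (hH.antitone.measurable.comp measurable_real_toNNReal)

theorem tail_le_one (hH : IsTailFunction H) (t : ℝ) : tail H t ≤ 1 := by
  rw [tail]; exact ENNReal.ofReal_le_one.2 (hH.mem_Icc _).2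

open Classical in
/-- The indicator of `u < c`, for a real level `u`. -/
def layer (c : ℝ≥0∞) (u : ℝ) : ℝ≥0∞ := if ENNReal.ofReal u < c then 1 else 0

theorem eq_lintegral_layer {c : ℝ≥0∞} (hc : c ≤ 1) :
    ∫⁻ u in Icc (0 : ℝ) 1, layer c u = c := by
  have hct : c ≠ ⊤ := ne_top_of_le_ne_top ENNReal.one_ne_top hc
  have h1 : c.toReal ≤ 1 := by
    simpa using ENNReal.toReal_mono ENNReal.one_ne_top hc
  have e : ∀ u ∈ Icc (0 : ℝ) 1, layer c u = (Ico 0 c.toReal).indicator (fun _ => 1) u := by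
    intro u hu
    by_cases h : u ∈ Ico 0 c.toReal
    · rw [indicator_of_mem h, layer, if_pos ((ENNReal.ofReal_lt_iff_lt_toReal hu.1 hct).2 h.2)]
    · rw [indicator_of_notMem h, layer, if_neg]
      intro h'
      exact h ⟨hu.1, (ENNReal.ofReal_lt_iff_lt_toReal hu.1 hct).1 h'⟩
  rw [setLIntegral_congr_fun measurableSet_Icc e, lintegral_indicator measurableSet_Ico]
  simp only [lintegral_const, one_mul, Measure.restrict_apply MeasurableSet.univ, univ_inter]
  rw [Measure.restrict_apply measurableSet_Ico, inter_eq_left.2, Real.volume_Ico, sub_zero,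
    ENNReal.ofReal_toReal hct]
  exact fun u hu => ⟨hu.1, hu.2.le.trans h1⟩

theorem layer_min (c d : ℝ≥0∞) (u : ℝ) : layer (min c d) u = layer c u * layer d u := by
  simp only [layer, lt_min_iff]
  split_ifs <;> simp_all

theorem measurable_layer {γ : Type*} [MeasurableSpace γ] {c : γ → ℝ≥0∞} {g : γ → ℝ}
    (hc : Measurable c) (hg : Measurable g) : Measurable fun x => layer (c x) (g x) :=
  Measurable.ite (measurableSet_lt (ENNReal.measurable_ofReal.comp hg) hc) measurable_const
    measurable_const

theorem layer_tail_le (hH : IsTailFunction H) {t u : ℝ} (hu : 0 ≤ u)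
    (h : layer (tail H t) u ≠ 0) : ENNReal.ofReal t ≤ quantile H u := by
  have h' : ENNReal.ofReal u < tail H t := by
    by_contra hcon; exact h (if_neg hcon)
  refine le_quantile_of_lt hH (s := t.toNNReal) ?_
  exact (ENNReal.ofReal_lt_ofReal_iff_of_nonneg hu).1 h'

/-- `∫_0^∞ 1_{u < H(t)} dt ≤ Q(u)`. -/
theorem lintegral_layer_tail_le (hH : IsTailFunction H) {u : ℝ} (hu : 0 ≤ u) :
    ∫⁻ t in Ioi (0 : ℝ), layer (tail H t) u ≤ quantile H u := by
  by_cases hq : quantile H u = ⊤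
  · rw [hq]; exact le_top
  calc ∫⁻ t in Ioi (0 : ℝ), layer (tail H t) u
      ≤ ∫⁻ t in Ioi (0 : ℝ), (Ioc 0 (quantile H u).toReal).indicator (fun _ => 1) t := by
        refine setLIntegral_mono' measurableSet_Ioi fun t ht => ?_
        by_cases h : layer (tail H t) u = 0
        · rw [h]; exact bot_le
        · have h2 := layer_tail_le hH hu h
          have h3 : t ≤ (quantile H u).toReal := (ENNReal.ofReal_le_iff_le_toReal hq).1 h2
          rw [indicator_of_mem (show t ∈ Ioc 0 (quantile H u).toReal from ⟨ht, h3⟩), layer]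
          split_ifs <;> simp
    _ ≤ ∫⁻ t, (Ioc 0 (quantile H u).toReal).indicator (fun _ => 1) t :=
        setLIntegral_le_lintegral _ _
    _ = quantile H u := by
        rw [lintegral_indicator measurableSet_Ioc]
        simp [ENNReal.ofReal_toReal hq]

theorem lintegral_layer_tail_le_min (hH : IsTailFunction H) {u : ℝ} (hu : 0 ≤ u) (M : ℝ≥0) :
    ∫⁻ t in Ioc (0 : ℝ) M, layer (tail H t) u ≤ min (quantile H u) M := by
  refine le_min ?_ ?_
  · refine le_trans ?_ (lintegral_layer_tail_le hH hu)
    exact lintegral_mono_set Ioc_subset_Ioi_self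
  · calc ∫⁻ t in Ioc (0 : ℝ) M, layer (tail H t) u ≤ ∫⁻ t in Ioc (0 : ℝ) M, 1 := by
          refine lintegral_mono fun t => ?_
          show layer (tail H t) u ≤ 1
          rw [layer]; split_ifs <;> simp
      _ = M := by simp

/-- `∫_M^∞ H ≤ ∫_0^v Q` when `Q ≤ M` beyond `v`. -/
theorem lintegral_tail_le (hH : IsTailFunction H) {v : ℝ} {M : ℝ≥0}
    (hv : ∀ u, v ≤ u → u ≤ 1 → quantile H u ≤ M) :
    ∫⁻ t in Ioi (M : ℝ), tail H t ≤ ∫⁻ u in Icc (0 : ℝ) 1, (Iio v).indicator (quantile H) u := by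
  calc ∫⁻ t in Ioi (M : ℝ), tail H t
      = ∫⁻ t in Ioi (M : ℝ), ∫⁻ u in Icc (0 : ℝ) 1, layer (tail H t) u := by
        simp_rw [eq_lintegral_layer (tail_le_one hH _)]
    _ = ∫⁻ u in Icc (0 : ℝ) 1, ∫⁻ t in Ioi (M : ℝ), layer (tail H t) u := by
        refine lintegral_lintegral_swap ?_
        exact (measurable_layer ((measurable_tail hH).comp measurable_fst)
          measurable_snd).aemeasurable
    _ ≤ _ := by
        refine setLIntegral_mono' measurableSet_Icc fun u hu => ?_
        by_cases huv : u < v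
        · rw [indicator_of_mem (mem_Iio.2 huv)]
          refine le_trans ?_ (lintegral_layer_tail_le hH hu.1)
          exact lintegral_mono_set (Ioi_subset_Ioi M.2)
        · rw [indicator_of_notMem (by simpa using huv)]
          refine le_of_eq ?_
          rw [← lintegral_zero (μ := volume.restrict (Ioi (M : ℝ)))]
          refine setLIntegral_congr_fun measurableSet_Ioi fun t ht => ?_
          by_contra h
          have ht' : (M : ℝ) < t := ht
          have h2 := (layer_tail_le hH hu.1 h).trans
            (hv u (not_lt.1 huv) hu.2)
          have h3 : ENNReal.ofReal t ≤ ENNReal.ofReal M := by simpa using h2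
          have := (ENNReal.ofReal_le_ofReal_iff M.2).1 h3
          exact absurd this (not_le.2 ht')

/-- `M v ≤ ∫_0^v Q` when `M ≤ Q` below `v`. -/
theorem mul_le_lintegral_quantile {v : ℝ} {M : ℝ≥0} (hv1 : v ≤ 1)
    (h : ∀ u, 0 ≤ u → u < v → (M : ℝ≥0∞) ≤ quantile H u) :
    (M : ℝ≥0∞) * ENNReal.ofReal v ≤ ∫⁻ u in Icc (0 : ℝ) 1, (Iio v).indicator (quantile H) u := by
  calc (M : ℝ≥0∞) * ENNReal.ofReal v = ∫⁻ _ in Ico (0 : ℝ) v, (M : ℝ≥0∞) := by simp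
    _ = ∫⁻ u in Ico (0 : ℝ) v, (Iio v).indicator (fun _ => (M : ℝ≥0∞)) u := by
        refine setLIntegral_congr_fun measurableSet_Ico fun u hu => ?_
        exact (indicator_of_mem (mem_Iio.2 hu.2) (fun _ => (M : ℝ≥0∞))).symm
    _ ≤ ∫⁻ u in Ico (0 : ℝ) v, (Iio v).indicator (quantile H) u := by
        refine setLIntegral_mono' measurableSet_Ico fun u hu => ?_
        rw [indicator_of_mem (mem_Iio.2 hu.2), indicator_of_mem (mem_Iio.2 hu.2)]
        exact h u hu.1 hu.2
    _ ≤ _ := lintegral_mono_set (Ico_subset_Icc_self.trans (Icc_subset_Icc_right hv1))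

/-- Exchange of the levels in the covariance bound:
`∫∫ min (c, H s, H t) ds dt` is the integral of the squared layer measures. -/
theorem lintegral_min_tail (hH : IsTailFunction H) {c : ℝ≥0∞} (hc : c ≤ 1) (M : ℝ) :
    ∫⁻ s in Ioc (0 : ℝ) M, ∫⁻ t in Ioc (0 : ℝ) M, min c (min (tail H s) (tail H t)) =
    ∫⁻ u in Icc (0 : ℝ) 1, layer c u * (∫⁻ t in Ioc (0 : ℝ) M, layer (tail H t) u) ^ 2 := by
  have m1 : Measurable fun u => ∫⁻ t in Ioc (0 : ℝ) M, layer (tail H t) u :=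
    Measurable.lintegral_prod_right'
      (f := fun p : ℝ × ℝ => layer (tail H p.2) p.1)
      (measurable_layer ((measurable_tail hH).comp measurable_snd) measurable_fst)
  have m2 : Measurable fun u => layer c u := measurable_layer measurable_const measurable_id
  have m3 : ∀ u, Measurable fun t => layer (tail H t) u := fun u =>
    measurable_layer (measurable_tail hH) measurable_const
  have m4 : ∀ s, Measurable fun u => layer (tail H s) u := fun u =>
    measurable_layer measurable_const measurable_id
  have m5 : Measurable fun p : ℝ × ℝ => layer (tail H p.1) p.2 :=
    measurable_layer ((measurable_tail hH).comp measurable_fst) measurable_snd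
  calc _ = ∫⁻ s in Ioc (0 : ℝ) M, ∫⁻ t in Ioc (0 : ℝ) M, ∫⁻ u in Icc (0 : ℝ) 1,
        layer c u * (layer (tail H s) u * layer (tail H t) u) := by
        refine lintegral_congr fun s => lintegral_congr fun t => ?_
        rw [← eq_lintegral_layer ((min_le_left c (min (tail H s) (tail H t))).trans hc)]
        refine lintegral_congr fun u => ?_
        rw [layer_min, layer_min]
    _ = ∫⁻ s in Ioc (0 : ℝ) M, ∫⁻ u in Icc (0 : ℝ) 1,
        layer (tail H s) u * (layer c u * ∫⁻ t in Ioc (0 : ℝ) M, layer (tail H t) u) := by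
        refine lintegral_congr fun s => ?_
        rw [lintegral_lintegral_swap]
        · refine lintegral_congr fun u => ?_
          rw [← lintegral_const_mul _ (m3 u), ← lintegral_const_mul _ ((m3 u).const_mul _)]
          refine lintegral_congr fun t => ?_
          ring
        · exact ((m2.comp measurable_snd).mul (((m4 s).comp measurable_snd).mul m5)).aemeasurable
    _ = _ := by
        rw [lintegral_lintegral_swap]
        · refine lintegral_congr fun u => ?_
          rw [lintegral_mul_const _ (m3 u)]
          ring
        · exact (m5.mul ((m2.mul m1).comp measurable_snd)).aemeasurable

end Layers

section Tail
variable {Ω : Type*} {F₀ : MeasurableSpace Ω} [mΩ : MeasurableSpace Ω] {P : Measure Ω}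
  {Y : ℤ → Ω → ℝ} {H : ℝ≥0 → ℝ}

/-- The sum of the layered covariance bounds is at most `∫ min (q, α⁻¹) min (Q, M)²`. -/
theorem sum_lintegral_min_le (hH : IsTailFunction H) (q : ℕ) (M : ℝ≥0) :
    ∑ k ∈ Finset.range q, ∫⁻ s in Ioc (0 : ℝ) M, ∫⁻ t in Ioc (0 : ℝ) M,
      min (min (alpha F₀ P Y 2 k) (1 / 2)) (min (tail H s) (tail H t)) ≤
    ∫⁻ u in Icc (0 : ℝ) 1, min (q : ℝ≥0∞) (alphaInv F₀ P Y 2 u) * min (quantile H u) M ^ 2 := by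
  have h12 : ∀ c : ℝ≥0∞, min c (1 / 2) ≤ 1 := fun c => by
    refine (min_le_right _ _).trans ?_
    simp
  simp_rw [lintegral_min_tail hH (h12 _)]
  rw [← lintegral_finsetSum]
  · refine setLIntegral_mono' measurableSet_Icc fun u hu => ?_
    rw [← Finset.sum_mul]
    refine mul_le_mul' ?_ (pow_le_pow_left' (lintegral_layer_tail_le_min hH hu.1 M) 2)
    exact sum_alpha_le u q
  · intro k _
    refine Measurable.mul (measurable_layer measurable_const measurable_id) (Measurable.pow_const ?_ 2)
    exact Measurable.lintegral_prod_right'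
      (f := fun p : ℝ × ℝ => layer (tail H p.2) p.1)
      (measurable_layer ((measurable_tail hH).comp measurable_snd) measurable_fst)

/-- Interpolation of the variance bound. At levels `u < v` the truncation gives `q M ≤ z ≤ R(u)`,
and at the other levels `α⁻¹ Q = R ≤ z`. -/
theorem lintegral_min_sq_le {s : ℝ} (hs1 : 1 ≤ s) (hs2 : s ≤ 2) {v : ℝ} {z : ℝ≥0∞} {q : ℕ}
    {M : ℝ≥0} (hqM : (q : ℝ≥0∞) * M ≤ z)
    (hlt : ∀ u, 0 ≤ u → u < v → z < R F₀ P Y H u) (hle : ∀ u, v ≤ u → R F₀ P Y H u ≤ z) :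
    ∫⁻ u in Icc (0 : ℝ) 1, min (q : ℝ≥0∞) (alphaInv F₀ P Y 2 u) * min (quantile H u) M ^ 2 ≤
      z ^ (2 - s) * ∫⁻ u in Icc (0 : ℝ) 1, quantile H u * R F₀ P Y H u ^ (s - 1) := by
  have hsplit : ∀ w : ℝ≥0∞, w = w ^ (2 - s) * w ^ (s - 1) := fun w => by
    rw [← ENNReal.rpow_add_of_nonneg _ _ (by linarith) (by linarith)]
    norm_num
  have hm : Measurable fun u => quantile H u * R F₀ P Y H u ^ (s - 1) :=
    (measurable_quantile H).mul (measurable_R.pow_const _)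
  rw [← lintegral_const_mul _ hm]
  refine setLIntegral_mono' measurableSet_Icc fun u hu => ?_
  rcases lt_or_ge u v with h | h
  · calc min (q : ℝ≥0∞) (alphaInv F₀ P Y 2 u) * min (quantile H u) M ^ 2
        ≤ (q * M) * quantile H u := by
          rw [sq, mul_assoc, mul_comm (min (quantile H u) (M : ℝ≥0∞))]
          exact mul_le_mul' (min_le_left _ _) (mul_le_mul' (min_le_right _ _) (min_le_left _ _))
      _ ≤ z * quantile H u := mul_le_mul' hqM le_rfl
      _ = z ^ (2 - s) * (quantile H u * z ^ (s - 1)) := by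
          conv_lhs => rw [hsplit z]
          ring
      _ ≤ _ := by
          refine mul_le_mul' le_rfl (mul_le_mul' le_rfl ?_)
          exact ENNReal.rpow_le_rpow (hlt u hu.1 h).le (by linarith)
  · calc min (q : ℝ≥0∞) (alphaInv F₀ P Y 2 u) * min (quantile H u) M ^ 2
        ≤ alphaInv F₀ P Y 2 u * (quantile H u * quantile H u) := by
          rw [sq]
          exact mul_le_mul' (min_le_right _ _) (mul_le_mul' (min_le_left _ _) (min_le_left _ _))
      _ = R F₀ P Y H u ^ (2 - s) * (quantile H u * R F₀ P Y H u ^ (s - 1)) := by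
          rw [mul_left_comm (R F₀ P Y H u ^ (2 - s)), ← hsplit, mul_left_comm]; rfl
      _ ≤ _ := by
          refine mul_le_mul' ?_ le_rfl
          exact ENNReal.rpow_le_rpow (hle u h) (by linarith)

variable (F₀ P Y H) in
/-- The smoothed tail integral `∫_0^1 Q(u) min(1, R(u)/y)^m du`. It dominates
`∫_0^1 Q(u) 1_{R(u) > y} du`, and unlike the latter it changes by at most a constant factor when
`y` does. -/
def tailInt (m : ℕ) (y : ℝ) : ℝ≥0∞ :=
  ∫⁻ u in Icc (0 : ℝ) 1, quantile H u * min 1 (R F₀ P Y H u / ENNReal.ofReal y) ^ m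

theorem tailInt_le (m : ℕ) (y : ℝ) :
    tailInt F₀ P Y H m y ≤ ∫⁻ u in Icc (0 : ℝ) 1, quantile H u := by
  refine lintegral_mono fun u => ?_
  exact mul_le_of_le_one_right bot_le (pow_le_one' (min_le_left _ _) m)

/-- `∫_0^v Q` is at most `K^m` times the tail integral at `y` when `R > y / K` below `v`. -/
theorem lintegral_quantile_le_tailInt (m : ℕ) {y K : ℝ} (hy : 0 < y) (hK : 1 ≤ K) {v : ℝ}
    (hlt : ∀ u, 0 ≤ u → u < v → ENNReal.ofReal (y / K) < R F₀ P Y H u) :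
    ∫⁻ u in Icc (0 : ℝ) 1, (Iio v).indicator (quantile H) u ≤
      ENNReal.ofReal K ^ m * tailInt F₀ P Y H m y := by
  have hK0 : 0 < K := by linarith
  rw [tailInt, ← lintegral_const_mul' _ _ (by simp)]
  refine setLIntegral_mono' measurableSet_Icc fun u hu => ?_
  by_cases h : u < v
  · rw [indicator_of_mem (mem_Iio.2 h)]
    have h1 : 1 ≤ ENNReal.ofReal K * min 1 (R F₀ P Y H u / ENNReal.ofReal y) := by
      rw [mul_min, mul_one]
      refine le_min (ENNReal.one_le_ofReal.2 hK) ?_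
      calc (1 : ℝ≥0∞) = ENNReal.ofReal K * (ENNReal.ofReal (y / K) / ENNReal.ofReal y) := by
            rw [← ENNReal.ofReal_div_of_pos hy, ← ENNReal.ofReal_mul hK0.le]
            rw [← ENNReal.ofReal_one]; congr 1; field_simp
        _ ≤ _ := mul_le_mul' le_rfl (ENNReal.div_le_div_right (hlt u hu.1 h).le _)
    calc quantile H u = quantile H u * 1 := (mul_one _).symm
      _ ≤ quantile H u * (ENNReal.ofReal K * min 1 (R F₀ P Y H u / ENNReal.ofReal y)) ^ m :=
          mul_le_mul' le_rfl (one_le_pow_of_one_le' h1 m)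
      _ = _ := by rw [mul_pow]; ring
  · rw [indicator_of_notMem (by simpa using h)]; exact bot_le

theorem tailInt_mul_le (m : ℕ) {y θ : ℝ} (hθ : 0 < θ) (hθ1 : θ ≤ 1) :
    tailInt F₀ P Y H m (θ * y) ≤ ENNReal.ofReal (θ⁻¹) ^ m * tailInt F₀ P Y H m y := by
  rw [tailInt, tailInt, ← lintegral_const_mul' _ _ (by simp)]
  refine lintegral_mono fun u => ?_
  show quantile H u * _ ≤ _
  rw [mul_left_comm, ← mul_pow]
  refine mul_le_mul' le_rfl (pow_le_pow_left' ?_ m)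
  rw [mul_min, mul_one]
  refine min_le_min (ENNReal.one_le_ofReal.2 ((one_le_inv₀ hθ).2 hθ1)) ?_
  rw [ENNReal.ofReal_mul hθ.le, ENNReal.ofReal_inv_of_pos hθ, div_eq_mul_inv, div_eq_mul_inv,
    ENNReal.mul_inv (Or.inl (by simpa using hθ)) (Or.inl ENNReal.ofReal_ne_top), mul_left_comm]

end Tail

/-! ### Observables and their layers -/

/-- Indicator of a set of reals, as a real function. -/
def ind (D : Set ℝ) : ℝ → ℝ := D.indicator fun _ => 1

theorem ind_nonneg (D : Set ℝ) (y : ℝ) : 0 ≤ ind D y := indicator_nonneg (fun _ _ => zero_le_one) _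

theorem ind_le_one (D : Set ℝ) (y : ℝ) : ind D y ≤ 1 :=
  indicator_le_self' (s := D) (f := fun _ => (1 : ℝ)) (fun _ _ => zero_le_one) y

theorem abs_ind_le (D : Set ℝ) (y : ℝ) : |ind D y| ≤ 1 := by
  rw [abs_of_nonneg (ind_nonneg D y)]; exact ind_le_one D y

theorem measurable_ind {D : Set ℝ} (hD : MeasurableSet D) : Measurable (ind D) :=
  measurable_const.indicator hD

/-- Lower sets of reals are pointwise limits of closed half-lines; they may be open, empty or the
whole line, which the definition of the dependence coefficients does not allow directly. -/
theorem exists_tendsto_ind_of_isLowerSet {D : Set ℝ} (hD : IsLowerSet D) :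
    ∃ x : ℕ → ℝ, ∀ y, Tendsto (fun n => ind (Iic (x n)) y) atTop (𝓝 (ind D y)) := by
  suffices h : ∃ x : ℕ → ℝ, ∀ y, ∀ᶠ n in atTop, (y ≤ x n ↔ y ∈ D) by
    obtain ⟨x, hx⟩ := h
    refine ⟨x, fun y => tendsto_const_nhds.congr' ?_⟩
    filter_upwards [hx y] with n hn
    by_cases hy : y ∈ D
    · rw [ind, ind, indicator_of_mem hy, indicator_of_mem (mem_Iic.2 (hn.2 hy))]
    · rw [ind, ind, indicator_of_notMem hy, indicator_of_notMem (by simpa using mt hn.1 hy)]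
  rcases D.eq_empty_or_nonempty with rfl | hne
  · refine ⟨fun n => -(n : ℝ), fun y => ?_⟩
    filter_upwards [eventually_gt_atTop ⌈-y⌉₊] with n hn
    have h1 := Nat.le_ceil (-y)
    have h2 : (⌈-y⌉₊ : ℝ) < n := by exact_mod_cast hn
    simp only [mem_empty_iff_false, iff_false, not_le]
    linarith
  by_cases hu : D = univ
  · refine ⟨fun n => n, fun y => ?_⟩
    filter_upwards [eventually_ge_atTop ⌈y⌉₊] with n hn
    have h1 := Nat.le_ceil y
    have h2 : (⌈y⌉₊ : ℝ) ≤ n := by exact_mod_cast hn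
    simp only [hu, mem_univ, iff_true]
    linarith
  obtain ⟨w, hw⟩ := (ne_univ_iff_exists_notMem D).1 hu
  have hbdd : BddAbove D := ⟨w, fun y hy => by
    by_contra hcon
    exact hw (hD (not_le.1 hcon).le hy)⟩
  by_cases hs : sSup D ∈ D
  · refine ⟨fun _ => sSup D, fun y => Eventually.of_forall fun n => ?_⟩
    exact ⟨fun h => hD h hs, fun h => le_csSup hbdd h⟩
  · refine ⟨fun n => sSup D - 1 / ((n : ℝ) + 1), fun y => ?_⟩
    have ht : Tendsto (fun n : ℕ => sSup D - 1 / ((n : ℝ) + 1)) atTop (𝓝 (sSup D - 0)) :=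
      tendsto_const_nhds.sub tendsto_one_div_add_atTop_nhds_zero_nat
    rw [sub_zero] at ht
    rcases lt_or_ge y (sSup D) with hy | hy
    · filter_upwards [ht.eventually (lt_mem_nhds hy)] with n hn
      obtain ⟨y', hy', hlt⟩ := exists_lt_of_lt_csSup hne hy
      exact ⟨fun _ => hD hlt.le hy', fun _ => hn.le⟩
    · refine Eventually.of_forall fun n => ?_
      have hp : 0 < 1 / ((n : ℝ) + 1) := by positivity
      constructor
      · intro h; linarith
      · intro h
        have := le_csSup hbdd h
        exact absurd (le_antisymm this hy ▸ h) hs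

theorem exists_isLowerSet_sub_of_ordConnected {J : Set ℝ} (hJ : J.OrdConnected) :
    ∃ D D' : Set ℝ, IsLowerSet D ∧ IsLowerSet D' ∧ ∀ y, ind J y = ind D y - ind D' y := by
  refine ⟨lowerClosure J, (lowerClosure J : Set ℝ) \ J, (lowerClosure J).lower, ?_, fun y => ?_⟩
  · rintro a b hba ⟨ha, haJ⟩
    refine ⟨(lowerClosure J).lower hba ha, fun hb => haJ ?_⟩
    obtain ⟨c, hc, hac⟩ := mem_lowerClosure.1 ha
    exact hJ.out hb hc ⟨hba, hac⟩
  · have hsub : J ⊆ lowerClosure J := subset_lowerClosure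
    by_cases h1 : y ∈ J
    · have h2 := hsub h1
      simp only [ind, indicator, h1, h2, Set.mem_sdiff, if_true, not_true, and_false, if_false, sub_zero]
    · by_cases h2 : y ∈ (lowerClosure J : Set ℝ)
      · simp only [ind, indicator, h1, h2, Set.mem_sdiff, if_true, not_false_iff, and_true, if_false,
          sub_self]
      · simp only [ind, indicator, h1, h2, Set.mem_sdiff, false_and, if_false, sub_self]

theorem measurableSet_of_isLowerSet {D : Set ℝ} (hD : IsLowerSet D) : MeasurableSet D :=
  hD.ordConnected.measurableSet

section Obs
variable {Ω : Type*} [mΩ : MeasurableSpace Ω] {P : Measure Ω} [IsProbabilityMeasure P]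
  {Y : ℤ → Ω → ℝ}

omit [IsProbabilityMeasure P] in
theorem measurable_obs (hY : ∀ i, Measurable (Y i)) {g : ℝ → ℝ} (hg : Measurable g) (i : ℤ) :
    Measurable (obs P Y g i) :=
  (hg.comp (hY i)).sub_const _

theorem integrable_comp (hY : ∀ i, Measurable (Y i)) {g : ℝ → ℝ} (hg : Measurable g) {b : ℝ}
    (hb : ∀ y, |g y| ≤ b) (i : ℤ) : Integrable (fun ω => g (Y i ω)) P :=
  integrable_of_abs_le (hg.comp (hY i)) b fun _ => hb _

theorem abs_obs_le {g : ℝ → ℝ} {c d : ℝ} (hY : ∀ i, Measurable (Y i)) (hg : Measurable g)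
    (hc : ∀ y, c ≤ g y) (hd : ∀ y, g y ≤ d) (i : ℤ) (ω : Ω) : |obs P Y g i ω| ≤ d - c := by
  have hi : Integrable (fun ω => g (Y i ω)) P := integrable_comp hY hg (b := |c| + |d|)
    (fun y => abs_le.2 ⟨by linarith [neg_abs_le c, abs_nonneg d, hc y],
      by linarith [le_abs_self d, abs_nonneg c, hd y]⟩) i
  have h1 : ∫ ω, g (Y i ω) ∂P ≤ d := by
    simpa using integral_mono hi (integrable_const d) fun ω => hd (Y i ω)
  have h2 : c ≤ ∫ ω, g (Y i ω) ∂P := by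
    simpa using integral_mono (integrable_const c) hi fun ω => hc (Y i ω)
  rw [obs, centered, abs_le]
  have := hc (Y i ω); have := hd (Y i ω)
  constructor <;> linarith

theorem abs_obs_ind_le (hY : ∀ i, Measurable (Y i)) {D : Set ℝ} (hD : MeasurableSet D) (i : ℤ)
    (ω : Ω) : |obs P Y (ind D) i ω| ≤ 1 := by
  simpa using abs_obs_le (P := P) hY (measurable_ind hD) (ind_nonneg D) (ind_le_one D) i ω

theorem obs_sub (hY : ∀ i, Measurable (Y i)) {g g' : ℝ → ℝ} (hg : Measurable g)
    (hg' : Measurable g') {b b' : ℝ} (hb : ∀ y, |g y| ≤ b) (hb' : ∀ y, |g' y| ≤ b') (i : ℤ) (ω : Ω) :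
    obs P Y (fun y => g y - g' y) i ω = obs P Y g i ω - obs P Y g' i ω := by
  simp only [obs, centered]
  rw [integral_sub (integrable_comp hY hg hb i) (integrable_comp hY hg' hb' i)]
  ring

/-- Centring may be moved from one factor of a product to the other. -/
theorem integral_mul_obs (hY : ∀ i, Measurable (Y i)) {g : ℝ → ℝ} (hg : Measurable g) {b : ℝ}
    (hb : ∀ y, |g y| ≤ b) {W : Ω → ℝ} (hW : Measurable W) {w : ℝ} (hw : ∀ ω, |W ω| ≤ w) (i : ℤ) :
    ∫ ω, W ω * obs P Y g i ω ∂P = ∫ ω, (W ω - ∫ ω', W ω' ∂P) * g (Y i ω) ∂P := by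
  have h1 : Integrable W P := integrable_of_abs_le hW w hw
  have h2 := integrable_comp (P := P) hY hg hb i
  have h3 : Integrable (fun ω => W ω * g (Y i ω)) P := by
    refine integrable_of_abs_le (hW.mul (hg.comp (hY i))) (w * b) fun ω => ?_
    rw [abs_mul]
    exact mul_le_mul (hw ω) (hb _) (abs_nonneg _) ((abs_nonneg _).trans (hw ω))
  simp only [obs, centered, mul_sub, sub_mul]
  rw [integral_sub h3 (h1.mul_const _), integral_sub h3 (h2.const_mul _), integral_mul_const,
    integral_const_mul]

theorem tendsto_obs (hY : ∀ i, Measurable (Y i)) {g : ℕ → ℝ → ℝ} {g' : ℝ → ℝ}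
    (hg : ∀ n, Measurable (g n)) {b : ℝ} (hb : ∀ n y, |g n y| ≤ b)
    (h : ∀ y, Tendsto (fun n => g n y) atTop (𝓝 (g' y))) (i : ℤ) (ω : Ω) :
    Tendsto (fun n => obs P Y (g n) i ω) atTop (𝓝 (obs P Y g' i ω)) := by
  refine (h _).sub ?_
  refine tendsto_integral_of_dominated_convergence (fun _ => b)
    (fun n => ((hg n).comp (hY i)).aestronglyMeasurable) (integrable_const b)
    (fun n => ae_of_all _ fun ω => hb n _) (ae_of_all _ fun ω => h _)

/-- Layer-cake representation of a correlation with a bounded function. -/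
theorem enorm_integral_mul_obs_le (hY : ∀ i, Measurable (Y i)) {h : ℝ → ℝ} (hh : Measurable h)
    {M : ℝ≥0} (h0 : ∀ y, 0 ≤ h y) (hM : ∀ y, h y ≤ M) {W : Ω → ℝ} (hW : Measurable W) {w : ℝ}
    (hw : ∀ ω, |W ω| ≤ w) (i : ℤ) :
    ‖∫ ω, W ω * obs P Y h i ω ∂P‖ₑ ≤
      ∫⁻ t in Ioc (0 : ℝ) M, ‖∫ ω, W ω * obs P Y (ind {y | t < h y}) i ω ∂P‖ₑ := by
  have hbM : ∀ y, |h y| ≤ M := fun y => by rw [abs_of_nonneg (h0 y)]; exact hM y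
  have hms : ∀ t, MeasurableSet {y | t < h y} := fun t => measurableSet_lt measurable_const hh
  have hcake : ∀ y, h y = ∫ t in Ioc (0 : ℝ) M, ind {y | t < h y} y := by
    intro y
    have e : ∀ t ∈ Ioc (0 : ℝ) M, ind {y | t < h y} y = (Ioo 0 (h y)).indicator (fun _ => 1) t := by
      intro t ht
      by_cases hty : t < h y
      · rw [ind, indicator_of_mem (show y ∈ {y | t < h y} from hty),
          indicator_of_mem (show t ∈ Ioo 0 (h y) from ⟨ht.1, hty⟩)]
      · rw [ind, indicator_of_notMem (show y ∉ {y | t < h y} from hty),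
          indicator_of_notMem (show t ∉ Ioo 0 (h y) from fun h' => hty h'.2)]
    rw [setIntegral_congr_fun measurableSet_Ioc e, integral_indicator measurableSet_Ioo,
      Measure.restrict_restrict measurableSet_Ioo, inter_eq_left.2]
    · simp [h0 y]
    · exact fun t ht => ⟨ht.1, ht.2.le.trans (hM y)⟩
  set W' : Ω → ℝ := fun ω => W ω - ∫ ω', W ω' ∂P with hW'
  have hW'm : Measurable W' := hW.sub_const _
  have e : ∫ ω, W ω * obs P Y h i ω ∂P =
      ∫ t in Ioc (0 : ℝ) M, ∫ ω, W ω * obs P Y (ind {y | t < h y}) i ω ∂P := by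
    rw [integral_mul_obs hY hh hbM hW hw]
    calc ∫ ω, W' ω * h (Y i ω) ∂P
        = ∫ ω, (∫ t in Ioc (0 : ℝ) M, W' ω * ind {y | t < h y} (Y i ω)) ∂P := by
          refine integral_congr_ae (ae_of_all _ fun ω => ?_)
          show W' ω * h (Y i ω) = ∫ t in Ioc (0 : ℝ) M, W' ω * ind {y | t < h y} (Y i ω)
          rw [integral_const_mul, ← hcake]
      _ = ∫ t in Ioc (0 : ℝ) M, ∫ ω, W' ω * ind {y | t < h y} (Y i ω) ∂P := by
          refine integral_integral_swap ?_
          refine Integrable.of_bound (C := 2 * w * 1) ?_ (ae_of_all _ fun p => ?_)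
          · refine Measurable.aestronglyMeasurable ?_
            refine (hW'm.comp measurable_fst).mul ?_
            have : MeasurableSet {p : Ω × ℝ | p.2 < h (Y i p.1)} :=
              measurableSet_lt measurable_snd ((hh.comp (hY i)).comp measurable_fst)
            exact (measurable_const (a := (1 : ℝ))).indicator this
          · simp only [Function.uncurry, norm_mul, Real.norm_eq_abs]
            have h1 : |W' p.1| ≤ 2 * w := by
              have h2 : |∫ ω', W ω' ∂P| ≤ w := by
                simpa using norm_integral_le_of_norm_le_const (μ := P) (f := W) (C := w) (ae_of_all _ hw)
              have := abs_sub (W p.1) (∫ ω', W ω' ∂P)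
              have := hw p.1
              show |W p.1 - _| ≤ _
              linarith
            exact mul_le_mul h1 (abs_ind_le _ _) (abs_nonneg _) ((abs_nonneg _).trans h1)
      _ = _ := by
          refine integral_congr_ae (ae_of_all _ fun t => ?_)
          exact (integral_mul_obs hY (measurable_ind (hms t)) (abs_ind_le _) hW hw i).symm
  rw [e]
  exact enorm_integral_le_lintegral_enorm _

/-- Layer-cake representation of a correlation of two observables with a bounded function. -/
theorem enorm_integral_mul_obs_mul_obs_le (hY : ∀ i, Measurable (Y i)) {h h' : ℝ → ℝ}
    (hh : Measurable h) (hh' : Measurable h') {M : ℝ≥0} (h0 : ∀ y, 0 ≤ h y) (hM : ∀ y, h y ≤ M)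
    (h0' : ∀ y, 0 ≤ h' y) (hM' : ∀ y, h' y ≤ M) {W : Ω → ℝ} (hW : Measurable W) {w : ℝ}
    (hw : ∀ ω, |W ω| ≤ w) (i j : ℤ) :
    ‖∫ ω, W ω * obs P Y h i ω * obs P Y h' j ω ∂P‖ₑ ≤
      ∫⁻ s in Ioc (0 : ℝ) M, ∫⁻ t in Ioc (0 : ℝ) M,
        ‖∫ ω, W ω * obs P Y (ind {y | s < h y}) i ω * obs P Y (ind {y | t < h' y}) j ω ∂P‖ₑ := by
  have hms : ∀ t, MeasurableSet {y | t < h y} := fun t => measurableSet_lt measurable_const hh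
  have key : ∀ {g₁ : ℝ → ℝ} {b : ℝ}, Measurable g₁ → (∀ i ω, |obs P Y g₁ i ω| ≤ b) → ∀ i ω,
      |W ω * obs P Y g₁ i ω| ≤ w * b := by
    intro g₁ b _ hb i ω
    rw [abs_mul]
    exact mul_le_mul (hw ω) (hb i ω) (abs_nonneg _) ((abs_nonneg _).trans (hw ω))
  have e : ∀ (a b c : ℝ), a * b * c = a * c * b := fun a b c => by ring
  calc ‖∫ ω, W ω * obs P Y h i ω * obs P Y h' j ω ∂P‖ₑ
      = ‖∫ ω, W ω * obs P Y h' j ω * obs P Y h i ω ∂P‖ₑ := by simp_rw [e _ (obs P Y h i _)]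
    _ ≤ ∫⁻ s in Ioc (0 : ℝ) M,
        ‖∫ ω, W ω * obs P Y h' j ω * obs P Y (ind {y | s < h y}) i ω ∂P‖ₑ :=
        enorm_integral_mul_obs_le hY hh h0 hM (hW.mul (measurable_obs hY hh' j))
          (key hh' (abs_obs_le hY hh' h0' hM') j) i
    _ ≤ _ := by
        refine lintegral_mono fun s => ?_
        show ‖∫ ω, W ω * obs P Y h' j ω * obs P Y (ind {y | s < h y}) i ω ∂P‖ₑ ≤ _
        simp_rw [e _ (obs P Y h' j _)]
        exact enorm_integral_mul_obs_le hY hh' h0' hM'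
          (hW.mul (measurable_obs hY (measurable_ind (hms s)) i))
          (key (measurable_ind (hms s)) (abs_obs_ind_le hY (hms s)) i) j

end Obs

/-! ### Duality bounds by the dependence coefficients -/

section Dual
variable {Ω : Type*} {F₀ : MeasurableSpace Ω} [mΩ : MeasurableSpace Ω] {P : Measure Ω}
  [IsProbabilityMeasure P] {Y : ℤ → Ω → ℝ}

/-- The `L¹` distance of a conditional expectation to its mean dominates the correlations with
bounded functions of the past. -/
theorem enorm_integral_mul_le_of_condExp (hF₀ : F₀ ≤ mΩ) {Z φ : Ω → ℝ} (hZ : Measurable[F₀] Z)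
    (hZ1 : ∀ ω, |Z ω| ≤ 1) (hφ : Integrable φ P) :
    ‖∫ ω, (Z ω - ∫ ω', Z ω' ∂P) * φ ω ∂P‖ₑ ≤
      eLpNorm (fun ω => (P[φ | F₀]) ω - ∫ ω', φ ω' ∂P) 1 P := by
  have hZm : Measurable Z := hZ.mono hF₀ le_rfl
  have hZi : Integrable Z P := integrable_of_abs_le hZm 1 hZ1
  have hZφ : Integrable (fun ω => Z ω * φ ω) P :=
    hφ.bdd_mul (c := 1) hZm.aestronglyMeasurable (ae_of_all _ hZ1)
  have hZc : Integrable (fun ω => Z ω * (P[φ | F₀]) ω) P :=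
    integrable_condExp.bdd_mul (c := 1) hZm.aestronglyMeasurable (ae_of_all _ hZ1)
  have e : ∫ ω, (Z ω - ∫ ω', Z ω' ∂P) * φ ω ∂P =
      ∫ ω, Z ω * ((P[φ | F₀]) ω - ∫ ω', φ ω' ∂P) ∂P := by
    simp only [mul_sub, sub_mul]
    rw [integral_sub hZφ (hφ.const_mul _), integral_sub hZc (hZi.mul_const _), integral_mul_const,
      integral_const_mul]
    congr 1
    rw [← integral_condExp hF₀ (f := fun ω => Z ω * φ ω)]
    refine integral_congr_ae ?_
    exact condExp_stronglyMeasurable_mul_of_bound hF₀ hZ.stronglyMeasurable hφ 1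
      (ae_of_all _ hZ1)
  rw [e, eLpNorm_one_eq_lintegral_enorm]
  refine (enorm_integral_le_lintegral_enorm _).trans (lintegral_mono fun ω => ?_)
  rw [enorm_mul]
  refine mul_le_of_le_one_left bot_le ?_
  rw [← ofReal_norm]
  exact ENNReal.ofReal_le_one.2 (hZ1 ω)

omit [IsProbabilityMeasure P] in
theorem centeredProd_eq (V : Fin 2 → ℤ) (x : Fin 2 → ℝ) :
    centeredProd P (fun j => Y (V j)) x =
      fun ω => obs P Y (ind (Iic (x 0))) (V 0) ω * obs P Y (ind (Iic (x 1))) (V 1) ω := by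
  funext ω
  simp only [centeredProd, Fin.prod_univ_two]
  rfl

omit [IsProbabilityMeasure P] in
theorem centeredProd_one_eq (V : Fin 1 → ℤ) (x : Fin 1 → ℝ) :
    centeredProd P (fun j => Y (V j)) x = fun ω => obs P Y (ind (Iic (x 0))) (V 0) ω := by
  funext ω
  simp only [centeredProd, Fin.prod_univ_one]
  rfl

omit [IsProbabilityMeasure P] in
theorem le_alpha {n l : ℕ} (hn : n ≠ 0) (hl : l ∈ Finset.Icc 1 2) (V : Fin l → ℤ)
    (hV : Monotone V ∧ ∀ j, (n : ℤ) ≤ V j) (x : Fin l → ℝ) :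
    eLpNorm (fun ω => (P[centeredProd P (fun j => Y (V j)) x | F₀]) ω -
      ∫ ω', centeredProd P (fun j => Y (V j)) x ω' ∂P) 1 P ≤ alpha F₀ P Y 2 n := by
  rw [alpha, if_neg hn]
  refine le_trans ?_ (le_iSup₂ (f := fun (l : ℕ) (_ : l ∈ Finset.Icc 1 2) =>
    ⨆ (i : Fin l → ℤ) (_ : Monotone i ∧ ∀ j, (n : ℤ) ≤ i j), alphaVec F₀ P fun j => Y (i j)) l hl)
  refine le_trans ?_ (le_iSup₂ (f := fun (i : Fin l → ℤ) (_ : Monotone i ∧ ∀ j, (n : ℤ) ≤ i j) =>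
    alphaVec F₀ P fun j => Y (i j)) V hV)
  exact le_iSup (f := fun x => eLpNorm (fun ω => (P[centeredProd P (fun j => Y (V j)) x | F₀]) ω -
      ∫ ω', centeredProd P (fun j => Y (V j)) x ω' ∂P) 1 P) x

/-- Duality bound for a pair of half-lines. -/
theorem dual_pair_Iic (hF₀ : F₀ ≤ mΩ) (hY : ∀ i, Measurable (Y i)) {Z : Ω → ℝ}
    (hZ : Measurable[F₀] Z) (hZ1 : ∀ ω, |Z ω| ≤ 1) {n : ℕ} (hn : n ≠ 0) {i j : ℤ} (hni : n ≤ i)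
    (hij : i ≤ j) (x x' : ℝ) :
    ‖∫ ω, (Z ω - ∫ ω', Z ω' ∂P) * (obs P Y (ind (Iic x)) i ω * obs P Y (ind (Iic x')) j ω) ∂P‖ₑ ≤
      alpha F₀ P Y 2 n := by
  have h := le_alpha (F₀ := F₀) (P := P) (Y := Y) hn (l := 2) (by simp) ![i, j] ⟨by
    intro a b hab
    fin_cases a <;> fin_cases b <;> simp_all, by
    intro a
    fin_cases a
    · exact hni
    · exact hni.trans hij⟩ ![x, x']
  rw [centeredProd_eq] at h
  refine le_trans ?_ h
  refine enorm_integral_mul_le_of_condExp hF₀ hZ hZ1 ?_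
  refine integrable_of_abs_le ((measurable_obs hY (measurable_ind measurableSet_Iic) _).mul
    (measurable_obs hY (measurable_ind measurableSet_Iic) _)) 1 fun ω => ?_
  rw [abs_mul]
  exact mul_le_one₀ (abs_obs_ind_le hY measurableSet_Iic _ _) (abs_nonneg _)
    (abs_obs_ind_le hY measurableSet_Iic _ _)

theorem dual_single_Iic (hF₀ : F₀ ≤ mΩ) (hY : ∀ i, Measurable (Y i)) {Z : Ω → ℝ}
    (hZ : Measurable[F₀] Z) (hZ1 : ∀ ω, |Z ω| ≤ 1) {n : ℕ} (hn : n ≠ 0) {i : ℤ} (hni : n ≤ i)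
    (x : ℝ) :
    ‖∫ ω, (Z ω - ∫ ω', Z ω' ∂P) * obs P Y (ind (Iic x)) i ω ∂P‖ₑ ≤ alpha F₀ P Y 2 n := by
  have h := le_alpha (F₀ := F₀) (P := P) (Y := Y) hn (l := 1) (by simp) (fun _ => i) ⟨by
    intro a b hab
    simp, fun _ => hni⟩ (fun _ => x)
  rw [centeredProd_one_eq] at h
  refine le_trans ?_ h
  refine enorm_integral_mul_le_of_condExp hF₀ hZ hZ1 ?_
  exact integrable_of_abs_le (measurable_obs hY (measurable_ind measurableSet_Iic) _) 1
    (abs_obs_ind_le hY measurableSet_Iic _)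

theorem abs_sub_integral_le {Z : Ω → ℝ} (hZ1 : ∀ ω, |Z ω| ≤ 1) (ω : Ω) :
    |Z ω - ∫ ω', Z ω' ∂P| ≤ 2 := by
  have h2 : |∫ ω', Z ω' ∂P| ≤ 1 := by
    simpa using norm_integral_le_of_norm_le_const (μ := P) (f := Z) (C := 1) (ae_of_all _ hZ1)
  have := abs_sub (Z ω) (∫ ω', Z ω' ∂P)
  have := hZ1 ω
  linarith

/-- Duality bound for a pair of lower sets, by approximation with half-lines. -/
theorem dual_pair_lower (hF₀ : F₀ ≤ mΩ) (hY : ∀ i, Measurable (Y i)) {Z : Ω → ℝ}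
    (hZ : Measurable[F₀] Z) (hZ1 : ∀ ω, |Z ω| ≤ 1) {n : ℕ} (hn : n ≠ 0) {i j : ℤ} (hni : n ≤ i)
    (hij : i ≤ j) {D D' : Set ℝ} (hD : IsLowerSet D) (hD' : IsLowerSet D') :
    ‖∫ ω, (Z ω - ∫ ω', Z ω' ∂P) * (obs P Y (ind D) i ω * obs P Y (ind D') j ω) ∂P‖ₑ ≤
      alpha F₀ P Y 2 n := by
  obtain ⟨x, hx⟩ := exists_tendsto_ind_of_isLowerSet hD
  obtain ⟨x', hx'⟩ := exists_tendsto_ind_of_isLowerSet hD'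
  have hm : ∀ x : ℝ, Measurable (ind (Iic x)) := fun x => measurable_ind measurableSet_Iic
  have hZm : Measurable Z := hZ.mono hF₀ le_rfl
  refine le_of_tendsto (x := atTop) (f := fun n : ℕ => ‖∫ ω, (Z ω - ∫ ω', Z ω' ∂P) *
    (obs P Y (ind (Iic (x n))) i ω * obs P Y (ind (Iic (x' n))) j ω) ∂P‖ₑ) ?_
    (Eventually.of_forall fun m => dual_pair_Iic hF₀ hY hZ hZ1 hn hni hij (x m) (x' m))
  refine (Continuous.tendsto continuous_enorm _).comp ?_
  refine tendsto_integral_of_dominated_convergence (fun _ => 2)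
    (fun m => ((hZm.sub_const _).mul ((measurable_obs hY (hm _) _).mul
      (measurable_obs hY (hm _) _))).aestronglyMeasurable) (integrable_const _)
    (fun m => ae_of_all _ fun ω => ?_) (ae_of_all _ fun ω => ?_)
  · rw [Real.norm_eq_abs, abs_mul, abs_mul]
    have h1 := abs_obs_ind_le (P := P) hY (D := Iic (x m)) measurableSet_Iic i ω
    have h2 := abs_obs_ind_le (P := P) hY (D := Iic (x' m)) measurableSet_Iic j ω
    have h3 := abs_sub_integral_le (P := P) hZ1 ω
    have h4 := mul_le_one₀ h1 (abs_nonneg _) h2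
    calc _ ≤ |Z ω - ∫ ω', Z ω' ∂P| * 1 := mul_le_mul_of_nonneg_left h4 (abs_nonneg _)
      _ ≤ 2 := by linarith
  · exact ((tendsto_obs hY (fun m => hm _) (fun m => abs_ind_le _) hx i ω).mul
      (tendsto_obs hY (fun m => hm _) (fun m => abs_ind_le _) hx' j ω)).const_mul _

theorem dual_single_lower (hF₀ : F₀ ≤ mΩ) (hY : ∀ i, Measurable (Y i)) {Z : Ω → ℝ}
    (hZ : Measurable[F₀] Z) (hZ1 : ∀ ω, |Z ω| ≤ 1) {n : ℕ} (hn : n ≠ 0) {i : ℤ} (hni : n ≤ i)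
    {D : Set ℝ} (hD : IsLowerSet D) :
    ‖∫ ω, (Z ω - ∫ ω', Z ω' ∂P) * obs P Y (ind D) i ω ∂P‖ₑ ≤ alpha F₀ P Y 2 n := by
  obtain ⟨x, hx⟩ := exists_tendsto_ind_of_isLowerSet hD
  have hm : ∀ x : ℝ, Measurable (ind (Iic x)) := fun x => measurable_ind measurableSet_Iic
  have hZm : Measurable Z := hZ.mono hF₀ le_rfl
  refine le_of_tendsto (x := atTop) (f := fun n : ℕ => ‖∫ ω, (Z ω - ∫ ω', Z ω' ∂P) *
    obs P Y (ind (Iic (x n))) i ω ∂P‖ₑ) ?_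
    (Eventually.of_forall fun m => dual_single_Iic hF₀ hY hZ hZ1 hn hni (x m))
  refine (Continuous.tendsto continuous_enorm _).comp ?_
  refine tendsto_integral_of_dominated_convergence (fun _ => 2)
    (fun m => ((hZm.sub_const _).mul (measurable_obs hY (hm _) _)).aestronglyMeasurable)
    (integrable_const _) (fun m => ae_of_all _ fun ω => ?_) (ae_of_all _ fun ω => ?_)
  · rw [Real.norm_eq_abs, abs_mul]
    have h1 := abs_obs_ind_le (P := P) hY (D := Iic (x m)) measurableSet_Iic i ω
    have h3 := abs_sub_integral_le (P := P) hZ1 ω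
    calc _ ≤ |Z ω - ∫ ω', Z ω' ∂P| * 1 := mul_le_mul_of_nonneg_left h1 (abs_nonneg _)
      _ ≤ 2 := by linarith
  · exact (tendsto_obs hY (fun m => hm _) (fun m => abs_ind_le _) hx i ω).const_mul _

/-- Duality bound for a pair of intervals, as differences of lower sets. -/
theorem dual_pair_ordConnected (hF₀ : F₀ ≤ mΩ) (hY : ∀ i, Measurable (Y i)) {Z : Ω → ℝ}
    (hZ : Measurable[F₀] Z) (hZ1 : ∀ ω, |Z ω| ≤ 1) {n : ℕ} (hn : n ≠ 0) {i j : ℤ} (hni : n ≤ i)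
    (hij : i ≤ j) {J J' : Set ℝ} (hJ : J.OrdConnected) (hJ' : J'.OrdConnected) :
    ‖∫ ω, (Z ω - ∫ ω', Z ω' ∂P) * obs P Y (ind J) i ω * obs P Y (ind J') j ω ∂P‖ₑ ≤
      4 * alpha F₀ P Y 2 n := by
  obtain ⟨A, B, hA, hB, hAB⟩ := exists_isLowerSet_sub_of_ordConnected hJ
  obtain ⟨A', B', hA', hB', hAB'⟩ := exists_isLowerSet_sub_of_ordConnected hJ'
  have hZm : Measurable Z := hZ.mono hF₀ le_rfl
  have hm : ∀ {D : Set ℝ}, IsLowerSet D → Measurable (ind D) := fun hD =>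
    measurable_ind (measurableSet_of_isLowerSet hD)
  have hint : ∀ {D D' : Set ℝ}, IsLowerSet D → IsLowerSet D' → Integrable (fun ω =>
      (Z ω - ∫ ω', Z ω' ∂P) * (obs P Y (ind D) i ω * obs P Y (ind D') j ω)) P := by
    intro D D' hD hD'
    refine integrable_of_abs_le ((hZm.sub_const _).mul ((measurable_obs hY (hm hD) _).mul
      (measurable_obs hY (hm hD') _))) 2 fun ω => ?_
    rw [abs_mul, abs_mul]
    have h1 := abs_obs_ind_le (P := P) hY (measurableSet_of_isLowerSet hD) i ω
    have h2 := abs_obs_ind_le (P := P) hY (measurableSet_of_isLowerSet hD') j ω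
    have h3 := abs_sub_integral_le (P := P) hZ1 ω
    have h4 := mul_le_one₀ h1 (abs_nonneg _) h2
    calc _ ≤ |Z ω - ∫ ω', Z ω' ∂P| * 1 := mul_le_mul_of_nonneg_left h4 (abs_nonneg _)
      _ ≤ 2 := by linarith
  have e1 : ∀ ω, obs P Y (ind J) i ω = obs P Y (ind A) i ω - obs P Y (ind B) i ω := by
    rw [show ind J = fun y => ind A y - ind B y from funext hAB]
    exact obs_sub hY (hm hA) (hm hB) (abs_ind_le A) (abs_ind_le B) i
  have e2 : ∀ ω, obs P Y (ind J') j ω = obs P Y (ind A') j ω - obs P Y (ind B') j ω := by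
    rw [show ind J' = fun y => ind A' y - ind B' y from funext hAB']
    exact obs_sub hY (hm hA') (hm hB') (abs_ind_le A') (abs_ind_le B') j
  have e : ∀ ω, (Z ω - ∫ ω', Z ω' ∂P) * obs P Y (ind J) i ω * obs P Y (ind J') j ω =
      ((Z ω - ∫ ω', Z ω' ∂P) * (obs P Y (ind A) i ω * obs P Y (ind A') j ω)
      - (Z ω - ∫ ω', Z ω' ∂P) * (obs P Y (ind A) i ω * obs P Y (ind B') j ω))
      - ((Z ω - ∫ ω', Z ω' ∂P) * (obs P Y (ind B) i ω * obs P Y (ind A') j ω)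
      - (Z ω - ∫ ω', Z ω' ∂P) * (obs P Y (ind B) i ω * obs P Y (ind B') j ω)) := by
    intro ω
    rw [e1, e2]; ring
  simp_rw [e]
  rw [integral_sub, integral_sub (hint hA hA') (hint hA hB'), integral_sub (hint hB hA') (hint hB hB')]
  rotate_left
  · exact (hint hA hA').sub (hint hA hB')
  · exact (hint hB hA').sub (hint hB hB')
  have b : ∀ {D D' : Set ℝ}, IsLowerSet D → IsLowerSet D' → _ := fun {D D'} hD hD' =>
    dual_pair_lower (P := P) hF₀ hY hZ hZ1 hn hni hij (D := D) (D' := D') hD hD'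
  calc _ ≤ (alpha F₀ P Y 2 n + alpha F₀ P Y 2 n) + (alpha F₀ P Y 2 n + alpha F₀ P Y 2 n) := by
        refine (enorm_sub_le).trans (add_le_add ?_ ?_)
        · exact (enorm_sub_le).trans (add_le_add (b hA hA') (b hA hB'))
        · exact (enorm_sub_le).trans (add_le_add (b hB hA') (b hB hB'))
    _ = 4 * alpha F₀ P Y 2 n := by ring

theorem dual_single_ordConnected (hF₀ : F₀ ≤ mΩ) (hY : ∀ i, Measurable (Y i)) {Z : Ω → ℝ}
    (hZ : Measurable[F₀] Z) (hZ1 : ∀ ω, |Z ω| ≤ 1) {n : ℕ} (hn : n ≠ 0) {i : ℤ} (hni : n ≤ i)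
    {J : Set ℝ} (hJ : J.OrdConnected) :
    ‖∫ ω, Z ω * obs P Y (ind J) i ω ∂P‖ₑ ≤ 2 * alpha F₀ P Y 2 n := by
  obtain ⟨A, B, hA, hB, hAB⟩ := exists_isLowerSet_sub_of_ordConnected hJ
  have hZm : Measurable Z := hZ.mono hF₀ le_rfl
  have hm : ∀ {D : Set ℝ}, IsLowerSet D → Measurable (ind D) := fun hD =>
    measurable_ind (measurableSet_of_isLowerSet hD)
  have hint : ∀ {D : Set ℝ}, IsLowerSet D → Integrable (fun ω =>
      (Z ω - ∫ ω', Z ω' ∂P) * obs P Y (ind D) i ω) P := by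
    intro D hD
    refine integrable_of_abs_le ((hZm.sub_const _).mul (measurable_obs hY (hm hD) _)) 2 fun ω => ?_
    rw [abs_mul]
    have h1 := abs_obs_ind_le (P := P) hY (measurableSet_of_isLowerSet hD) i ω
    have h3 := abs_sub_integral_le (P := P) hZ1 ω
    calc _ ≤ |Z ω - ∫ ω', Z ω' ∂P| * 1 := mul_le_mul_of_nonneg_left h1 (abs_nonneg _)
      _ ≤ 2 := by linarith
  have hi : Integrable (fun ω => obs P Y (ind J) i ω) P :=
    integrable_of_abs_le (measurable_obs hY (measurable_ind hJ.measurableSet) i) 1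
      (abs_obs_ind_le hY hJ.measurableSet i)
  have h0 : ∫ ω, obs P Y (ind J) i ω ∂P = 0 := by
    simp only [obs, centered]
    rw [integral_sub (integrable_comp hY (measurable_ind hJ.measurableSet) (abs_ind_le J) i)
      (integrable_const _)]
    simp
  have hi' : Integrable (fun ω => Z ω * obs P Y (ind J) i ω) P :=
    hi.bdd_mul (c := 1) hZm.aestronglyMeasurable (ae_of_all _ hZ1)
  have e0 : ∫ ω, Z ω * obs P Y (ind J) i ω ∂P =
      ∫ ω, (Z ω - ∫ ω', Z ω' ∂P) * obs P Y (ind J) i ω ∂P := by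
    simp only [sub_mul]
    rw [integral_sub hi' (hi.const_mul _), integral_const_mul, h0, mul_zero, sub_zero]
  have e : ∀ ω, (Z ω - ∫ ω', Z ω' ∂P) * obs P Y (ind J) i ω =
      (Z ω - ∫ ω', Z ω' ∂P) * obs P Y (ind A) i ω
      - (Z ω - ∫ ω', Z ω' ∂P) * obs P Y (ind B) i ω := by
    intro ω
    have := obs_sub (P := P) hY (hm hA) (hm hB) (abs_ind_le A) (abs_ind_le B) i ω
    rw [show (fun y => ind A y - ind B y) = ind J from (funext hAB).symm] at this
    rw [this]; ring
  rw [e0]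
  simp_rw [e]
  rw [integral_sub (hint hA) (hint hB), two_mul]
  exact (enorm_sub_le).trans (add_le_add (dual_single_lower hF₀ hY hZ hZ1 hn hni hA)
    (dual_single_lower hF₀ hY hZ hZ1 hn hni hB))

/-- Covariance of the indicators of two intervals, including the case `k = 0`, where the coefficient
has the conventional value `1 / 2`. -/
theorem enorm_cov_ind_le (hF₀ : F₀ ≤ mΩ) (hY : ∀ i, Measurable (Y i)) (hY0 : Measurable[F₀] (Y 0))
    (k : ℕ) {J J' : Set ℝ} (hJ : J.OrdConnected) (hJ' : J'.OrdConnected) {c c' : ℝ≥0∞}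
    (hc : P (Y 0 ⁻¹' J) ≤ c) (hc' : P (Y k ⁻¹' J') ≤ c') :
    ‖∫ ω, obs P Y (ind J) 0 ω * obs P Y (ind J') k ω ∂P‖ₑ ≤
      2 * min (min (alpha F₀ P Y 2 k) (1 / 2)) (min c c') := by
  have hmJ := measurable_ind hJ.measurableSet
  have hmJ' := measurable_ind hJ'.measurableSet
  have hb := abs_obs_ind_le (P := P) hY hJ.measurableSet 0
  have hb' := abs_obs_ind_le (P := P) hY hJ'.measurableSet k
  set A : Set Ω := Y 0 ⁻¹' J with hA
  set B : Set Ω := Y k ⁻¹' J' with hB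
  have hAm : MeasurableSet A := hY 0 hJ.measurableSet
  have hBm : MeasurableSet B := hY k hJ'.measurableSet
  have e1 : ∀ (i : ℤ) (J : Set ℝ), (fun ω => ind J (Y i ω)) = (Y i ⁻¹' J).indicator fun _ => 1 :=
    fun _ _ => rfl
  have hval : ∫ ω, obs P Y (ind J) 0 ω * obs P Y (ind J') k ω ∂P =
      P.real (A ∩ B) - P.real A * P.real B := by
    rw [integral_mul_obs hY hmJ' (abs_ind_le J') (measurable_obs hY hmJ 0) hb]
    have h0 : ∫ ω, obs P Y (ind J) 0 ω ∂P = 0 := by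
      simp only [obs, centered]
      rw [integral_sub (integrable_comp hY hmJ (abs_ind_le J) 0) (integrable_const _)]
      simp
    rw [h0]
    have e : ∀ ω, (obs P Y (ind J) 0 ω - 0) * ind J' (Y k ω) =
        (A ∩ B).indicator (fun _ => (1 : ℝ)) ω - P.real A * B.indicator (fun _ => (1 : ℝ)) ω := by
      intro ω
      have h1 : ∫ ω, ind J (Y 0 ω) ∂P = P.real A := by
        rw [e1, integral_indicator hAm]; simp
      simp only [obs, centered, h1, sub_zero, sub_mul]
      congr 1
      show A.indicator (fun _ => (1 : ℝ)) ω * B.indicator (fun _ => (1 : ℝ)) ω = _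
      rw [← inter_indicator_mul]; simp
    simp_rw [e]
    rw [integral_sub ((integrable_const _).indicator (hAm.inter hBm))
      (((integrable_const _).indicator hBm).const_mul _), integral_const_mul,
      integral_indicator (hAm.inter hBm), integral_indicator hBm]
    simp
  have hAB1 : P.real (A ∩ B) ≤ P.real A := measureReal_mono inter_subset_left
  have hAB2 : P.real (A ∩ B) ≤ P.real B := measureReal_mono inter_subset_right
  have hA1 : P.real A ≤ 1 := measureReal_le_one
  have hB1 : P.real B ≤ 1 := measureReal_le_one
  have hA0 : 0 ≤ P.real A := measureReal_nonneg
  have hB0 : 0 ≤ P.real B := measureReal_nonneg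
  have hmin : |P.real (A ∩ B) - P.real A * P.real B| ≤ min (P.real A) (P.real B) := by
    have h0 : 0 ≤ P.real (A ∩ B) := measureReal_nonneg
    refine le_min (abs_le.2 ⟨?_, ?_⟩) (abs_le.2 ⟨?_, ?_⟩) <;> nlinarith [mul_nonneg hA0 hB0]
  have hr : ‖∫ ω, obs P Y (ind J) 0 ω * obs P Y (ind J') k ω ∂P‖ₑ ≤ min (P A) (P B) := by
    rw [hval, Real.enorm_eq_ofReal_abs]
    refine (ENNReal.ofReal_le_ofReal hmin).trans ?_
    rw [ENNReal.ofReal_min, ofReal_measureReal, ofReal_measureReal]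
  have h2 : ∀ c : ℝ≥0∞, c ≤ 2 * c := fun c => by rw [two_mul]; exact le_self_add
  have hhalf : (2 : ℝ≥0∞) * (1 / 2) = 1 := by
    rw [one_div]; exact ENNReal.mul_inv_cancel (by simp) (by simp)
  have hone : ‖∫ ω, obs P Y (ind J) 0 ω * obs P Y (ind J') k ω ∂P‖ₑ ≤ 1 :=
    (hr.trans (min_le_left _ _)).trans prob_le_one
  rw [mul_min, mul_min, mul_min]
  refine le_min (le_min ?_ (hone.trans hhalf.ge))
    (le_min ((hr.trans ((min_le_left _ _).trans hc)).trans (h2 c))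
      ((hr.trans ((min_le_right _ _).trans hc')).trans (h2 c')))
  rcases Nat.eq_zero_or_pos k with rfl | hk
  · rw [alpha_zero]; exact hone.trans hhalf.ge
  · refine dual_single_ordConnected hF₀ hY ?_ hb (by omega) le_rfl hJ'
    exact (hmJ.comp hY0).sub_const _

end Dual

/-! ### The flow, layered functions and their combinations -/

section Flow
variable {Ω : Type*} {F₀ : MeasurableSpace Ω} [mΩ : MeasurableSpace Ω]

theorem measurable_zpow_equiv (T : Ω ≃ᵐ Ω) (i : ℤ) :
    Measurable ((T.toEquiv : Equiv.Perm Ω) ^ i) := by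
  have key : ∀ (T : Ω ≃ᵐ Ω) (n : ℕ), Measurable ((T.toEquiv : Equiv.Perm Ω) ^ n) := by
    intro T n
    induction n with
    | zero => simpa using measurable_id
    | succ n ih =>
      rw [pow_succ, Equiv.Perm.coe_mul]
      exact ih.comp T.measurable
  cases i with
  | ofNat n => simpa using key T n
  | negSucc n =>
    rw [zpow_negSucc, ← inv_pow]
    exact key T.symm (n + 1)

/-- The iterates `T^i`, `i ∈ ℤ`, as measurable equivalences. -/
def flow (T : Ω ≃ᵐ Ω) (i : ℤ) : Ω ≃ᵐ Ω where
  toEquiv := (T.toEquiv : Equiv.Perm Ω) ^ i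
  measurable_toFun := measurable_zpow_equiv T i
  measurable_invFun := by
    have h := measurable_zpow_equiv T (-i)
    rw [zpow_neg] at h
    exact h

theorem flow_add (T : Ω ≃ᵐ Ω) (i j : ℤ) (ω : Ω) : flow T (i + j) ω = flow T i (flow T j ω) := by
  show ((T.toEquiv : Equiv.Perm Ω) ^ (i + j)) ω = _
  rw [zpow_add]; rfl

theorem flow_zero (T : Ω ≃ᵐ Ω) (ω : Ω) : flow T 0 ω = ω := rfl

theorem flow_one (T : Ω ≃ᵐ Ω) (ω : Ω) : flow T 1 ω = T ω := by
  show ((T.toEquiv : Equiv.Perm Ω) ^ (1 : ℤ)) ω = _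
  rw [zpow_one]; rfl

theorem shifted_apply (T : Ω ≃ᵐ Ω) (Y₀ : Ω → ℝ) (i : ℤ) (ω : Ω) :
    shifted T Y₀ i ω = Y₀ (flow T i ω) := rfl

theorem shifted_flow (T : Ω ≃ᵐ Ω) (Y₀ : Ω → ℝ) (i m : ℤ) (ω : Ω) :
    shifted T Y₀ i (flow T m ω) = shifted T Y₀ (i + m) ω := by
  rw [shifted_apply, shifted_apply, flow_add]

variable {P : Measure Ω} {T : Ω ≃ᵐ Ω} {Y₀ : Ω → ℝ}

theorem measurePreserving_flow (hT : MeasurePreserving T P P) (i : ℤ) :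
    MeasurePreserving (flow T i) P P := by
  have step : ∀ j, MeasurePreserving (flow T j) P P → MeasurePreserving (flow T (j + 1)) P P := by
    intro j hj
    have : (flow T (j + 1) : Ω → Ω) = flow T j ∘ T := by
      funext ω; rw [flow_add, flow_one]; rfl
    rw [this]; exact hj.comp hT
  have step' : ∀ j, MeasurePreserving (flow T j) P P → MeasurePreserving (flow T (j - 1)) P P := by
    intro j hj
    have : (flow T (j - 1) : Ω → Ω) = flow T j ∘ T.symm := by
      funext ω
      have := flow_add T (j - 1) 1 (T.symm ω)
      rw [flow_one, T.apply_symm_apply, sub_add_cancel] at this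
      exact this.symm
    rw [this]; exact hj.comp (hT.symm T)
  induction i using Int.induction_on with
  | zero => exact MeasurePreserving.id P
  | succ n ih => exact step _ ih
  | pred n ih => exact step' _ ih

theorem integral_flow (hT : MeasurePreserving T P P) (i : ℤ) (φ : Ω → ℝ) :
    ∫ ω, φ (flow T i ω) ∂P = ∫ ω, φ ω ∂P :=
  (measurePreserving_flow hT i).integral_comp' φ

theorem obs_flow (hT : MeasurePreserving T P P) (g : ℝ → ℝ) (i m : ℤ) (ω : Ω) :
    obs P (shifted T Y₀) g i (flow T m ω) = obs P (shifted T Y₀) g (i + m) ω := by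
  simp only [obs, centered, shifted_flow]
  congr 1
  rw [← integral_flow hT m fun ω => g (shifted T Y₀ i ω)]
  simp only [shifted_flow]

theorem measurable_shifted (hY₀ : Measurable Y₀) (i : ℤ) : Measurable (shifted T Y₀ i) :=
  hY₀.comp (flow T i).measurable

variable (F₀) in
/-- The `σ`-algebra `T^{-m} F₀` of the past at time `m`. -/
abbrev pastAlg (T : Ω ≃ᵐ Ω) (m : ℤ) : MeasurableSpace Ω :=
  F₀.comap (flow T m)

theorem pastAlg_le (hF₀ : F₀ ≤ mΩ) (m : ℤ) : pastAlg F₀ T m ≤ mΩ :=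
  (MeasurableSpace.comap_mono hF₀).trans (flow T m).measurable.comap_le

theorem pastAlg_mono (hF₀T : F₀ ≤ MeasurableSpace.comap T F₀) : Monotone (pastAlg F₀ T) := by
  refine monotone_int_of_le_succ fun m => ?_
  have : (flow T (m + 1) : Ω → Ω) = T ∘ flow T m := by
    funext ω; rw [add_comm, flow_add, flow_one]; rfl
  rw [pastAlg, pastAlg, this, ← MeasurableSpace.comap_comp]
  exact MeasurableSpace.comap_mono hF₀T

theorem measurable_shifted_pastAlg (hF₀T : F₀ ≤ MeasurableSpace.comap T F₀)
    (hY₀ : Measurable[F₀] Y₀) {i m : ℤ} (him : i ≤ m) :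
    Measurable[pastAlg F₀ T m] (shifted T Y₀ i) := by
  refine Measurable.mono ?_ (pastAlg_mono hF₀T him) le_rfl
  intro s hs
  exact ⟨Y₀ ⁻¹' s, hY₀ hs, rfl⟩

theorem measurable_obs_pastAlg (hF₀T : F₀ ≤ MeasurableSpace.comap T F₀)
    (hY₀ : Measurable[F₀] Y₀) {g : ℝ → ℝ} (hg : Measurable g) {i m : ℤ} (him : i ≤ m) :
    Measurable[pastAlg F₀ T m] (obs P (shifted T Y₀) g i) :=
  (hg.comp (measurable_shifted_pastAlg hF₀T hY₀ him)).sub_const _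

/-- Functions of the past at time `m` become `F₀`-measurable after a shift of time. -/
theorem measurable_comp_flow_neg {Z : Ω → ℝ} {m : ℤ} (hZ : Measurable[pastAlg F₀ T m] Z) :
    Measurable[F₀] fun ω => Z (flow T (-m) ω) := by
  intro s hs
  obtain ⟨A, hA, hAs⟩ := hZ hs
  have : (fun ω => Z (flow T (-m) ω)) ⁻¹' s = A := by
    ext ω
    have h1 : flow T m (flow T (-m) ω) = ω := by
      rw [← flow_add, add_neg_cancel, flow_zero]
    have h2 : flow T (-m) ω ∈ flow T m ⁻¹' A ↔ flow T (-m) ω ∈ Z ⁻¹' s := by rw [hAs]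
    rw [mem_preimage, h1] at h2
    exact h2.symm
  rw [this]; exact hA

end Flow

/-- Nonnegative functions all of whose strict superlevel sets at levels `t ≥ 0` are intervals, with
tails bounded by `H`. -/
structure IsLayered (H : ℝ≥0 → ℝ) (μ : Measure ℝ) (h : ℝ → ℝ) : Prop where
  nonneg : ∀ y, 0 ≤ h y
  ordConnected : ∀ t, 0 ≤ t → OrdConnected {y | t < h y}
  le_tail : ∀ t, 0 ≤ t → μ {y | t < h y} ≤ tail H t

theorem IsLayered.measurable {H : ℝ≥0 → ℝ} {μ : Measure ℝ} {h : ℝ → ℝ} (hh : IsLayered H μ h) :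
    Measurable h := by
  refine measurable_of_Ioi fun t => ?_
  rcases le_or_gt 0 t with ht | ht
  · exact (hh.ordConnected t ht).measurableSet
  · convert MeasurableSet.univ
    refine eq_univ_of_forall fun y => ?_
    exact ht.trans_le (hh.nonneg y)

theorem IsLayered.truncate {H : ℝ≥0 → ℝ} {μ : Measure ℝ} {h : ℝ → ℝ} (hh : IsLayered H μ h)
    (M : ℝ≥0) :
    IsLayered H μ fun y => min (h y) M where
  nonneg y := le_min (hh.nonneg y) M.2
  ordConnected t ht := by
    by_cases htM : t < M
    · simpa only [lt_min_iff, htM, and_true] using hh.ordConnected t ht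
    · simp only [lt_min_iff, htM, and_false, ofPred_false]
      exact ordConnected_empty
  le_tail t ht := by
    refine le_trans (measure_mono ?_) (hh.le_tail t ht)
    intro y hy
    have hy' : t < min (h y) M := hy
    exact hy'.trans_le (min_le_left _ _)

/-- The linear combination `∑ b_l h_l`. -/
def comb {L : ℕ} (b : Fin L → ℝ) (h : Fin L → ℝ → ℝ) (y : ℝ) : ℝ := ∑ l, b l * h l y

section Comb
variable {Ω : Type*} [mΩ : MeasurableSpace Ω] {P : Measure Ω} [IsProbabilityMeasure P]
  {Y : ℤ → Ω → ℝ} {L : ℕ} {b : Fin L → ℝ} {h : Fin L → ℝ → ℝ}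

theorem measurable_comb (hh : ∀ l, Measurable (h l)) : Measurable (comb b h) :=
  Finset.measurable_sum _ fun l _ => (hh l).const_mul _

theorem sum_abs_le_of_enorm (hb : ∑ l, ‖b l‖ₑ ≤ 2) : ∑ l, |b l| ≤ 2 := by
  have : ENNReal.ofReal (∑ l, |b l|) ≤ ENNReal.ofReal 2 := by
    rw [ENNReal.ofReal_sum_of_nonneg fun _ _ => abs_nonneg _]
    simpa [Real.enorm_eq_ofReal_abs] using hb
  exact (ENNReal.ofReal_le_ofReal_iff (by norm_num)).1 this

theorem abs_comb_le (hb : ∑ l, ‖b l‖ₑ ≤ 2) {y : ℝ} {c : ℝ} (hc : 0 ≤ c) (hh : ∀ l, |h l y| ≤ c) :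
    |comb b h y| ≤ 2 * c := by
  calc |comb b h y| ≤ ∑ l, |b l * h l y| := Finset.abs_sum_le_sum_abs _ _
    _ ≤ ∑ l, |b l| * c := by
        refine Finset.sum_le_sum fun l _ => ?_
        rw [abs_mul]
        exact mul_le_mul_of_nonneg_left (hh l) (abs_nonneg _)
    _ = (∑ l, |b l|) * c := by rw [Finset.sum_mul]
    _ ≤ 2 * c := mul_le_mul_of_nonneg_right (sum_abs_le_of_enorm hb) hc

omit [IsProbabilityMeasure P] in
theorem obs_comb {i : ℤ} (hi : ∀ l, Integrable (fun ω => h l (Y i ω)) P) (ω : Ω) :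
    obs P Y (comb b h) i ω = ∑ l, b l * obs P Y (h l) i ω := by
  simp only [obs, centered, comb]
  rw [integral_finsetSum _ fun l _ => (hi l).const_mul _, ← Finset.sum_sub_distrib]
  refine Finset.sum_congr rfl fun l _ => ?_
  rw [integral_const_mul]; ring

theorem abs_obs_comb_le (hY : ∀ i, Measurable (Y i)) (hb : ∑ l, ‖b l‖ₑ ≤ 2)
    (hh : ∀ l, Measurable (h l)) {M : ℝ} (h0 : ∀ l y, 0 ≤ h l y) (hM : ∀ l y, h l y ≤ M)
    (hM0 : 0 ≤ M) (i : ℤ) (ω : Ω) : |obs P Y (comb b h) i ω| ≤ 4 * M := by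
  have h1 : ∀ y, |comb b h y| ≤ 2 * M := fun y => abs_comb_le hb hM0 fun l => by
    rw [abs_of_nonneg (h0 l y)]; exact hM l y
  have := abs_obs_le (P := P) hY (measurable_comb (b := b) hh) (fun y => (abs_le.1 (h1 y)).1)
    (fun y => (abs_le.1 (h1 y)).2) i ω
  linarith

theorem enorm_integral_mul_comb_le (hY : ∀ i, Measurable (Y i)) (hb : ∑ l, ‖b l‖ₑ ≤ 2)
    (hh : ∀ l, Measurable (h l)) {M : ℝ} (h0 : ∀ l y, 0 ≤ h l y) (hM : ∀ l y, h l y ≤ M)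
    {W : Ω → ℝ} (hW : Measurable W) {w : ℝ} (hw : ∀ ω, |W ω| ≤ w) (i : ℤ) {C : ℝ≥0∞}
    (hC : ∀ l, ‖∫ ω, W ω * obs P Y (h l) i ω ∂P‖ₑ ≤ C) :
    ‖∫ ω, W ω * obs P Y (comb b h) i ω ∂P‖ₑ ≤ 2 * C := by
  have hbd : ∀ l y, |h l y| ≤ M := fun l y => by rw [abs_of_nonneg (h0 l y)]; exact hM l y
  have hint : ∀ l, Integrable (fun ω => W ω * obs P Y (h l) i ω) P := fun l =>
    (integrable_of_abs_le (measurable_obs hY (hh l) i) (M - 0)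
      (abs_obs_le hY (hh l) (h0 l) (hM l) i)).bdd_mul hW.aestronglyMeasurable (ae_of_all _ hw)
  have e : ∀ ω, W ω * obs P Y (comb b h) i ω = ∑ l, b l * (W ω * obs P Y (h l) i ω) := by
    intro ω
    rw [obs_comb fun l => integrable_comp hY (hh l) (hbd l) i, Finset.mul_sum]
    exact Finset.sum_congr rfl fun l _ => by ring
  simp_rw [e]
  rw [integral_finsetSum _ fun l _ => (hint l).const_mul _]
  simp_rw [integral_const_mul]
  refine (enorm_sum_le _ _).trans ?_
  calc ∑ l, ‖b l * ∫ ω, W ω * obs P Y (h l) i ω ∂P‖ₑ ≤ ∑ l, ‖b l‖ₑ * C := by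
        refine Finset.sum_le_sum fun l _ => ?_
        rw [enorm_mul]
        exact mul_le_mul' le_rfl (hC l)
    _ = (∑ l, ‖b l‖ₑ) * C := by rw [Finset.sum_mul]
    _ ≤ 2 * C := mul_le_mul' hb le_rfl

theorem enorm_integral_mul_comb_mul_comb_le (hY : ∀ i, Measurable (Y i)) (hb : ∑ l, ‖b l‖ₑ ≤ 2)
    (hh : ∀ l, Measurable (h l)) {M : ℝ} (h0 : ∀ l y, 0 ≤ h l y) (hM : ∀ l y, h l y ≤ M)
    {W : Ω → ℝ} (hW : Measurable W) {w : ℝ} (hw : ∀ ω, |W ω| ≤ w) (i j : ℤ) {C : ℝ≥0∞}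
    (hC : ∀ l l', ‖∫ ω, W ω * obs P Y (h l) i ω * obs P Y (h l') j ω ∂P‖ₑ ≤ C) :
    ‖∫ ω, W ω * obs P Y (comb b h) i ω * obs P Y (comb b h) j ω ∂P‖ₑ ≤ 4 * C := by
  rcases Nat.eq_zero_or_pos L with rfl | hL
  · simp [comb, obs, centered]
  have hM0 : 0 ≤ M := (h0 ⟨0, hL⟩ 0).trans (hM _ _)
  have hprod : ∀ {g : ℝ → ℝ} {c : ℝ} {i : ℤ}, Measurable g → (∀ ω, |obs P Y g i ω| ≤ c) →
      ∀ ω, |W ω * obs P Y g i ω| ≤ w * c := by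
    intro g c i _ hc ω
    rw [abs_mul]
    exact mul_le_mul (hw ω) (hc ω) (abs_nonneg _) ((abs_nonneg _).trans (hw ω))
  have e : ∀ a b c : ℝ, a * b * c = a * c * b := fun a b c => by ring
  have h1 : ∀ l, ‖∫ ω, W ω * obs P Y (h l) i ω * obs P Y (comb b h) j ω ∂P‖ₑ ≤ 2 * C := fun l =>
    enorm_integral_mul_comb_le hY hb hh h0 hM (hW.mul (measurable_obs hY (hh l) i))
      (hprod (hh l) (abs_obs_le hY (hh l) (h0 l) (hM l) i)) j (hC l)
  have h2 := enorm_integral_mul_comb_le (P := P) hY hb hh h0 hM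
    (hW.mul (measurable_obs (P := P) hY (measurable_comb (b := b) hh) j))
    (hprod (measurable_comb hh) (abs_obs_comb_le hY hb hh h0 hM hM0 j)) i (C := 2 * C) (fun l => by
      simpa only [Pi.mul_apply, e _ (obs P Y (comb b h) j _)] using h1 l)
  simp_rw [e _ (obs P Y (comb b h) i _)]
  refine h2.trans (le_of_eq ?_)
  ring

end Comb

/-! ### Moments of block sums -/

/-- The standing assumptions on the stationary sequence `Y_i = Y₀ ∘ T^i` and on the tail function. -/
structure Standing {Ω : Type*} (F₀ : MeasurableSpace Ω) [mΩ : MeasurableSpace Ω] (P : Measure Ω)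
    (T : Ω ≃ᵐ Ω) (Y₀ : Ω → ℝ) (H : ℝ≥0 → ℝ) : Prop where
  preserving : MeasurePreserving T P P
  le : F₀ ≤ mΩ
  le_comap : F₀ ≤ MeasurableSpace.comap T F₀
  meas : Measurable[F₀] Y₀
  tail : IsTailFunction H

/-- Linear combinations of layered functions, with total coefficient at most `2`. -/
structure IsComb (H : ℝ≥0 → ℝ) (μ : Measure ℝ) {L : ℕ} (b : Fin L → ℝ) (h : Fin L → ℝ → ℝ) :
    Prop where
  sum_le : ∑ l, ‖b l‖ₑ ≤ 2
  layered : ∀ l, IsLayered H μ (h l)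

theorem IsComb.truncate {H : ℝ≥0 → ℝ} {μ : Measure ℝ} {L : ℕ} {b : Fin L → ℝ} {h : Fin L → ℝ → ℝ}
    (hC : IsComb H μ b h) (M : ℝ≥0) : IsComb H μ b fun l y => min (h l y) M :=
  ⟨hC.sum_le, fun l => (hC.layered l).truncate M⟩

/-- The sum of `q` consecutive terms after time `o`. -/
def blockSum {Ω : Type*} (X : ℤ → Ω → ℝ) (o : ℤ) (q : ℕ) (ω : Ω) : ℝ :=
  ∑ k ∈ Finset.range q, X (o + 1 + k) ω

section Sums

/-- Reindexing of a partial sum of nonnegative terms by an injective map of the range. -/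
theorem sum_range_filter_le {c : ℕ → ℝ≥0∞} {q : ℕ} {p : ℕ → Prop} [DecidablePred p] {g : ℕ → ℕ}
    (hg : ∀ j < q, p j → g j < q)
    (hinj : ∀ j < q, ∀ j' < q, p j → p j' → g j = g j' → j = j') :
    ∑ j ∈ (Finset.range q).filter p, c (g j) ≤ ∑ k ∈ Finset.range q, c k := by
  rw [← Finset.sum_image (f := c) (g := g)]
  · refine Finset.sum_le_sum_of_subset fun k hk => ?_
    obtain ⟨j, hj, rfl⟩ := Finset.mem_image.1 hk
    rw [Finset.mem_filter, Finset.mem_range] at hj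
    exact Finset.mem_range.2 (hg j hj.1 hj.2)
  · intro j hj j' hj' h
    simp only [Finset.coe_filter, Finset.mem_range, mem_ofPred_eq] at hj hj'
    exact hinj j hj.1 j' hj'.1 hj.2 hj'.2 h

theorem sum_natAbs_le (c : ℕ → ℝ≥0∞) {i q : ℕ} (hi : i < q) :
    ∑ j ∈ Finset.range q, c ((j : ℤ) - i).natAbs ≤ 2 * ∑ k ∈ Finset.range q, c k := by
  classical
  rw [← Finset.sum_filter_add_sum_filter_not (Finset.range q) (fun j => i ≤ j), two_mul]
  refine add_le_add (sum_range_filter_le ?_ ?_) (sum_range_filter_le ?_ ?_) <;> intros <;> omega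

end Sums

section Block
variable {Ω : Type*} {F₀ : MeasurableSpace Ω} [mΩ : MeasurableSpace Ω] {P : Measure Ω}
  [IsProbabilityMeasure P] {T : Ω ≃ᵐ Ω} {Y₀ : Ω → ℝ} {H : ℝ≥0 → ℝ}
  {L : ℕ} {b : Fin L → ℝ} {h : Fin L → ℝ → ℝ} {M : ℝ≥0}

omit [IsProbabilityMeasure P] in
theorem Standing.measurable_Y (S : Standing F₀ P T Y₀ H) (i : ℤ) : Measurable (shifted T Y₀ i) :=
  measurable_shifted (S.meas.mono S.le le_rfl) i

omit [IsProbabilityMeasure P] in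
theorem Standing.measurable_Y_zero (S : Standing F₀ P T Y₀ H) :
    Measurable[F₀] (shifted T Y₀ 0) := S.meas

omit [IsProbabilityMeasure P] in
theorem Standing.measure_lt_le (S : Standing F₀ P T Y₀ H) {h : ℝ → ℝ}
    (hh : IsLayered H (P.map Y₀) h) (i : ℤ) {t : ℝ} (ht : 0 ≤ t) :
    P (shifted T Y₀ i ⁻¹' {y | t < h y}) ≤ AlphaDep.tail H t := by
  refine le_trans (le_of_eq ?_) (hh.le_tail t ht)
  have hm : MeasurableSet {y | t < h y} := (hh.ordConnected t ht).measurableSet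
  have hY : Measurable Y₀ := S.meas.mono S.le le_rfl
  rw [Measure.map_apply hY hm]
  exact (measurePreserving_flow S.preserving i).measure_preimage (hY hm).nullMeasurableSet

/-- Correlation of an observable with the past at distance `n`. -/
theorem dual_single_comb (S : Standing F₀ P T Y₀ H) (hC : IsComb H (P.map Y₀) b h)
    (hM : ∀ l y, h l y ≤ M) {n : ℕ} (hn : n ≠ 0) {m i : ℤ} (hmi : m + n ≤ i) {Z : Ω → ℝ}
    (hZ : Measurable[pastAlg F₀ T m] Z) (hZ1 : ∀ ω, |Z ω| ≤ 1) :
    ‖∫ ω, Z ω * obs P (shifted T Y₀) (comb b h) i ω ∂P‖ₑ ≤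
      4 * (alpha F₀ P (shifted T Y₀) 2 n * M) := by
  have hZ' := measurable_comp_flow_neg hZ
  have e : ∫ ω, Z ω * obs P (shifted T Y₀) (comb b h) i ω ∂P =
      ∫ ω, Z (flow T (-m) ω) * obs P (shifted T Y₀) (comb b h) (i + -m) ω ∂P := by
    rw [← integral_flow S.preserving (-m)]
    simp_rw [obs_flow S.preserving]
  rw [e, show (4 : ℝ≥0∞) * (alpha F₀ P (shifted T Y₀) 2 n * M) =
    2 * (2 * alpha F₀ P (shifted T Y₀) 2 n * M) by ring]
  refine enorm_integral_mul_comb_le S.measurable_Y hC.sum_le (fun l => (hC.layered l).measurable)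
    (fun l => (hC.layered l).nonneg) hM (hZ'.mono S.le le_rfl) (fun ω => hZ1 _) _ fun l => ?_
  refine (enorm_integral_mul_obs_le S.measurable_Y (hC.layered l).measurable
    (hC.layered l).nonneg (hM l) (hZ'.mono S.le le_rfl) (fun ω => hZ1 _) _).trans ?_
  calc _ ≤ ∫⁻ t in Ioc (0 : ℝ) M, 2 * alpha F₀ P (shifted T Y₀) 2 n := by
        refine setLIntegral_mono' measurableSet_Ioc fun t ht => ?_
        exact dual_single_ordConnected S.le S.measurable_Y hZ' (fun ω => hZ1 _) hn (by omega)
          ((hC.layered l).ordConnected t ht.1.le)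
    _ = _ := by simp

theorem dual_pair_comb_of_le (S : Standing F₀ P T Y₀ H) (hC : IsComb H (P.map Y₀) b h)
    (hM : ∀ l y, h l y ≤ M) {n : ℕ} (hn : n ≠ 0) {m i j : ℤ} (hmi : m + n ≤ i) (hij : i ≤ j)
    {Z : Ω → ℝ} (hZ : Measurable[pastAlg F₀ T m] Z) (hZ1 : ∀ ω, |Z ω| ≤ 1) :
    ‖∫ ω, (Z ω - ∫ ω', Z ω' ∂P) * obs P (shifted T Y₀) (comb b h) i ω *
        obs P (shifted T Y₀) (comb b h) j ω ∂P‖ₑ ≤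
      16 * (alpha F₀ P (shifted T Y₀) 2 n * M ^ 2) := by
  have hZ' := measurable_comp_flow_neg hZ
  have hW : Measurable fun ω => Z (flow T (-m) ω) - ∫ ω', Z (flow T (-m) ω') ∂P :=
    (hZ'.mono S.le le_rfl).sub_const _
  have hW2 : ∀ ω, |Z (flow T (-m) ω) - ∫ ω', Z (flow T (-m) ω') ∂P| ≤ 2 :=
    abs_sub_integral_le (Z := fun ω => Z (flow T (-m) ω)) fun ω => hZ1 _
  have e : ∫ ω, (Z ω - ∫ ω', Z ω' ∂P) * obs P (shifted T Y₀) (comb b h) i ω *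
        obs P (shifted T Y₀) (comb b h) j ω ∂P =
      ∫ ω, (Z (flow T (-m) ω) - ∫ ω', Z (flow T (-m) ω') ∂P) *
        obs P (shifted T Y₀) (comb b h) (i + -m) ω *
        obs P (shifted T Y₀) (comb b h) (j + -m) ω ∂P := by
    rw [← integral_flow S.preserving (-m), integral_flow S.preserving (-m) Z]
    simp_rw [obs_flow S.preserving]
  rw [e, show (16 : ℝ≥0∞) * (alpha F₀ P (shifted T Y₀) 2 n * M ^ 2) =
    4 * (4 * alpha F₀ P (shifted T Y₀) 2 n * M * M) by ring]
  refine enorm_integral_mul_comb_mul_comb_le S.measurable_Y hC.sum_le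
    (fun l => (hC.layered l).measurable) (fun l => (hC.layered l).nonneg) hM hW hW2 _ _
    fun l l' => ?_
  refine (enorm_integral_mul_obs_mul_obs_le S.measurable_Y (hC.layered l).measurable
    (hC.layered l').measurable (hC.layered l).nonneg (hM l) (hC.layered l').nonneg (hM l')
    hW hW2 _ _).trans ?_
  calc _ ≤ ∫⁻ s in Ioc (0 : ℝ) M, ∫⁻ t in Ioc (0 : ℝ) M, 4 * alpha F₀ P (shifted T Y₀) 2 n := by
        refine setLIntegral_mono' measurableSet_Ioc fun s hs => ?_
        refine setLIntegral_mono' measurableSet_Ioc fun t ht => ?_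
        exact dual_pair_ordConnected S.le S.measurable_Y hZ' (fun ω => hZ1 _) hn (by omega)
          (by omega) ((hC.layered l).ordConnected s hs.1.le) ((hC.layered l').ordConnected t ht.1.le)
    _ = _ := by simp

/-- Correlation of two observables with the past at distance `n`. -/
theorem dual_pair_comb (S : Standing F₀ P T Y₀ H) (hC : IsComb H (P.map Y₀) b h)
    (hM : ∀ l y, h l y ≤ M) {n : ℕ} (hn : n ≠ 0) {m i j : ℤ} (hmi : m + n ≤ i) (hmj : m + n ≤ j)
    {Z : Ω → ℝ} (hZ : Measurable[pastAlg F₀ T m] Z) (hZ1 : ∀ ω, |Z ω| ≤ 1) :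
    ‖∫ ω, (Z ω - ∫ ω', Z ω' ∂P) * obs P (shifted T Y₀) (comb b h) i ω *
        obs P (shifted T Y₀) (comb b h) j ω ∂P‖ₑ ≤
      16 * (alpha F₀ P (shifted T Y₀) 2 n * M ^ 2) := by
  rcases le_total i j with hij | hij
  · exact dual_pair_comb_of_le S hC hM hn hmi hij hZ hZ1
  · have := dual_pair_comb_of_le S hC hM hn hmj hij hZ hZ1
    have e : ∀ a b c : ℝ, a * b * c = a * c * b := fun a b c => by ring
    simp_rw [e _ (obs P (shifted T Y₀) (comb b h) i _)]
    exact this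

/-- Bound for the sum of the covariances of a truncated combination. -/
theorem sum_cov_comb_le (S : Standing F₀ P T Y₀ H) (hC : IsComb H (P.map Y₀) b h)
    (hM : ∀ l y, h l y ≤ M) (q : ℕ) :
    ∑ k ∈ Finset.range q, ‖∫ ω, obs P (shifted T Y₀) (comb b h) 0 ω *
        obs P (shifted T Y₀) (comb b h) k ω ∂P‖ₑ ≤
      8 * ∫⁻ u in Icc (0 : ℝ) 1,
        min (q : ℝ≥0∞) (alphaInv F₀ P (shifted T Y₀) 2 u) * min (quantile H u) M ^ 2 := by
  refine le_trans ?_ (mul_le_mul' le_rfl (sum_lintegral_min_le S.tail q M))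
  rw [Finset.mul_sum]
  refine Finset.sum_le_sum fun k _ => ?_
  have h1 := enorm_integral_mul_comb_mul_comb_le (P := P) S.measurable_Y hC.sum_le
    (fun l => (hC.layered l).measurable) (fun l => (hC.layered l).nonneg) hM
    (W := fun _ => 1) measurable_const (w := 1) (fun _ => by simp) 0 k
    (C := 2 * ∫⁻ s in Ioc (0 : ℝ) M, ∫⁻ t in Ioc (0 : ℝ) M,
      min (min (alpha F₀ P (shifted T Y₀) 2 k) (1 / 2)) (min (tail H s) (tail H t))) ?_
  · simp only [one_mul] at h1
    refine h1.trans (le_of_eq ?_)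
    rw [← mul_assoc]; norm_num
  · intro l l'
    refine (enorm_integral_mul_obs_mul_obs_le S.measurable_Y (hC.layered l).measurable
      (hC.layered l').measurable (hC.layered l).nonneg (hM l) (hC.layered l').nonneg (hM l')
      measurable_const (w := 1) (fun _ => by simp) _ _).trans ?_
    rw [← lintegral_const_mul' _ _ (by simp)]
    refine setLIntegral_mono' measurableSet_Ioc fun s hs => ?_
    rw [← lintegral_const_mul' _ _ (by simp)]
    refine setLIntegral_mono' measurableSet_Ioc fun t ht => ?_
    simp only [one_mul]
    exact enorm_cov_ind_le S.le S.measurable_Y S.measurable_Y_zero k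
      ((hC.layered l).ordConnected s hs.1.le) ((hC.layered l').ordConnected t ht.1.le)
      (S.measure_lt_le (hC.layered l) 0 hs.1.le) (S.measure_lt_le (hC.layered l') k ht.1.le)

omit [IsProbabilityMeasure P] in
theorem measurable_blockSum (S : Standing F₀ P T Y₀ H) {g : ℝ → ℝ} (hg : Measurable g) (o : ℤ)
    (q : ℕ) : Measurable (blockSum (obs P (shifted T Y₀) g) o q) :=
  Finset.measurable_sum _ fun _ _ => measurable_obs S.measurable_Y hg _

omit [IsProbabilityMeasure P] in
theorem measurable_blockSum_pastAlg (S : Standing F₀ P T Y₀ H) {g : ℝ → ℝ} (hg : Measurable g)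
    {o m : ℤ} {q : ℕ} (h : o + q ≤ m) :
    Measurable[pastAlg F₀ T m] (blockSum (obs P (shifted T Y₀) g) o q) := by
  refine Finset.measurable_sum _ fun k hk => ?_
  have := Finset.mem_range.1 hk
  exact measurable_obs_pastAlg S.le_comap S.meas hg (by omega)

omit [IsProbabilityMeasure P] in
theorem blockSum_flow (S : Standing F₀ P T Y₀ H) (g : ℝ → ℝ) (o m : ℤ) (q : ℕ) (ω : Ω) :
    blockSum (obs P (shifted T Y₀) g) o q (flow T m ω) =
      blockSum (obs P (shifted T Y₀) g) (o + m) q ω := by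
  simp only [blockSum, obs_flow S.preserving]
  refine Finset.sum_congr rfl fun k _ => ?_
  congr 1; ring

theorem abs_blockSum_le (S : Standing F₀ P T Y₀ H) (hC : IsComb H (P.map Y₀) b h)
    (hM : ∀ l y, h l y ≤ M) (o : ℤ) (q : ℕ) (ω : Ω) :
    |blockSum (obs P (shifted T Y₀) (comb b h)) o q ω| ≤ 4 * (q * M) := by
  calc _ ≤ ∑ k ∈ Finset.range q, |obs P (shifted T Y₀) (comb b h) (o + 1 + k) ω| :=
        Finset.abs_sum_le_sum_abs _ _
    _ ≤ ∑ k ∈ Finset.range q, 4 * (M : ℝ) := Finset.sum_le_sum fun k _ =>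
        abs_obs_comb_le S.measurable_Y hC.sum_le (fun l => (hC.layered l).measurable)
          (fun l => (hC.layered l).nonneg) hM M.2 _ ω
    _ = _ := by simp; ring

/-- The conditional mean of a block given the past at distance `n`, in dual form. -/
theorem integral_mul_blockSum_le (S : Standing F₀ P T Y₀ H) (hC : IsComb H (P.map Y₀) b h)
    (hM : ∀ l y, h l y ≤ M) {n : ℕ} (hn : n ≠ 0) {v : ℝ} (hv : 0 ≤ v)
    (hα : alpha F₀ P (shifted T Y₀) 2 n ≤ ENNReal.ofReal v) {m o : ℤ} (hmo : m + n ≤ o) (q : ℕ)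
    {Z : Ω → ℝ} (hZ : Measurable[pastAlg F₀ T m] Z) (hZ1 : ∀ ω, |Z ω| ≤ 1) :
    ∫ ω, Z ω * blockSum (obs P (shifted T Y₀) (comb b h)) o q ω ∂P ≤ 4 * (q * M * v) := by
  have hmc := measurable_comb (b := b) fun l => (hC.layered l).measurable
  have hZm : Measurable Z := hZ.mono (pastAlg_le S.le m) le_rfl
  have hint : ∀ i, Integrable (fun ω => Z ω * obs P (shifted T Y₀) (comb b h) i ω) P := fun i =>
    (integrable_of_abs_le (measurable_obs S.measurable_Y hmc i) (4 * M)
      (abs_obs_comb_le S.measurable_Y hC.sum_le (fun l => (hC.layered l).measurable)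
          (fun l => (hC.layered l).nonneg) hM M.2 i)).bdd_mul hZm.aestronglyMeasurable
      (ae_of_all _ hZ1)
  simp only [blockSum, Finset.mul_sum]
  rw [integral_finsetSum _ fun k _ => hint _]
  calc _ ≤ ∑ k ∈ Finset.range q, 4 * (v * M) := by
        refine Finset.sum_le_sum fun k _ => ?_
        have h1 := dual_single_comb S hC hM hn (m := m) (i := o + 1 + k) (by omega) hZ hZ1
        have h2 : ‖∫ ω, Z ω * obs P (shifted T Y₀) (comb b h) (o + 1 + k) ω ∂P‖ₑ ≤
            ENNReal.ofReal (4 * (v * M)) := by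
          refine h1.trans ?_
          rw [ENNReal.ofReal_mul (by norm_num), ENNReal.ofReal_mul hv]
          refine mul_le_mul' (by simp) (mul_le_mul' hα (by simp))
        rw [Real.enorm_eq_ofReal_abs, ENNReal.ofReal_le_ofReal_iff (by positivity)] at h2
        exact (le_abs_self _).trans h2
    _ = _ := by simp; ring

/-- The conditional variance of a block given the past at distance `n` is its variance, up to an
error. -/
theorem setIntegral_blockSum_sq_le (S : Standing F₀ P T Y₀ H) (hC : IsComb H (P.map Y₀) b h)
    (hM : ∀ l y, h l y ≤ M) {n : ℕ} (hn : n ≠ 0) {v : ℝ} (hv : 0 ≤ v)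
    (hα : alpha F₀ P (shifted T Y₀) 2 n ≤ ENNReal.ofReal v) {m o : ℤ} (hmo : m + n ≤ o) (q : ℕ)
    {s : Set Ω} (hs : MeasurableSet[pastAlg F₀ T m] s) :
    ∫ ω in s, blockSum (obs P (shifted T Y₀) (comb b h)) o q ω ^ 2 ∂P ≤
      (∫ ω, blockSum (obs P (shifted T Y₀) (comb b h)) o q ω ^ 2 ∂P) * P.real s
        + 16 * (q ^ 2 * M ^ 2 * v) := by
  have hmc := measurable_comb (b := b) fun l => (hC.layered l).measurable
  have hsm : MeasurableSet s := pastAlg_le S.le m s hs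
  set U := blockSum (obs P (shifted T Y₀) (comb b h)) o q with hU
  set Z : Ω → ℝ := s.indicator fun _ => 1 with hZdef
  have hZ : Measurable[pastAlg F₀ T m] Z :=
    Measurable.indicator (@measurable_const _ _ _ (pastAlg F₀ T m) _) hs
  have hZ1 : ∀ ω, |Z ω| ≤ 1 := fun ω => by
    by_cases hω : ω ∈ s <;> simp [Z, hω]
  have hZm : Measurable Z := hZ.mono (pastAlg_le S.le m) le_rfl
  have hZint : ∫ ω, Z ω ∂P = P.real s := by
    rw [hZdef, integral_indicator hsm]; simp
  have hU2 : Integrable (fun ω => U ω ^ 2) P := by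
    refine integrable_of_abs_le ((measurable_blockSum S hmc o q).pow_const 2)
      ((4 * (q * M)) ^ 2) fun ω => ?_
    rw [abs_pow]
    exact pow_le_pow_left₀ (abs_nonneg _) (abs_blockSum_le S hC hM o q ω) 2
  have hZU : Integrable (fun ω => Z ω * U ω ^ 2) P :=
    hU2.bdd_mul hZm.aestronglyMeasurable (ae_of_all _ hZ1)
  have e1 : ∫ ω in s, U ω ^ 2 ∂P = ∫ ω, Z ω * U ω ^ 2 ∂P := by
    rw [← integral_indicator hsm]
    refine integral_congr_ae (ae_of_all _ fun ω => ?_)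
    by_cases hω : ω ∈ s <;> simp [Z, hω]
  have e2 : ∫ ω, (Z ω - ∫ ω', Z ω' ∂P) * U ω ^ 2 ∂P =
      ∫ ω in s, U ω ^ 2 ∂P - (∫ ω, U ω ^ 2 ∂P) * P.real s := by
    simp only [sub_mul]
    rw [integral_sub hZU (hU2.const_mul _), integral_const_mul, hZint, e1, mul_comm (P.real s)]
  have hint : ∀ i j, Integrable (fun ω => (Z ω - ∫ ω', Z ω' ∂P) *
      obs P (shifted T Y₀) (comb b h) i ω * obs P (shifted T Y₀) (comb b h) j ω) P := by
    intro i j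
    refine integrable_of_abs_le (((hZm.sub_const _).mul (measurable_obs S.measurable_Y hmc i)).mul
      (measurable_obs S.measurable_Y hmc j)) (2 * (4 * M) * (4 * M)) fun ω => ?_
    have hb := fun i => abs_obs_comb_le (P := P) S.measurable_Y hC.sum_le
      (fun l => (hC.layered l).measurable) (fun l => (hC.layered l).nonneg) hM M.2 i ω
    rw [abs_mul, abs_mul]
    exact mul_le_mul (mul_le_mul (abs_sub_integral_le hZ1 ω) (hb i) (abs_nonneg _) (by norm_num))
      (hb j) (abs_nonneg _) (by positivity)
  have e3 : ∀ ω, (Z ω - ∫ ω', Z ω' ∂P) * U ω ^ 2 = ∑ k ∈ Finset.range q, ∑ k' ∈ Finset.range q,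
      (Z ω - ∫ ω', Z ω' ∂P) * obs P (shifted T Y₀) (comb b h) (o + 1 + k) ω *
        obs P (shifted T Y₀) (comb b h) (o + 1 + k') ω := by
    intro ω
    rw [hU, blockSum, sq, Finset.sum_mul_sum, Finset.mul_sum]
    refine Finset.sum_congr rfl fun k _ => ?_
    rw [Finset.mul_sum]
    exact Finset.sum_congr rfl fun k' _ => by ring
  have e4 : ∫ ω, (Z ω - ∫ ω', Z ω' ∂P) * U ω ^ 2 ∂P ≤ 16 * (q ^ 2 * M ^ 2 * v) := by
    simp_rw [e3]
    rw [integral_finsetSum _ fun k _ => integrable_finsetSum _ fun k' _ => hint _ _]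
    simp_rw [integral_finsetSum _ fun k' _ => hint _ _]
    calc _ ≤ ∑ k ∈ Finset.range q, ∑ k' ∈ Finset.range q, 16 * (v * M ^ 2) := by
          refine Finset.sum_le_sum fun k _ => Finset.sum_le_sum fun k' _ => ?_
          have h1 := dual_pair_comb S hC hM hn (m := m) (i := o + 1 + k) (j := o + 1 + k')
            (by omega) (by omega) hZ hZ1
          have h2 : ‖∫ ω, (Z ω - ∫ ω', Z ω' ∂P) * obs P (shifted T Y₀) (comb b h) (o + 1 + k) ω *
              obs P (shifted T Y₀) (comb b h) (o + 1 + k') ω ∂P‖ₑ ≤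
              ENNReal.ofReal (16 * (v * M ^ 2)) := by
            refine h1.trans ?_
            rw [ENNReal.ofReal_mul (by norm_num), ENNReal.ofReal_mul hv,
              ENNReal.ofReal_pow M.coe_nonneg]
            refine mul_le_mul' (by simp) (mul_le_mul' hα (by simp))
          rw [Real.enorm_eq_ofReal_abs, ENNReal.ofReal_le_ofReal_iff (by positivity)] at h2
          exact (le_abs_self _).trans h2
      _ = _ := by simp; ring
  linarith

/-- Bound for the variance of a block, by stationarity and the sum of the covariances. -/
theorem integral_blockSum_sq_le (S : Standing F₀ P T Y₀ H) (hC : IsComb H (P.map Y₀) b h)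
    (hM : ∀ l y, h l y ≤ M) (o : ℤ) (q : ℕ) :
    ENNReal.ofReal (∫ ω, blockSum (obs P (shifted T Y₀) (comb b h)) o q ω ^ 2 ∂P) ≤
      16 * q * ∫⁻ u in Icc (0 : ℝ) 1,
        min (q : ℝ≥0∞) (alphaInv F₀ P (shifted T Y₀) 2 u) * min (quantile H u) M ^ 2 := by
  have hmc := measurable_comb (b := b) fun l => (hC.layered l).measurable
  set X := obs P (shifted T Y₀) (comb b h) with hX
  set c : ℕ → ℝ≥0∞ := fun k => ‖∫ ω, X 0 ω * X k ω ∂P‖ₑ with hc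
  have hint : ∀ i j, Integrable (fun ω => X i ω * X j ω) P := by
    intro i j
    refine integrable_of_abs_le ((measurable_obs S.measurable_Y hmc i).mul
      (measurable_obs S.measurable_Y hmc j)) ((4 * M) * (4 * M)) fun ω => ?_
    have hb := fun i => abs_obs_comb_le (P := P) S.measurable_Y hC.sum_le
      (fun l => (hC.layered l).measurable) (fun l => (hC.layered l).nonneg) hM M.2 i ω
    rw [abs_mul]
    exact mul_le_mul (hb i) (hb j) (abs_nonneg _) (by positivity)
  have hcov' : ∀ i j : ℤ, i ≤ j → ‖∫ ω, X i ω * X j ω ∂P‖ₑ = c (j - i).natAbs := by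
    intro i j hij
    rw [← integral_flow S.preserving (-i)]
    simp_rw [hX, obs_flow S.preserving, hc]
    have h1 : i + -i = 0 := by ring
    have h2 : j + -i = ((j - i).natAbs : ℤ) := by omega
    rw [h1, h2]
  have hcov : ∀ i j : ℤ, ‖∫ ω, X i ω * X j ω ∂P‖ₑ = c (j - i).natAbs := by
    intro i j
    rcases le_total i j with hij | hij
    · exact hcov' i j hij
    · simp_rw [mul_comm (X i _)]
      rw [hcov' j i hij]
      congr 1; omega
  have e : ∀ ω, blockSum X o q ω ^ 2 = ∑ k ∈ Finset.range q, ∑ k' ∈ Finset.range q,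
      X (o + 1 + k) ω * X (o + 1 + k') ω := fun ω => by
    rw [blockSum, sq, Finset.sum_mul_sum]
  simp_rw [e]
  rw [integral_finsetSum _ fun k _ => integrable_finsetSum _ fun k' _ => hint _ _]
  simp_rw [integral_finsetSum _ fun k' _ => hint _ _]
  refine (Real.ofReal_le_enorm _).trans ?_
  refine (enorm_sum_le _ _).trans ?_
  calc _ ≤ ∑ k ∈ Finset.range q, ∑ k' ∈ Finset.range q, c ((k' : ℤ) - k).natAbs := by
        refine Finset.sum_le_sum fun k _ => (enorm_sum_le _ _).trans (le_of_eq ?_)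
        refine Finset.sum_congr rfl fun k' _ => ?_
        rw [hcov]
        congr 2; ring
    _ ≤ ∑ k ∈ Finset.range q, 2 * ∑ k' ∈ Finset.range q, c k' :=
        Finset.sum_le_sum fun k hk => sum_natAbs_le c (Finset.mem_range.1 hk)
    _ = 2 * q * ∑ k' ∈ Finset.range q, c k' := by
        rw [Finset.sum_const, Finset.card_range, nsmul_eq_mul]; ring
    _ ≤ 2 * q * (8 * _) := mul_le_mul' le_rfl (sum_cov_comb_le S hC hM q)
    _ = _ := by ring

end Block

/-! ### Iteration over every other block -/

section Parity
variable {Ω : Type*} {F₀ : MeasurableSpace Ω} [mΩ : MeasurableSpace Ω] {P : Measure Ω}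
  [IsProbabilityMeasure P] {T : Ω ≃ᵐ Ω} {Y₀ : Ω → ℝ} {H : ℝ≥0 → ℝ}
  {L : ℕ} {b : Fin L → ℝ} {h : Fin L → ℝ → ℝ} {M : ℝ≥0}

omit [IsProbabilityMeasure P] in
theorem measureReal_blockSum_shift (S : Standing F₀ P T Y₀ H) {g : ℝ → ℝ} (hg : Measurable g)
    (o : ℤ) (q : ℕ) (z : ℝ) :
    P.real {ω | z < |blockSum (obs P (shifted T Y₀) g) o q ω|} =
      P.real {ω | z < |blockSum (obs P (shifted T Y₀) g) 0 q ω|} := by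
  have hm : MeasurableSet {ω | z < |blockSum (obs P (shifted T Y₀) g) 0 q ω|} :=
    measurableSet_lt_abs (measurable_blockSum S hg 0 q) z
  have h1 := (measurePreserving_flow S.preserving o).measure_preimage hm.nullMeasurableSet
  rw [measureReal_def, measureReal_def, ← h1]
  congr 2
  ext ω
  simp only [mem_preimage, mem_ofPred_eq, blockSum_flow S, zero_add]

/-- Iterated good-`λ` inequality for the sums of every other block. -/
theorem alternate_blocks_le_sum (S : Standing F₀ P T Y₀ H) (hC : IsComb H (P.map Y₀) b h)
    (hM : ∀ l y, h l y ≤ M) {q : ℕ} (hq : q ≠ 0) {v : ℝ} (hv : 0 ≤ v)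
    (hα : alpha F₀ P (shifted T Y₀) 2 q ≤ ENNReal.ofReal v) (o : ℤ) (N : ℕ) {y₀ : ℝ} (hy₀ : 0 < y₀)
    (E J : ℕ)
    (hJ : 4 ^ (J + 1) * 4 ^ E *
      (N * ∫ ω, blockSum (obs P (shifted T Y₀) (comb b h)) 0 q ω ^ 2 ∂P) ≤ y₀ ^ 2) :
    P.real {ω | ∃ j ≤ N, y₀ < |∑ k ∈ Finset.range j,
        blockSum (obs P (shifted T Y₀) (comb b h)) (o + 2 * k * q) q ω|} ≤
      ∑ j ∈ Finset.range J, (1 / 4 ^ E : ℝ) ^ j *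
        (N * P.real {ω | y₀ / 2 ^ (j + 2) < |blockSum (obs P (shifted T Y₀) (comb b h)) 0 q ω|} +
          4 / (y₀ / 2 ^ (j + 1)) ^ 2 * (N * (16 * (q ^ 2 * M ^ 2 * v) +
            8 * (y₀ / 2 ^ (j + 1)) * (4 * (q * M * v))))) + (1 / 4 ^ E : ℝ) ^ J := by
  have hmc := measurable_comb (b := b) fun l => (hC.layered l).measurable
  set X := obs P (shifted T Y₀) (comb b h) with hX
  set U : ℕ → Ω → ℝ := fun k => blockSum X (o + 2 * k * q) q with hU
  set p : ℕ → ℝ := fun j =>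
    P.real {ω | ∃ i ≤ N, y₀ / 2 ^ j < |∑ k ∈ Finset.range i, U k ω|} with hp
  set σ := ∫ ω, blockSum X 0 q ω ^ 2 ∂P with hσ
  have hσ0 : 0 ≤ σ := integral_nonneg fun ω => sq_nonneg _
  have hUσ : ∀ k, ∫ ω, U k ω ^ 2 ∂P = σ := by
    intro k
    rw [hσ, ← integral_flow S.preserving (o + 2 * k * q) fun ω => blockSum X 0 q ω ^ 2]
    simp only [hX, blockSum_flow S, zero_add, hU]
  have hrec : ∀ j < J, p j ≤ (N * P.real {ω | y₀ / 2 ^ (j + 2) < |blockSum X 0 q ω|} +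
          4 / (y₀ / 2 ^ (j + 1)) ^ 2 * (N * (16 * (q ^ 2 * M ^ 2 * v) +
            8 * (y₀ / 2 ^ (j + 1)) * (4 * (q * M * v))))) + 1 / 4 ^ E * p (j + 1) := by
    intro j hj
    have hl : 0 < y₀ / 2 ^ (j + 1) := by positivity
    -- The `k`-th block starts at time `o + 2kq`, and the past ends `q` time steps before.
    have hgl := good_lambda P U (fun k => pastAlg F₀ T (o + 2 * k * q - q)) N
      (fun k => pastAlg_le S.le _) (fun k => measurable_blockSum S hmc _ _) (by
        intro k i hik
        refine Finset.measurable_sum _ fun l hl => ?_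
        refine measurable_blockSum_pastAlg S hmc ?_
        have hl' := Finset.mem_range.1 hl
        have : (l : ℤ) + 1 ≤ k := by omega
        have hq0 : (0 : ℤ) ≤ q := by positivity
        nlinarith)
      (4 * (q * M)) (fun k ω => abs_blockSum_le S hC hM _ _ ω) (4 * (q * M * v))
      (16 * (q ^ 2 * M ^ 2 * v)) σ hσ0
      (fun k _ Z hZ hZ1 => integral_mul_blockSum_le S hC hM hq hv hα (by omega) q hZ hZ1)
      (fun k _ s hs => by
        rw [← hUσ k]
        exact setIntegral_blockSum_sq_le S hC hM hq hv hα (by omega) q hs)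
      (y₀ / 2 ^ (j + 1)) (1 / 2) hl le_rfl
    have e1 : 2 * (y₀ / 2 ^ (j + 1)) = y₀ / 2 ^ j := by rw [pow_succ]; field_simp
    have e2 : 1 / 2 * (y₀ / 2 ^ (j + 1)) = y₀ / 2 ^ (j + 2) := by
      rw [pow_succ 2 (j + 1)]; field_simp
    rw [e1, e2] at hgl
    have hun : P.real {ω | ∃ k < N, y₀ / 2 ^ (j + 2) < |U k ω|} ≤
        N * P.real {ω | y₀ / 2 ^ (j + 2) < |blockSum X 0 q ω|} := by
      have e3 : {ω | ∃ k < N, y₀ / 2 ^ (j + 2) < |U k ω|} =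
          ⋃ k ∈ Finset.range N, {ω | y₀ / 2 ^ (j + 2) < |U k ω|} := by
        ext ω; simp
      rw [e3]
      refine (measureReal_biUnion_finset_le _ _).trans (le_of_eq ?_)
      simp only [hU, hX, measureReal_blockSum_shift S hmc]
      simp
    have hcoef : 4 / (y₀ / 2 ^ (j + 1)) ^ 2 * (N * σ) ≤ 1 / 4 ^ E := by
      rw [div_pow, ← pow_mul, mul_comm (j + 1) 2, pow_mul, div_div_eq_mul_div, div_mul_eq_mul_div,
        div_le_div_iff₀ (by positivity) (by positivity)]
      have h4 : (4 : ℝ) * (2 ^ 2) ^ (j + 1) ≤ 4 ^ (J + 1) := by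
        rw [show (2 : ℝ) ^ 2 = 4 by norm_num, ← pow_succ']
        exact pow_le_pow_right₀ (by norm_num) (by omega)
      have h5 : (0 : ℝ) ≤ 4 ^ E * (N * σ) := by positivity
      nlinarith [mul_le_mul_of_nonneg_right h4 h5]
    have hpn : 0 ≤ p (j + 1) := measureReal_nonneg
    calc p j ≤ _ := hgl
      _ ≤ _ := by
        have := mul_le_mul_of_nonneg_right hcoef hpn
        simp only [hp] at this ⊢
        linarith
  have h0 := le_sum_of_recursion (p := p) (θ := 1 / 4 ^ E) (by positivity) J hrec
  have hp0 : p 0 = P.real {ω | ∃ j ≤ N, y₀ < |∑ k ∈ Finset.range j, U k ω|} := by simp [hp]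
  rw [hp0] at h0
  refine h0.trans ?_
  have hpJ : p J ≤ 1 := measureReal_le_one
  have : (1 / 4 ^ E : ℝ) ^ J * p J ≤ (1 / 4 ^ E : ℝ) ^ J := mul_le_of_le_one_right (by positivity) hpJ
  linarith

theorem sum_half_pow_le (J : ℕ) : ∑ j ∈ Finset.range J, (1 / 2 : ℝ) ^ j ≤ 2 := by
  have := geom_sum_eq (by norm_num : (1 / 2 : ℝ) ≠ 1) J
  rw [this, div_le_iff_of_neg (by norm_num)]
  have : (0 : ℝ) < (1 / 2) ^ J := by positivity
  linarith

/-- The tail of a geometric series from the index `9` on. The value `1 / 4` leaves a contraction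
after adding the walks of the even-numbered and of the odd-numbered blocks. -/
theorem sum_late_half_pow_le (J : ℕ) :
    ∑ j ∈ Finset.range J, (if j < 9 then 0 else 64 * (1 / 2 : ℝ) ^ j) ≤ 1 / 4 := by
  have key : ∀ J, ∑ j ∈ Finset.range J, (if j < 9 then 0 else 64 * (1 / 2 : ℝ) ^ j) ≤
      1 / 4 - 128 * (1 / 2) ^ (max J 9) := by
    intro J
    induction J with
    | zero => norm_num
    | succ J ih =>
      rw [Finset.sum_range_succ]
      by_cases hJ : J < 9
      · rw [max_eq_right (by omega)] at ih ⊢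
        simpa [hJ] using ih
      · rw [max_eq_left (by omega)] at ih ⊢
        simp only [hJ, if_false]
        rw [pow_succ]
        linarith
  have := key J
  have h2 : (0 : ℝ) < 128 * (1 / 2) ^ (max J 9) := by positivity
  linarith

/-- The sums of every other block, when a bound `B` is known for the single blocks up to the factor
`z^E` at the level `y / z`. Only a fourth of `B` is left, since truncation disposes of the highest
levels and the gain `4^(-E)` at each step beats the growth of `z^E`. -/
theorem alternate_blocks_le (S : Standing F₀ P T Y₀ H) (hC : IsComb H (P.map Y₀) b h)
    (hM : ∀ l y, h l y ≤ M) {q n : ℕ} (hq : q ≠ 0) {v w : ℝ} (hv : 0 ≤ v)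
    (hα : alpha F₀ P (shifted T Y₀) 2 q ≤ ENNReal.ofReal v) (o : ℤ) {N : ℕ} (hN : N * q ≤ n) {y : ℝ}
    (hy : 0 < y) {E J : ℕ} (hE : 2 ≤ E)
    (hJ : 4 ^ (J + 1) * 4 ^ E *
      (N * ∫ ω, blockSum (obs P (shifted T Y₀) (comb b h)) 0 q ω ^ 2 ∂P) ≤ (y / 16) ^ 2)
    (hqM : q * (M : ℝ) ≤ y / 2 ^ 17) (hw : M * v ≤ w) {B : ℝ} (hB : 0 ≤ B)
    (hind : ∀ j ≥ 9, N * P.real {ω | y / 2 ^ (j + 6) <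
      |blockSum (obs P (shifted T Y₀) (comb b h)) 0 q ω|} ≤ (2 ^ (j + 6)) ^ E * B) :
    P.real {ω | ∃ j ≤ N, y / 16 < |∑ k ∈ Finset.range j,
        blockSum (obs P (shifted T Y₀) (comb b h)) (o + 2 * k * q) q ω|} ≤
      B / 4 + 8194 * (n / y * w) + (1 / 4 ^ E : ℝ) ^ J := by
  have h1 := alternate_blocks_le_sum S hC hM hq hv hα o N (y₀ := y / 16) (by positivity) E J hJ
  refine h1.trans (add_le_add ?_ le_rfl)
  have hw0 : 0 ≤ w := (mul_nonneg M.2 hv).trans hw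
  have hnw : 0 ≤ n / y * w := by positivity
  have hMv : 0 ≤ M * v := mul_nonneg M.2 hv
  have hterm : ∀ j ∈ Finset.range J, (1 / 4 ^ E : ℝ) ^ j *
        (N * P.real {ω | y / 16 / 2 ^ (j + 2) <
            |blockSum (obs P (shifted T Y₀) (comb b h)) 0 q ω|} +
          4 / (y / 16 / 2 ^ (j + 1)) ^ 2 * (N * (16 * (q ^ 2 * M ^ 2 * v) +
            8 * (y / 16 / 2 ^ (j + 1)) * (4 * (q * M * v))))) ≤
      (if j < 9 then 0 else 64 * (1 / 2 : ℝ) ^ j) * B + 4097 * (n / y * w) * (1 / 2) ^ j := by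
    intro j _
    have e1 : y / 16 / 2 ^ (j + 2) = y / 2 ^ (j + 6) := by
      rw [pow_add, pow_add 2 j 6]; field_simp; norm_num
    rw [mul_add]
    refine add_le_add ?_ ?_
    · rw [e1]
      by_cases hj : j < 9
      -- The truncated block is at most `4 q M ≤ y / 2^15`, so it exceeds none of the levels `j < 9`.
      · have hempty : {ω | y / 2 ^ (j + 6) <
            |blockSum (obs P (shifted T Y₀) (comb b h)) 0 q ω|} = ∅ := by
          refine eq_empty_of_forall_notMem fun ω hω => ?_
          have h2 : y / 2 ^ (j + 6) < _ := hω
          have h3 := abs_blockSum_le S hC hM 0 q ω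
          have h4 : y / 2 ^ 15 ≤ y / 2 ^ (j + 6) :=
            div_le_div_of_nonneg_left hy.le (by positivity)
              (pow_le_pow_right₀ (by norm_num) (by omega))
          have h5 : y / 2 ^ 15 = 4 * (y / 2 ^ 17) := by norm_num; ring
          linarith
        rw [hempty]; simp [hj]
      · have h2 := hind j (by omega)
        simp only [hj, if_false]
        calc (1 / 4 ^ E : ℝ) ^ j * _ ≤ (1 / 4 ^ E : ℝ) ^ j * ((2 ^ (j + 6)) ^ E * B) :=
              mul_le_mul_of_nonneg_left h2 (by positivity)
          _ = ((1 / 4) ^ j * 2 ^ (j + 6)) ^ E * B := by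
              have e2 : (1 / 4 ^ E : ℝ) ^ j = ((1 / 4) ^ j) ^ E := by
                rw [← pow_mul, mul_comm j E, pow_mul, one_div_pow (4 : ℝ) E]
              rw [e2, mul_pow]; ring
          _ = (64 * (1 / 2) ^ j) ^ E * B := by
              congr 2
              rw [pow_add, show (1 / 4 : ℝ) = 1 / 2 * (1 / 2) by norm_num, mul_pow]
              have : (1 / 2 : ℝ) ^ j * 2 ^ j = 1 := by rw [← mul_pow]; norm_num
              calc _ = (1 / 2 : ℝ) ^ j * 2 ^ j * ((1 / 2) ^ j * 2 ^ 6) := by ring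
                _ = _ := by rw [this]; norm_num; ring
          _ ≤ (64 * (1 / 2) ^ j) * B := by
              refine mul_le_mul_of_nonneg_right ?_ hB
              refine pow_le_of_le_one (by positivity) ?_ (by omega)
              have : (1 / 2 : ℝ) ^ j ≤ (1 / 2) ^ 9 :=
                pow_le_pow_of_le_one (by norm_num) (by norm_num) (by omega)
              calc (64 : ℝ) * (1 / 2) ^ j ≤ 64 * (1 / 2) ^ 9 := by linarith
                _ ≤ 1 := by norm_num
    · have hθ : (1 / 4 ^ E : ℝ) ^ j ≤ (1 / 16) ^ j := by
        refine pow_le_pow_left₀ (by positivity) ?_ j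
        rw [show (1 / 16 : ℝ) = 1 / 4 ^ 2 by norm_num]
        exact one_div_le_one_div_of_le (by positivity) (pow_le_pow_right₀ (by norm_num) hE)
      have hNq : (N : ℝ) * q ≤ n := by exact_mod_cast hN
      have h1 : (N : ℝ) * q * (M * v) ≤ n * w :=
        mul_le_mul hNq hw hMv (by positivity)
      have hq0 : 0 ≤ (q : ℝ) * M := by positivity
      have h2 : (q : ℝ) * M * ((N : ℝ) * q * (M * v)) ≤ y / 2 ^ 17 * (n * w) :=
        mul_le_mul hqM h1 (by positivity) (by positivity)
      have h2j : (1 : ℝ) ≤ 2 ^ j := one_le_pow₀ (by norm_num)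
      -- One factor `q M` in the variance error is at most `y / 2^17`, so that both errors are of
      -- order `N q M v / y ≤ n w / y`.
      have e2 : 4 / (y / 16 / 2 ^ (j + 1)) ^ 2 * (N * (16 * (q ^ 2 * M ^ 2 * v) +
            8 * (y / 16 / 2 ^ (j + 1)) * (4 * (q * M * v)))) =
          65536 * (2 ^ j) ^ 2 * (q * M * (N * q * (M * v))) / y ^ 2 +
            4096 * 2 ^ j * (N * q * (M * v)) / y := by
        rw [pow_succ]; field_simp; ring
      have h3 : 65536 * (2 ^ j) ^ 2 * (q * M * (N * q * (M * v))) / y ^ 2 +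
            4096 * 2 ^ j * (N * q * (M * v)) / y ≤ 4097 * (2 ^ j) ^ 2 * (n / y * w) := by
        calc _ ≤ 65536 * (2 ^ j) ^ 2 * (y / 2 ^ 17 * (n * w)) / y ^ 2 +
            4096 * (2 ^ j) ^ 2 * (n * w) / y := by
              gcongr
              nlinarith
          _ = (1 / 2 + 4096) * (2 ^ j) ^ 2 * (n / y * w) := by field_simp; norm_num; ring
          _ ≤ _ := by
              refine mul_le_mul_of_nonneg_right ?_ hnw
              refine mul_le_mul_of_nonneg_right (by norm_num) (by positivity)
      rw [e2]
      calc _ ≤ (1 / 16 : ℝ) ^ j * (4097 * (2 ^ j) ^ 2 * (n / y * w)) :=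
            mul_le_mul hθ h3 (by positivity) (by positivity)
        _ = 4097 * (n / y * w) * ((1 / 16) ^ j * (2 ^ j) ^ 2) := by ring
        _ ≤ _ := by
            refine mul_le_mul_of_nonneg_left ?_ (by positivity)
            rw [← pow_mul, mul_comm j 2, pow_mul, ← mul_pow]
            exact pow_le_pow_left₀ (by norm_num) (by norm_num) j
  refine (Finset.sum_le_sum hterm).trans ?_
  rw [Finset.sum_add_distrib, ← Finset.sum_mul, ← Finset.mul_sum]
  have h3 := mul_le_mul_of_nonneg_right (sum_late_half_pow_le J) hB
  have h4 := mul_le_mul_of_nonneg_left (sum_half_pow_le J)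
    (by positivity : 0 ≤ 4097 * (n / y * w))
  linarith

end Parity

/-! ### Comparison, truncation and decomposition into blocks -/

/-- The event that some `|S_k|`, `1 ≤ k ≤ n`, is at least `y`. -/
def maxEvent {Ω : Type*} (X : ℤ → Ω → ℝ) (n : ℕ) (y : ℝ) : Set Ω :=
  {ω | ∃ k ∈ Finset.Icc 1 n, y ≤ |partialSum X k ω|}

theorem partialSum_eq_blockSum {Ω : Type*} (X : ℤ → Ω → ℝ) (n : ℕ) (ω : Ω) :
    partialSum X n ω = blockSum X 0 n ω := by
  rw [partialSum, blockSum, Finset.range_eq_Ico, ← Finset.Ico_add_one_right_eq_Icc,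
    ← Finset.sum_Ico_add' (fun k : ℕ => X (k : ℤ) ω) 0 n 1]
  refine Finset.sum_congr rfl fun k _ => ?_
  congr 1; push_cast; ring

section Compare
variable {Ω : Type*} [mΩ : MeasurableSpace Ω] {P : Measure Ω} [IsProbabilityMeasure P]
  {Y : ℤ → Ω → ℝ}

/-- Comparison of the maxima of two sequences of observables that are close in `L¹`. -/
theorem measureReal_maxEvent_le_add {g g' : ℝ → ℝ} {n : ℕ} {ε y : ℝ} (hy : 0 < y)
    (hg : ∀ i, Integrable (fun ω => g (Y i ω)) P) (hg' : ∀ i, Integrable (fun ω => g' (Y i ω)) P)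
    (hε : ∀ i, ∫ ω, |g (Y i ω) - g' (Y i ω)| ∂P ≤ ε) :
    P.real (maxEvent (obs P Y g) n y) ≤
      P.real (maxEvent (obs P Y g') n (y / 2)) + 4 * (n / y * ε) := by
  set D : Ω → ℝ := fun ω => ∑ k ∈ Finset.Icc 1 n,
    |obs P Y g (k : ℤ) ω - obs P Y g' (k : ℤ) ω| with hD
  have hd : ∀ i : ℤ, ∀ ω, obs P Y g i ω - obs P Y g' i ω =
      (g (Y i ω) - g' (Y i ω)) - ∫ ω, (g (Y i ω) - g' (Y i ω)) ∂P := by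
    intro i ω
    simp only [obs, centered]
    rw [integral_sub (hg i) (hg' i)]; ring
  have hdi : ∀ i : ℤ, Integrable (fun ω => |obs P Y g i ω - obs P Y g' i ω|) P := by
    intro i
    simp_rw [hd]
    exact (((hg i).sub (hg' i)).sub (integrable_const _)).abs
  have hd1 : ∀ i : ℤ, ∫ ω, |obs P Y g i ω - obs P Y g' i ω| ∂P ≤ 2 * ε := by
    intro i
    have hi : Integrable (fun ω => |g (Y i ω) - g' (Y i ω)|) P := ((hg i).sub (hg' i)).abs
    calc ∫ ω, |obs P Y g i ω - obs P Y g' i ω| ∂P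
        ≤ ∫ ω, (|g (Y i ω) - g' (Y i ω)| + ε) ∂P := by
          refine integral_mono (hdi i) (hi.add (integrable_const _)) fun ω => ?_
          show |obs P Y g i ω - obs P Y g' i ω| ≤ |g (Y i ω) - g' (Y i ω)| + ε
          rw [hd]
          refine (abs_sub _ _).trans (add_le_add le_rfl ?_)
          exact (abs_integral_le_integral_abs).trans (hε i)
      _ = ∫ ω, |g (Y i ω) - g' (Y i ω)| ∂P + ε := by
          rw [integral_add hi (integrable_const _)]; simp
      _ ≤ 2 * ε := by linarith [hε i]
  have hDi : ∫ ω, D ω ∂P ≤ n * (2 * ε) := by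
    simp only [hD]
    rw [integral_finsetSum (f := fun (k : ℕ) ω => |obs P Y g (k : ℤ) ω - obs P Y g' (k : ℤ) ω|) _
      fun k _ => hdi (k : ℤ)]
    calc _ ≤ ∑ k ∈ Finset.Icc 1 n, 2 * ε := Finset.sum_le_sum fun k _ => hd1 k
      _ = _ := by simp
  have hmark : P.real {ω | y / 2 ≤ D ω} ≤ 4 * (n / y * ε) := by
    have h1 := mul_meas_ge_le_integral_of_nonneg (μ := P) (f := D)
      (ae_of_all _ fun ω => Finset.sum_nonneg fun k _ => abs_nonneg _)
      (integrable_finsetSum (f := fun (k : ℕ) ω => |obs P Y g (k : ℤ) ω - obs P Y g' (k : ℤ) ω|) _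
        fun k _ => hdi (k : ℤ)) (y / 2)
    have h2 := h1.trans hDi
    rw [show 4 * (n / y * ε) = (n * (2 * ε)) / (y / 2) by field_simp; ring,
      le_div_iff₀ (by positivity), mul_comm]
    exact h2
  have hsub : maxEvent (obs P Y g) n y ⊆ maxEvent (obs P Y g') n (y / 2) ∪ {ω | y / 2 ≤ D ω} := by
    rintro ω ⟨k, hk, hky⟩
    by_cases hω : y / 2 ≤ |partialSum (obs P Y g') k ω|
    · exact Or.inl ⟨k, hk, hω⟩
    right
    have h1 : |partialSum (obs P Y g) k ω - partialSum (obs P Y g') k ω| ≤ D ω := by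
      rw [partialSum, partialSum, ← Finset.sum_sub_distrib]
      refine (Finset.abs_sum_le_sum_abs _ _).trans ?_
      refine Finset.sum_le_sum_of_subset_of_nonneg ?_ fun _ _ _ => abs_nonneg _
      exact Finset.Icc_subset_Icc_right (Finset.mem_Icc.1 hk).2
    have h2 := abs_sub_abs_le_abs_sub (partialSum (obs P Y g) k ω) (partialSum (obs P Y g') k ω)
    show y / 2 ≤ D ω
    linarith [not_le.1 hω]
  calc _ ≤ _ := measureReal_mono hsub
    _ ≤ _ := measureReal_union_le _ _
    _ ≤ _ := add_le_add le_rfl hmark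

end Compare

section Trunc
variable {Ω : Type*} {F₀ : MeasurableSpace Ω} [mΩ : MeasurableSpace Ω] {P : Measure Ω}
  [IsProbabilityMeasure P] {T : Ω ≃ᵐ Ω} {Y₀ : Ω → ℝ} {H : ℝ≥0 → ℝ}
  {L : ℕ} {b : Fin L → ℝ} {h : Fin L → ℝ → ℝ}

/-- The `L¹` error of the truncation of a layered function at `M` is at most `∫_M^∞ H`. -/
theorem lintegral_sub_truncate_le (S : Standing F₀ P T Y₀ H) {h : ℝ → ℝ}
    (hh : IsLayered H (P.map Y₀) h) (M : ℝ≥0) (i : ℤ) :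
    ∫⁻ ω, ‖h (shifted T Y₀ i ω) - min (h (shifted T Y₀ i ω)) M‖ₑ ∂P ≤
      ∫⁻ t in Ioi (M : ℝ), tail H t := by
  have hcake : ∀ y, ‖h y - min (h y) M‖ₑ = ∫⁻ t in Ioi (M : ℝ), (Iio (h y)).indicator 1 t := by
    intro y
    rw [lintegral_indicator measurableSet_Iio, Measure.restrict_restrict measurableSet_Iio]
    simp only [Pi.one_apply, lintegral_const, one_mul, Measure.restrict_apply MeasurableSet.univ,
      univ_inter]
    rw [inter_comm, Ioi_inter_Iio, Real.volume_Ioo, Real.enorm_eq_ofReal_abs]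
    rcases le_total (h y) M with hy | hy
    · rw [min_eq_left hy, sub_self, abs_zero, ENNReal.ofReal_zero,
        ENNReal.ofReal_of_nonpos (by linarith)]
    · rw [min_eq_right hy, abs_of_nonneg (by linarith)]
  simp_rw [hcake]
  rw [lintegral_lintegral_swap]
  · refine setLIntegral_mono' measurableSet_Ioi fun t ht => ?_
    have ht0 : 0 ≤ t := M.coe_nonneg.trans (le_of_lt ht)
    refine le_trans (le_of_eq ?_) (S.measure_lt_le hh i ht0)
    have hm : MeasurableSet (shifted T Y₀ i ⁻¹' {y | t < h y}) :=
      S.measurable_Y i (hh.ordConnected t ht0).measurableSet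
    rw [← lintegral_indicator_one hm]
    refine lintegral_congr fun ω => ?_
    rfl
  · have : MeasurableSet {p : Ω × ℝ | p.2 < h (shifted T Y₀ i p.1)} :=
      measurableSet_lt measurable_snd ((hh.measurable.comp (S.measurable_Y i)).comp measurable_fst)
    exact ((measurable_const (a := (1 : ℝ≥0∞))).indicator this).aemeasurable

theorem integrable_layered (S : Standing F₀ P T Y₀ H)
    (hQ : ∫⁻ u in Icc (0 : ℝ) 1, quantile H u ≠ ⊤) {h : ℝ → ℝ}
    (hh : IsLayered H (P.map Y₀) h) (i : ℤ) : Integrable (fun ω => h (shifted T Y₀ i ω)) P := by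
  refine ⟨(hh.measurable.comp (S.measurable_Y i)).aestronglyMeasurable, ?_⟩
  have h1 := lintegral_sub_truncate_le S hh 0 i
  have h2 := lintegral_tail_le S.tail (v := 2) (M := 0) (fun u hu hu' => by linarith)
  have h3 : ∫⁻ u in Icc (0 : ℝ) 1, (Iio 2).indicator (quantile H) u ≤
      ∫⁻ u in Icc (0 : ℝ) 1, quantile H u :=
    lintegral_mono fun u => indicator_le_self' (fun _ _ => bot_le) u
  refine lt_of_le_of_lt (le_trans (le_of_eq ?_) (h1.trans (h2.trans h3))) hQ.lt_top
  refine lintegral_congr fun ω => ?_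
  rw [NNReal.coe_zero, min_eq_right (hh.nonneg _), sub_zero]

theorem integral_abs_comb_sub_truncate_le (S : Standing F₀ P T Y₀ H)
    (hC : IsComb H (P.map Y₀) b h) (M : ℝ≥0)
    {w : ℝ} (hw0 : 0 ≤ w) (hw : ∫⁻ t in Ioi (M : ℝ), tail H t ≤ ENNReal.ofReal w) (i : ℤ) :
    ∫ ω, |comb b h (shifted T Y₀ i ω) - comb b (fun l y => min (h l y) M) (shifted T Y₀ i ω)| ∂P ≤
      2 * w := by
  have h1 : ∫⁻ ω, ‖comb b h (shifted T Y₀ i ω) -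
      comb b (fun l y => min (h l y) M) (shifted T Y₀ i ω)‖ₑ ∂P ≤ ENNReal.ofReal (2 * w) := by
    have hm : ∀ l, Measurable fun ω =>
        ‖h l (shifted T Y₀ i ω) - min (h l (shifted T Y₀ i ω)) M‖ₑ := fun l => by
      have h0 := (hC.layered l).measurable.comp (S.measurable_Y i)
      exact (h0.sub (h0.min measurable_const)).enorm
    calc _ ≤ ∫⁻ ω, ∑ l, ‖b l‖ₑ * ‖h l (shifted T Y₀ i ω) - min (h l (shifted T Y₀ i ω)) M‖ₑ ∂P := by
          refine lintegral_mono fun ω => ?_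
          simp only [comb]
          rw [← Finset.sum_sub_distrib]
          refine (enorm_sum_le _ _).trans (le_of_eq ?_)
          refine Finset.sum_congr rfl fun l _ => ?_
          rw [← mul_sub, enorm_mul]
      _ = ∑ l, ‖b l‖ₑ * ∫⁻ ω, ‖h l (shifted T Y₀ i ω) - min (h l (shifted T Y₀ i ω)) M‖ₑ ∂P := by
          rw [lintegral_finsetSum _ fun l _ => (hm l).const_mul _]
          refine Finset.sum_congr rfl fun l _ => ?_
          rw [lintegral_const_mul _ (hm l)]
      _ ≤ ∑ l, ‖b l‖ₑ * ENNReal.ofReal w := Finset.sum_le_sum fun l _ =>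
          mul_le_mul' le_rfl ((lintegral_sub_truncate_le S (hC.layered l) M i).trans hw)
      _ ≤ _ := by
          rw [← Finset.sum_mul, ENNReal.ofReal_mul (by norm_num)]
          exact mul_le_mul' (by simpa using hC.sum_le) le_rfl
  have hmc := measurable_comb (b := b) fun l => (hC.layered l).measurable
  have hmc' := measurable_comb (b := b) fun l => ((hC.truncate M).layered l).measurable
  have h2 := integral_norm_eq_lintegral_enorm (μ := P) ((hmc.comp (S.measurable_Y i)).sub
    (hmc'.comp (S.measurable_Y i))).aestronglyMeasurable
  refine (le_of_eq h2).trans ?_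
  exact ENNReal.toReal_le_of_le_ofReal (by positivity) h1

theorem integrable_comb (S : Standing F₀ P T Y₀ H)
    (hQ : ∫⁻ u in Icc (0 : ℝ) 1, quantile H u ≠ ⊤) (hC : IsComb H (P.map Y₀) b h) (i : ℤ) :
    Integrable (fun ω => comb b h (shifted T Y₀ i ω)) P :=
  integrable_finsetSum _ fun l _ => (integrable_layered S hQ (hC.layered l) i).const_mul _

end Trunc

section Blocks
variable {Ω : Type*}

theorem blockSum_add (X : ℤ → Ω → ℝ) (o : ℤ) (p r : ℕ) (ω : Ω) :
    blockSum X o (p + r) ω = blockSum X o p ω + blockSum X (o + p) r ω := by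
  rw [blockSum, Finset.sum_range_add, blockSum, blockSum]
  congr 1
  refine Finset.sum_congr rfl fun k _ => ?_
  congr 1; push_cast; ring

theorem blockSum_mul (X : ℤ → Ω → ℝ) (i q : ℕ) (ω : Ω) :
    blockSum X 0 (i * q) ω = ∑ k ∈ Finset.range i, blockSum X ((k : ℤ) * q) q ω := by
  induction i with
  | zero => simp [blockSum]
  | succ i ih =>
    rw [Nat.succ_mul, blockSum_add, ih, Finset.sum_range_succ]
    congr 2; push_cast; ring

theorem sum_range_parity (u : ℕ → ℝ) (i : ℕ) :
    ∑ k ∈ Finset.range i, u k =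
      ∑ k ∈ Finset.range ((i + 1) / 2), u (2 * k) + ∑ k ∈ Finset.range (i / 2), u (2 * k + 1) := by
  induction i with
  | zero => simp
  | succ i ih =>
    rw [Finset.sum_range_succ, ih]
    rcases Nat.even_or_odd' i with ⟨c, rfl | rfl⟩
    · have h1 : (2 * c + 1) / 2 = c := by omega
      have h2 : (2 * c + 1 + 1) / 2 = c + 1 := by omega
      have h3 : 2 * c / 2 = c := by omega
      rw [h1, h2, h3, Finset.sum_range_succ]; ring
    · have h1 : (2 * c + 1) / 2 = c := by omega
      have h2 : (2 * c + 1 + 1) / 2 = c + 1 := by omega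
      have h3 : (2 * c + 1 + 1 + 1) / 2 = c + 1 := by omega
      rw [h1, h2, h3, Finset.sum_range_succ (fun k => u (2 * k + 1))]; ring

/-- If a partial sum is large and the blocks are small, then the sum of the even-numbered blocks or
that of the odd-numbered ones is large at some time. -/
theorem maxEvent_subset_blocks {X : ℤ → Ω → ℝ} {n q : ℕ} (hq : q ≠ 0) (hqn : q ≤ n) {y : ℝ}
    (hy : 0 < y) (hX : ∀ o, ∀ r < q, ∀ ω, |blockSum X o r ω| ≤ y / 4) :
    maxEvent X n (y / 2) ⊆
      {ω | ∃ j ≤ n / q, y / 16 < |∑ k ∈ Finset.range j, blockSum X (0 + 2 * k * q) q ω|} ∪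
      {ω | ∃ j ≤ n / q, y / 16 < |∑ k ∈ Finset.range j, blockSum X (q + 2 * k * q) q ω|} := by
  rintro ω ⟨k, hk, hky⟩
  have hkn := (Finset.mem_Icc.1 hk).2
  have hN : 1 ≤ n / q := (Nat.one_le_div_iff (by omega)).2 hqn
  have hi : k / q ≤ n / q := Nat.div_le_div_right hkn
  have e1 : partialSum X k ω = ∑ j ∈ Finset.range (k / q), blockSum X ((j : ℤ) * q) q ω
      + blockSum X (((k / q * q : ℕ) : ℤ)) (k % q) ω := by
    rw [partialSum_eq_blockSum]
    conv_lhs => rw [← Nat.div_add_mod' k q]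
    rw [blockSum_add, blockSum_mul, zero_add]
  rw [sum_range_parity] at e1
  have hr := hX (((k / q * q : ℕ) : ℤ)) (k % q) (Nat.mod_lt _ (by omega)) ω
  have e2 : ∑ j ∈ Finset.range ((k / q + 1) / 2), blockSum X (((2 * j : ℕ) : ℤ) * q) q ω =
      ∑ j ∈ Finset.range ((k / q + 1) / 2), blockSum X (0 + 2 * j * q) q ω := by
    refine Finset.sum_congr rfl fun j _ => ?_
    congr 1; push_cast; ring
  have e3 : ∑ j ∈ Finset.range (k / q / 2), blockSum X (((2 * j + 1 : ℕ) : ℤ) * q) q ω =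
      ∑ j ∈ Finset.range (k / q / 2), blockSum X (q + 2 * j * q) q ω := by
    refine Finset.sum_congr rfl fun j _ => ?_
    congr 1; push_cast; ring
  rw [e2, e3] at e1
  by_contra hcon
  simp only [mem_union, mem_ofPred_eq, not_or, not_exists, not_and, not_lt] at hcon
  have h1 := hcon.1 ((k / q + 1) / 2) (by omega)
  have h2 := hcon.2 (k / q / 2) (by omega)
  have h3 : |partialSum X k ω| ≤ y / 16 + y / 16 + y / 4 := by
    rw [e1]
    refine (abs_add_le _ _).trans (add_le_add ?_ hr)
    exact (abs_add_le _ _).trans (add_le_add h1 h2)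
  linarith

end Blocks

/-! ### A Fuk–Nagaev type inequality for combinations -/

section Bound
variable {Ω : Type*} {F₀ : MeasurableSpace Ω} [mΩ : MeasurableSpace Ω] {P : Measure Ω}
  {Y : ℤ → Ω → ℝ} {H : ℝ≥0 → ℝ}

variable (F₀ P Y H) in
/-- The Fuk–Nagaev type bound: a Gaussian-scale term, and a heavy-tail term driven by the tail
integral. -/
def devBound (m : ℕ) (s a : ℝ) (n : ℕ) (y : ℝ) : ℝ :=
  (n / y ^ s) ^ a + n / y * (tailInt F₀ P Y H m y).toReal

theorem devBound_nonneg (m : ℕ) (s a : ℝ) (n : ℕ) {y : ℝ} (hy : 0 < y) :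
    0 ≤ devBound F₀ P Y H m s a n y := by
  rw [devBound]; positivity

/-- The bound grows at most polynomially when the level decreases. -/
theorem devBound_div_le (hQ : ∫⁻ u in Icc (0 : ℝ) 1, quantile H u ≠ ⊤) {m E : ℕ} {s a : ℝ}
    (hE : s * a ≤ E) (hmE : m + 1 ≤ E) (n k : ℕ) {y : ℝ} (hy : 0 < y) :
    devBound F₀ P Y H m s a n (y / 2 ^ k) ≤ (2 ^ k) ^ E * devBound F₀ P Y H m s a n y := by
  set t : ℝ := 2 ^ k with ht
  have ht1 : 1 ≤ t := one_le_pow₀ (by norm_num)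
  have ht0 : 0 < t := by positivity
  rw [devBound, devBound, mul_add]
  refine add_le_add ?_ ?_
  · have e : (n / (y / t) ^ s) ^ a = t ^ (s * a) * (n / y ^ s) ^ a := by
      rw [Real.div_rpow hy.le ht0.le, div_div_eq_mul_div, mul_comm, mul_div_assoc,
        Real.mul_rpow (by positivity) (by positivity), ← Real.rpow_mul ht0.le]
    rw [e]
    refine mul_le_mul_of_nonneg_right ?_ (by positivity)
    rw [← Real.rpow_natCast t E]
    exact Real.rpow_le_rpow_of_exponent_le ht1 hE
  · have hfin : tailInt F₀ P Y H m y ≠ ⊤ := ne_top_of_le_ne_top hQ (tailInt_le m y)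
    have h1 : (tailInt F₀ P Y H m (y / t)).toReal ≤ t ^ m * (tailInt F₀ P Y H m y).toReal := by
      have h2 := tailInt_mul_le (F₀ := F₀) (P := P) (Y := Y) (H := H) m (y := y)
        (inv_pos.2 ht0) (inv_le_one_of_one_le₀ ht1)
      rw [inv_inv, mul_comm t⁻¹ y, ← div_eq_mul_inv] at h2
      have h3 := ENNReal.toReal_mono (ENNReal.mul_ne_top (by simp) hfin) h2
      rwa [ENNReal.toReal_mul, ENNReal.toReal_pow, ENNReal.toReal_ofReal ht0.le] at h3
    calc n / (y / t) * (tailInt F₀ P Y H m (y / t)).toReal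
        ≤ n / (y / t) * (t ^ m * (tailInt F₀ P Y H m y).toReal) :=
          mul_le_mul_of_nonneg_left h1 (by positivity)
      _ = t ^ (m + 1) * (n / y * (tailInt F₀ P Y H m y).toReal) := by
          rw [pow_succ]; field_simp
      _ ≤ _ := mul_le_mul_of_nonneg_right (pow_le_pow_right₀ ht1 hmE) (by positivity)

/-- `N` bounds at time `q` add up to at most the bound at time `n ≥ N q`. -/
theorem mul_devBound_le {m : ℕ} {s a : ℝ} (ha : 1 ≤ a) {N q n : ℕ} (hN : N * q ≤ n) {y : ℝ}
    (hy : 0 < y) : N * devBound F₀ P Y H m s a q y ≤ devBound F₀ P Y H m s a n y := by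
  have hNq : (N : ℝ) * q ≤ n := by exact_mod_cast hN
  rw [devBound, devBound, mul_add]
  refine add_le_add ?_ ?_
  · have hNa : (N : ℝ) ≤ (N : ℝ) ^ a := by
      rcases Nat.eq_zero_or_pos N with rfl | hN0
      · simp [Real.zero_rpow (by linarith : a ≠ 0)]
      · exact Real.self_le_rpow_of_one_le (by exact_mod_cast hN0) ha
    calc (N : ℝ) * (q / y ^ s) ^ a ≤ (N : ℝ) ^ a * (q / y ^ s) ^ a :=
          mul_le_mul_of_nonneg_right hNa (by positivity)
      _ = (N * q / y ^ s) ^ a := by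
          rw [← Real.mul_rpow (by positivity) (by positivity), mul_div_assoc]
      _ ≤ _ := by
          refine Real.rpow_le_rpow (by positivity) ?_ (by linarith)
          exact div_le_div_of_nonneg_right hNq (by positivity)
  · rw [← mul_assoc, ← mul_div_assoc]
    refine mul_le_mul_of_nonneg_right ?_ ENNReal.toReal_nonneg
    exact div_le_div_of_nonneg_right hNq hy.le

/-- Choice of the number of iterations. -/
theorem exists_pow_four_le {r a : ℝ} {E : ℕ} (hr : 0 < r) (hr1 : r ≤ 1) (ha : a ≤ E) :
    ∃ J : ℕ, (4 : ℝ) ^ J ≤ 4 / r ∧ (1 / 4 ^ E : ℝ) ^ J ≤ r ^ a := by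
  have h4 : 1 ≤ 4 / r := by rw [le_div_iff₀ hr]; linarith
  obtain ⟨J, h1, h2⟩ := exists_nat_pow_near h4 (by norm_num : (1 : ℝ) < 4)
  refine ⟨J, h1, ?_⟩
  have h3 : (1 / 4 ^ J : ℝ) ≤ r := by
    rw [pow_succ, div_lt_iff₀ hr] at h2
    rw [div_le_iff₀ (by positivity)]
    nlinarith
  calc (1 / 4 ^ E : ℝ) ^ J = (1 / 4 ^ J) ^ E := by
        rw [← one_div_pow, ← one_div_pow, ← pow_mul, ← pow_mul, mul_comm]
    _ ≤ r ^ E := pow_le_pow_left₀ (by positivity) h3 E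
    _ = r ^ (E : ℝ) := (Real.rpow_natCast r E).symm
    _ ≤ r ^ a := Real.rpow_le_rpow_of_exponent_ge hr hr1 ha

variable (F₀ P Y) in
/-- The truncation level `M` and the block length `q` adapted to a deviation level `y`. -/
theorem exists_truncation (hH : IsTailFunction H)
    (hQ : ∫⁻ u in Icc (0 : ℝ) 1, quantile H u ≠ ⊤) (m : ℕ) {y : ℝ} (hy : 0 < y) :
    ∃ (M : ℝ≥0) (w : ℝ), 0 ≤ w ∧ w ≤ 2 * (2 ^ 17) ^ m * (tailInt F₀ P Y H m y).toReal ∧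
      ∫⁻ t in Ioi (M : ℝ), tail H t ≤ ENNReal.ofReal w ∧
      (M = 0 ∨ ∃ (v : ℝ) (q : ℕ), 0 ≤ v ∧ M * v ≤ w ∧ q ≠ 0 ∧
        alpha F₀ P Y 2 q ≤ ENNReal.ofReal v ∧ q * (M : ℝ) ≤ y / 2 ^ 17 ∧
        (∀ u, 0 ≤ u → u < v → ENNReal.ofReal (y / 2 ^ 17) < R F₀ P Y H u) ∧
        ∀ u, v ≤ u → R F₀ P Y H u ≤ ENNReal.ofReal (y / 2 ^ 17)) := by
  set z := ENNReal.ofReal (y / 2 ^ 17) with hz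
  obtain ⟨v, hv0, hv12, hlt, hle⟩ := exists_crossing F₀ P Y hH z
  set I := ∫⁻ u in Icc (0 : ℝ) 1, (Iio v).indicator (quantile H) u with hI
  have hIQ : I ≤ ∫⁻ u in Icc (0 : ℝ) 1, quantile H u :=
    lintegral_mono fun u => indicator_le_self' (fun _ _ => bot_le) u
  have hIfin : I ≠ ⊤ := ne_top_of_le_ne_top hQ hIQ
  have hτfin : tailInt F₀ P Y H m y ≠ ⊤ := ne_top_of_le_ne_top hQ (tailInt_le m y)
  have hIτ : I.toReal ≤ (2 ^ 17) ^ m * (tailInt F₀ P Y H m y).toReal := by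
    have h1 := lintegral_quantile_le_tailInt (F₀ := F₀) (P := P) (Y := Y) (H := H) m hy
      (K := 2 ^ 17) (by norm_num) hlt
    have h2 := ENNReal.toReal_mono (ENNReal.mul_ne_top (by simp) hτfin) h1
    rwa [ENNReal.toReal_mul, ENNReal.toReal_pow, ENNReal.toReal_ofReal (by norm_num)] at h2
  -- If the crossing point is less than `1 / 2`, it gives the truncation level and the block length;
  -- either `α⁻¹(v)` is finite, or `R(v) ≤ z < ∞` forces `Q(v) = 0`.
  rcases lt_or_ge v (1 / 2) with hv | hv
  · have hR := hle hv
    have hα1 := one_le_alphaInv (F₀ := F₀) (P := P) (Y := Y) hv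
    have hQv : quantile H v ≠ ⊤ := by
      refine ne_top_of_le_ne_top ENNReal.ofReal_ne_top (le_trans ?_ hR)
      exact le_mul_of_one_le_left bot_le hα1
    have hMQ : ((quantile H v).toNNReal : ℝ≥0∞) = quantile H v := ENNReal.coe_toNNReal hQv
    refine ⟨(quantile H v).toNNReal, I.toReal, ENNReal.toReal_nonneg, ?_, ?_, ?_⟩
    · have h0 : 0 ≤ (2 ^ 17) ^ m * (tailInt F₀ P Y H m y).toReal := by positivity
      linarith
    · rw [ENNReal.ofReal_toReal hIfin]
      refine lintegral_tail_le hH fun u hu _ => ?_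
      rw [hMQ]; exact quantile_antitone H hu
    · rcases alphaInv_eq F₀ P Y v with h1 | ⟨q, h1, h2⟩
      · left
        by_contra hM
        have hQ0 : quantile H v ≠ 0 := fun h0 => hM (by rw [h0]; rfl)
        rw [R, h1, ENNReal.top_mul hQ0] at hR
        exact absurd hR (not_le.2 ENNReal.ofReal_lt_top)
      · right
        refine ⟨v, q, hv0, ?_, ?_, h2, ?_, hlt, fun u hu => (R_antitone hu).trans hR⟩
        · have h3 := mul_le_lintegral_quantile (H := H) (v := v)
            (M := (quantile H v).toNNReal) (by linarith) fun u _ hu => by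
              rw [hMQ]; exact quantile_antitone H hu.le
          have h4 := ENNReal.toReal_mono hIfin h3
          rwa [ENNReal.toReal_mul, ENNReal.toReal_ofReal hv0, ENNReal.coe_toReal] at h4
        · have := one_le_of_alpha_le hv h2
          omega
        · rw [R, h1, ← hMQ] at hR
          have h4 := ENNReal.toReal_mono ENNReal.ofReal_ne_top hR
          rwa [ENNReal.toReal_mul, ENNReal.toReal_ofReal (by positivity), ENNReal.coe_toReal,
            ENNReal.toReal_natCast] at h4
  -- Otherwise `∫_0^{1/2} Q`, which is at least half of the whole integral, is controlled by the tail
  -- integral, and everything may be truncated away.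
  · obtain rfl : v = 1 / 2 := le_antisymm hv12 hv
    have hc : quantile H (1 / 2) ≠ ⊤ := (quantile_lt_top hH (by norm_num)).ne
    have hMQ : ((quantile H (1 / 2)).toNNReal : ℝ≥0∞) = quantile H (1 / 2) :=
      ENNReal.coe_toNNReal hc
    have h2I : ∫⁻ u in Icc (0 : ℝ) 1, quantile H u ≤ I + I := by
      calc ∫⁻ u in Icc (0 : ℝ) 1, quantile H u
          ≤ ∫⁻ u in Icc (0 : ℝ) 1, ((Iio (1 / 2)).indicator (quantile H) u +
              (Ici (1 / 2)).indicator (fun _ => quantile H (1 / 2)) u) := by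
            refine lintegral_mono fun u => ?_
            show quantile H u ≤ (Iio (1 / 2)).indicator (quantile H) u +
              (Ici (1 / 2)).indicator (fun _ => quantile H (1 / 2)) u
            rcases lt_or_ge u (1 / 2) with hu | hu
            · rw [indicator_of_mem (mem_Iio.2 hu)]; exact le_self_add
            · rw [indicator_of_mem (mem_Ici.2 hu)]
              exact (quantile_antitone H hu).trans le_add_self
        _ = I + ∫⁻ u in Icc (0 : ℝ) 1,
              (Ici (1 / 2)).indicator (fun _ => quantile H (1 / 2)) u :=
            lintegral_add_left ((measurable_quantile H).indicator measurableSet_Iio) _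
        _ = I + quantile H (1 / 2) * ENNReal.ofReal (1 / 2) := by
            have e : Ici (1 / 2 : ℝ) ∩ Icc 0 1 = Icc (1 / 2) 1 := by
              ext u
              simp only [mem_inter_iff, mem_Ici, mem_Icc]
              exact ⟨fun h => ⟨h.1, h.2.2⟩, fun h => ⟨h.1, by linarith [h.1], h.2⟩⟩
            rw [lintegral_indicator measurableSet_Ici, Measure.restrict_restrict measurableSet_Ici,
              e]
            simp only [lintegral_const, Measure.restrict_apply MeasurableSet.univ, univ_inter,
              Real.volume_Icc]
            norm_num
        _ ≤ I + I := by
            refine add_le_add le_rfl ?_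
            rw [← hMQ]
            exact mul_le_lintegral_quantile (H := H) (by norm_num) fun u _ hu => by
              rw [hMQ]; exact quantile_antitone H hu.le
    refine ⟨0, 2 * I.toReal, by positivity, by linarith, ?_, Or.inl rfl⟩
    refine (lintegral_tail_le hH (v := 2) (fun u hu hu' => by linarith)).trans ?_
    refine le_trans (lintegral_mono fun u => indicator_le_self' (fun _ _ => bot_le) u)
      (h2I.trans (le_of_eq ?_))
    rw [two_mul, ENNReal.ofReal_add ENNReal.toReal_nonneg ENNReal.toReal_nonneg,
      ENNReal.ofReal_toReal hIfin]

end Bound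

section Step
variable {Ω : Type*} {F₀ : MeasurableSpace Ω} [mΩ : MeasurableSpace Ω] {P : Measure Ω}
  [IsProbabilityMeasure P] {T : Ω ≃ᵐ Ω} {Y₀ : Ω → ℝ} {H : ℝ≥0 → ℝ}
  {L : ℕ} {b : Fin L → ℝ} {h : Fin L → ℝ → ℝ} {M : ℝ≥0}

/-- Truncated sums are deterministically bounded. -/
theorem maxEvent_eq_empty (S : Standing F₀ P T Y₀ H) (hC : IsComb H (P.map Y₀) b h)
    (hM : ∀ l y, h l y ≤ M) {n : ℕ} {y : ℝ} (hn : 4 * (n * (M : ℝ)) < y) :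
    maxEvent (obs P (shifted T Y₀) (comb b h)) n y = ∅ := by
  refine eq_empty_of_forall_notMem fun ω hω => ?_
  obtain ⟨k, hk, hky⟩ := hω
  rw [partialSum_eq_blockSum] at hky
  have h1 := abs_blockSum_le S hC hM 0 k ω
  have h2 : (k : ℝ) ≤ n := by exact_mod_cast (Finset.mem_Icc.1 hk).2
  have h3 : (k : ℝ) * M ≤ n * M := mul_le_mul_of_nonneg_right h2 M.2
  linarith

/-- The variance of a truncated block, in terms of the crossing level `z` of `R`. -/
theorem integral_blockSum_sq_le_rpow (S : Standing F₀ P T Y₀ H) (hC : IsComb H (P.map Y₀) b h)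
    (hM : ∀ l y, h l y ≤ M) {s : ℝ} (hs1 : 1 ≤ s) (hs2 : s ≤ 2) {D : ℝ} (hD0 : 0 ≤ D)
    (hD : ∫⁻ u in Icc (0 : ℝ) 1, quantile H u * R F₀ P (shifted T Y₀) H u ^ (s - 1) ≤
      ENNReal.ofReal D) {q : ℕ} {z v : ℝ} (hz : 0 ≤ z) (hqM : q * (M : ℝ) ≤ z)
    (hlt : ∀ u, 0 ≤ u → u < v → ENNReal.ofReal z < R F₀ P (shifted T Y₀) H u)
    (hle : ∀ u, v ≤ u → R F₀ P (shifted T Y₀) H u ≤ ENNReal.ofReal z) :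
    ∫ ω, blockSum (obs P (shifted T Y₀) (comb b h)) 0 q ω ^ 2 ∂P ≤ 16 * q * (z ^ (2 - s) * D) := by
  have h1 := integral_blockSum_sq_le S hC hM 0 q
  have hqM' : (q : ℝ≥0∞) * M ≤ ENNReal.ofReal z := by
    refine le_trans (le_of_eq ?_) (ENNReal.ofReal_le_ofReal hqM)
    rw [ENNReal.ofReal_mul (by positivity)]; simp
  have h2 := lintegral_min_sq_le (F₀ := F₀) (P := P) (Y := shifted T Y₀) hs1 hs2 hqM' hlt hle
  have h3 := h1.trans (mul_le_mul' le_rfl (h2.trans (mul_le_mul' le_rfl hD)))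
  rw [ENNReal.ofReal_rpow_of_nonneg hz (by linarith), ← ENNReal.ofReal_mul (by positivity),
    show (16 : ℝ≥0∞) * q = ENNReal.ofReal (16 * q) by
      rw [ENNReal.ofReal_mul (by norm_num)]; simp,
    ← ENNReal.ofReal_mul (by positivity)] at h3
  exact (ENNReal.ofReal_le_ofReal_iff (by positivity)).1 h3

/-- The induction step for a truncated combination: the bound at time `n` from the one for a block
of length `q < n`. -/
theorem measureReal_maxEvent_truncated_le (S : Standing F₀ P T Y₀ H)
    (hQ : ∫⁻ u in Icc (0 : ℝ) 1, quantile H u ≠ ⊤)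
    (hC : IsComb H (P.map Y₀) b h)
    (hM : ∀ l y, h l y ≤ M) {m E : ℕ} {s a D : ℝ} (hs1 : 1 ≤ s) (hs2 : s ≤ 2) (ha : 1 ≤ a)
    (hE : 2 ≤ E) (haE : a ≤ E) (hsE : s * a ≤ E) (hmE : m + 1 ≤ E) (hD0 : 0 < D)
    (hD : ∫⁻ u in Icc (0 : ℝ) 1, quantile H u * R F₀ P (shifted T Y₀) H u ^ (s - 1) ≤
      ENNReal.ofReal D) {n q : ℕ} {v w y A : ℝ} (hv : 0 ≤ v) (hw : M * v ≤ w) (hq : q ≠ 0)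
    (hqn : q < n) (hα : alpha F₀ P (shifted T Y₀) 2 q ≤ ENNReal.ofReal v) (hy : 0 < y) (hA : 0 ≤ A)
    (hqM : q * (M : ℝ) ≤ y / 2 ^ 17)
    (hlt : ∀ u, 0 ≤ u → u < v → ENNReal.ofReal (y / 2 ^ 17) < R F₀ P (shifted T Y₀) H u)
    (hle : ∀ u, v ≤ u → R F₀ P (shifted T Y₀) H u ≤ ENNReal.ofReal (y / 2 ^ 17))
    (hind : ∀ y > 0, P.real (maxEvent (obs P (shifted T Y₀) (comb b h)) q y) ≤
      A * devBound F₀ P (shifted T Y₀) H m s a q y)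
    (hr1 : 16384 * 4 ^ (E + 1) * D * (n / y ^ s) ≤ 1) :
    P.real (maxEvent (obs P (shifted T Y₀) (comb b h)) n (y / 2)) ≤
      2 * (A * devBound F₀ P (shifted T Y₀) H m s a n y / 4 + 8194 * (n / y * w) +
        (16384 * 4 ^ (E + 1) * D * (n / y ^ s)) ^ a) := by
  have hn0 : (0 : ℝ) < n := by
    have : 0 < n := by omega
    exact_mod_cast this
  set r := 16384 * 4 ^ (E + 1) * D * (n / y ^ s) with hr
  have hr0 : 0 < r := by positivity
  obtain ⟨J, hJ1, hJ2⟩ := exists_pow_four_le hr0 hr1 haE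
  set N := n / q with hNdef
  have hN : N * q ≤ n := Nat.div_mul_le_self n q
  have hNq : (N : ℝ) * q ≤ n := by exact_mod_cast hN
  have hσ := integral_blockSum_sq_le_rpow S hC hM hs1 hs2 hD0.le hD
    (by positivity : 0 ≤ y / 2 ^ 17) hqM hlt hle
  set σ := ∫ ω, blockSum (obs P (shifted T Y₀) (comb b h)) 0 q ω ^ 2 ∂P with hσdef
  have hz : (y / 2 ^ 17) ^ (2 - s) ≤ y ^ (2 - s) :=
    Real.rpow_le_rpow (by positivity) (div_le_self hy.le (by norm_num)) (by linarith)
  have hNσ : N * σ ≤ 16 * n * (y ^ (2 - s) * D) := by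
    calc N * σ ≤ N * (16 * q * (y ^ (2 - s) * D)) := by
          refine mul_le_mul_of_nonneg_left (hσ.trans ?_) (by positivity)
          gcongr
      _ = 16 * (N * q) * (y ^ (2 - s) * D) := by ring
      _ ≤ _ := by gcongr
  have hJ : 4 ^ (J + 1) * 4 ^ E * (N * σ) ≤ (y / 16) ^ 2 := by
    have hys : y ^ (2 - s) * y ^ s = y ^ 2 := by
      rw [← Real.rpow_add hy]; norm_num
    have hys0 : 0 < y ^ s := by positivity
    calc (4 : ℝ) ^ (J + 1) * 4 ^ E * (N * σ)
        ≤ 4 ^ (J + 1) * 4 ^ E * (16 * n * (y ^ (2 - s) * D)) :=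
          mul_le_mul_of_nonneg_left hNσ (by positivity)
      _ = 4 ^ J * (4 ^ (E + 1) * (16 * n * (y ^ (2 - s) * D))) := by ring
      _ ≤ 4 / r * (4 ^ (E + 1) * (16 * n * (y ^ (2 - s) * D))) :=
          mul_le_mul_of_nonneg_right hJ1 (by positivity)
      _ = y ^ (2 - s) * y ^ s / 256 := by
          rw [hr]; field_simp; norm_num
      _ = (y / 16) ^ 2 := by rw [hys]; ring
  have hindN : ∀ j ≥ 9, N * P.real {ω | y / 2 ^ (j + 6) <
      |blockSum (obs P (shifted T Y₀) (comb b h)) 0 q ω|} ≤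
      (2 ^ (j + 6)) ^ E * (A * devBound F₀ P (shifted T Y₀) H m s a n y) := by
    intro j _
    have hyj : 0 < y / 2 ^ (j + 6) := by positivity
    have h1 : P.real {ω | y / 2 ^ (j + 6) < |blockSum (obs P (shifted T Y₀) (comb b h)) 0 q ω|} ≤
        A * devBound F₀ P (shifted T Y₀) H m s a q (y / 2 ^ (j + 6)) := by
      refine le_trans (measureReal_mono ?_) (hind _ hyj)
      intro ω hω
      refine ⟨q, Finset.mem_Icc.2 ⟨by omega, le_rfl⟩, ?_⟩
      rw [partialSum_eq_blockSum]
      exact le_of_lt hω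
    calc _ ≤ N * (A * devBound F₀ P (shifted T Y₀) H m s a q (y / 2 ^ (j + 6))) :=
          mul_le_mul_of_nonneg_left h1 (by positivity)
      _ = A * (N * devBound F₀ P (shifted T Y₀) H m s a q (y / 2 ^ (j + 6))) := by ring
      _ ≤ A * ((2 ^ (j + 6)) ^ E * devBound F₀ P (shifted T Y₀) H m s a n y) :=
          mul_le_mul_of_nonneg_left ((mul_devBound_le ha hN hyj).trans
            (devBound_div_le hQ hsE hmE n _ hy)) hA
      _ = _ := by ring
  have hB : 0 ≤ A * devBound F₀ P (shifted T Y₀) H m s a n y :=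
    mul_nonneg hA (devBound_nonneg _ _ _ _ hy)
  have hpar := fun o : ℤ => alternate_blocks_le S hC hM hq hv hα o hN hy hE hJ hqM hw hB hindN
  have hcov := maxEvent_subset_blocks (X := obs P (shifted T Y₀) (comb b h)) hq hqn.le hy
    fun o r hr ω => by
      refine (abs_blockSum_le S hC hM o r ω).trans ?_
      have h1 : (r : ℝ) * M ≤ q * M :=
        mul_le_mul_of_nonneg_right (by exact_mod_cast hr.le) M.2
      have h2 : y / 2 ^ 17 ≤ y / 16 := div_le_div_of_nonneg_left hy.le (by norm_num) (by norm_num)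
      linarith
  calc _ ≤ _ := measureReal_mono hcov
    _ ≤ _ := measureReal_union_le _ _
    _ ≤ _ := add_le_add (hpar 0) (hpar q)
    _ ≤ _ := by linarith

/-- A Fuk–Nagaev type inequality for finite combinations of layered functions, with a constant that
depends neither on the combination nor on `n` and `y`. -/
theorem exists_measureReal_maxEvent_comb_le (S : Standing F₀ P T Y₀ H)
    (hQ : ∫⁻ u in Icc (0 : ℝ) 1, quantile H u ≠ ⊤) (m : ℕ) {s a : ℝ} (hs1 : 1 ≤ s) (hs2 : s ≤ 2)
    (ha : 1 ≤ a)
    (hD : ∫⁻ u in Icc (0 : ℝ) 1, quantile H u * R F₀ P (shifted T Y₀) H u ^ (s - 1) ≠ ⊤) :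
    ∃ A : ℝ, 0 < A ∧ ∀ (n : ℕ) (L : ℕ) (b : Fin L → ℝ) (h : Fin L → ℝ → ℝ),
      IsComb H (P.map Y₀) b h → ∀ y > 0,
        P.real (maxEvent (obs P (shifted T Y₀) (comb b h)) n y) ≤
          A * devBound F₀ P (shifted T Y₀) H m s a n y := by
  obtain ⟨E, hE⟩ := exists_nat_ge (max (max 2 (2 * a)) (m + 1 : ℝ))
  have hE2 : 2 ≤ E := by
    have : (2 : ℝ) ≤ E := ((le_max_left _ _).trans (le_max_left _ _)).trans hE
    exact_mod_cast this
  have h2a : 2 * a ≤ E := ((le_max_right _ _).trans (le_max_left _ _)).trans hE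
  have hmE : m + 1 ≤ E := by
    have : (m + 1 : ℝ) ≤ E := (le_max_right _ _).trans hE
    exact_mod_cast this
  have hsE : s * a ≤ E := by nlinarith
  set D := (∫⁻ u in Icc (0 : ℝ) 1, quantile H u * R F₀ P (shifted T Y₀) H u ^ (s - 1)).toReal + 1
    with hDdef
  have hD0 : 0 < D := by positivity
  have hD' : ∫⁻ u in Icc (0 : ℝ) 1, quantile H u * R F₀ P (shifted T Y₀) H u ^ (s - 1) ≤
      ENNReal.ofReal D := by
    rw [← ENNReal.ofReal_toReal hD]
    exact ENNReal.ofReal_le_ofReal (by linarith)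
  set C := (16384 * 4 ^ (E + 1) * D) ^ a with hC
  have hC0 : 0 < C := by positivity
  set A := 65584 * (2 ^ 17) ^ m + 4 * C with hAdef
  have hA0 : 0 < A := by positivity
  refine ⟨A, hA0, fun n => ?_⟩
  induction n using Nat.strong_induction_on with
  | _ n ih =>
  intro L b h hcomb y hy
  have hBn := devBound_nonneg (F₀ := F₀) (P := P) (Y := shifted T Y₀) (H := H) m s a n hy
  have hgauss : 0 ≤ ((n : ℝ) / y ^ s) ^ a := by positivity
  have hheavy : 0 ≤ n / y * (tailInt F₀ P (shifted T Y₀) H m y).toReal := by positivity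
  have hg1 : (16384 * 4 ^ (E + 1) * D * (n / y ^ s)) ^ a ≤
      C * devBound F₀ P (shifted T Y₀) H m s a n y := by
    rw [Real.mul_rpow (by positivity) (by positivity), devBound]
    exact mul_le_mul_of_nonneg_left (by linarith) hC0.le
  -- The constant `A` is such that the bound is trivial when the Gaussian-scale term is large.
  by_cases hr1 : 16384 * 4 ^ (E + 1) * D * (n / y ^ s) ≤ 1
  swap
  · calc P.real _ ≤ 1 := measureReal_le_one
      _ ≤ (16384 * 4 ^ (E + 1) * D * (n / y ^ s)) ^ a :=
          Real.one_le_rpow (not_le.1 hr1).le (by linarith)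
      _ ≤ C * devBound F₀ P (shifted T Y₀) H m s a n y := hg1
      _ ≤ A * devBound F₀ P (shifted T Y₀) H m s a n y := by
          refine mul_le_mul_of_nonneg_right ?_ hBn
          have : (0 : ℝ) ≤ 65584 * (2 ^ 17) ^ m := by positivity
          linarith
  obtain ⟨M, w, hw0, hwτ, hwt, hMq⟩ := exists_truncation F₀ P (shifted T Y₀) S.tail hQ m hy
  have hcombM := hcomb.truncate M
  have hM : ∀ l y, (fun l y => min (h l y) (M : ℝ)) l y ≤ M := fun l y => min_le_right _ _
  have hcmp := measureReal_maxEvent_le_add (n := n) hy (integrable_comb S hQ hcomb)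
    (integrable_comb S hQ hcombM) (integral_abs_comb_sub_truncate_le S hcomb M hw0 hwt)
  have hnw : n / y * w ≤ 2 * (2 ^ 17) ^ m * devBound F₀ P (shifted T Y₀) H m s a n y := by
    calc n / y * w ≤ n / y * (2 * (2 ^ 17) ^ m * (tailInt F₀ P (shifted T Y₀) H m y).toReal) :=
          mul_le_mul_of_nonneg_left hwτ (by positivity)
      _ = 2 * (2 ^ 17) ^ m * (n / y * (tailInt F₀ P (shifted T Y₀) H m y).toReal) := by ring
      _ ≤ _ := by
          refine mul_le_mul_of_nonneg_left ?_ (by positivity)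
          rw [devBound]; linarith
  have htr : P.real (maxEvent (obs P (shifted T Y₀) (comb b fun l y => min (h l y) M)) n (y / 2)) ≤
      2 * (A * devBound F₀ P (shifted T Y₀) H m s a n y / 4 + 8194 * (n / y * w) +
        C * devBound F₀ P (shifted T Y₀) H m s a n y) := by
    have hnn : 0 ≤ 2 * (A * devBound F₀ P (shifted T Y₀) H m s a n y / 4 + 8194 * (n / y * w) +
        C * devBound F₀ P (shifted T Y₀) H m s a n y) := by positivity
    rcases hMq with hM0 | ⟨v, q, hv, hMv, hq, hα, hqM, hlt, hle⟩
    · rw [maxEvent_eq_empty S hcombM hM (by rw [hM0]; simpa using hy)]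
      simpa using hnn
    -- If `n ≤ q` the truncated sums are too small to reach the level; otherwise the induction
    -- hypothesis applies to the blocks.
    rcases le_or_gt n q with hnq | hnq
    · rw [maxEvent_eq_empty S hcombM hM]
      · simpa using hnn
      · have h1 : (n : ℝ) * M ≤ q * M :=
          mul_le_mul_of_nonneg_right (by exact_mod_cast hnq) M.2
        have h2 : y / 2 ^ 17 ≤ y / 16 := div_le_div_of_nonneg_left hy.le (by norm_num) (by norm_num)
        linarith
    · refine (measureReal_maxEvent_truncated_le S hQ hcombM hM hs1 hs2 ha hE2 (by linarith) hsE hmE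
        hD0 hD' hv hMv hq hnq hα hy hA0.le hqM hlt hle
        (fun y' hy' => ih q hnq _ _ _ hcombM y' hy') hr1).trans ?_
      linarith
  set B := devBound F₀ P (shifted T Y₀) H m s a n y
  have e : A * B = 65584 * ((2 ^ 17) ^ m * B) + 4 * (C * B) := by rw [hAdef]; ring
  rw [mul_assoc] at hnw
  generalize ((2 : ℝ) ^ 17) ^ m * B = K at e hnw
  linarith

end Step

/-! ### Passage to the closure of the monotone functions -/

section Monotone
variable {H : ℝ≥0 → ℝ} {μ : Measure ℝ}

theorem MemMon.neg {g : ℝ → ℝ} (hg : MemMon H μ g) : MemMon H μ fun y => -g y := by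
  obtain ⟨⟨I, hIo, hI, hmono, h0⟩, ht⟩ := hg
  refine ⟨⟨I, hIo, hI, hmono.symm.imp (fun h => h.neg) (fun h => h.neg), fun y hy => ?_⟩, ?_⟩
  · show -g y = 0
    rw [h0 y hy, neg_zero]
  · simpa only [abs_neg] using ht

/-- The superlevel sets of the positive part at positive levels are intervals. -/
theorem MemMon.isLayered_max {g : ℝ → ℝ} (hg : MemMon H μ g) :
    IsLayered H μ fun y => max (g y) 0 := by
  obtain ⟨⟨I, hIo, hI, hmono, h0⟩, htail⟩ := hg
  have hset : ∀ t : ℝ, 0 ≤ t → ∀ y, t < max (g y) 0 ↔ y ∈ I ∧ t < g y := by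
    intro t ht y
    rw [lt_max_iff]
    constructor
    · rintro (h | h)
      · refine ⟨?_, h⟩
        by_contra hy
        rw [h0 y hy] at h
        linarith
      · linarith
    · exact fun h => Or.inl h.2
  refine ⟨fun y => le_max_right _ _, fun t ht => ⟨fun x hx y hy z hz => ?_⟩, fun t ht => ?_⟩
  · have hx' := (hset t ht x).1 hx
    have hy' := (hset t ht y).1 hy
    have hzI := hI.out hx'.1 hy'.1 hz
    refine (hset t ht z).2 ⟨hzI, ?_⟩
    rcases hmono with h | h
    · exact hx'.2.trans_le (h hx'.1 hzI hz.1)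
    · exact hy'.2.trans_le (h hzI hy'.1 hz.2)
  · refine le_trans (measure_mono fun y hy => ?_) (htail t.toNNReal)
    show (t.toNNReal : ℝ) < |g y|
    rw [Real.coe_toNNReal t ht]
    exact ((hset t ht y).1 hy).2.trans_le (le_abs_self _)

/-- Splitting into positive and negative parts doubles the total coefficient. -/
theorem exists_isComb {L : ℕ} {a : Fin L → ℝ} {g : Fin L → ℝ → ℝ} (ha : ∑ l, |a l| ≤ 1)
    (hg : ∀ l, MemMon H μ (g l)) :
    ∃ (b : Fin (L + L) → ℝ) (h : Fin (L + L) → ℝ → ℝ), IsComb H μ b h ∧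
      comb b h = fun y => ∑ l, a l * g l y := by
  refine ⟨Fin.append a fun l => -a l,
    Fin.append (fun l y => max (g l y) 0) fun l y => max (-g l y) 0, ⟨?_, fun l => ?_⟩, ?_⟩
  · have h1 : ∑ l, ‖a l‖ₑ ≤ 1 := by
      simp_rw [Real.enorm_eq_ofReal_abs]
      rw [← ENNReal.ofReal_sum_of_nonneg fun l _ => abs_nonneg _]
      exact ENNReal.ofReal_le_one.2 ha
    rw [Fin.sum_univ_add]
    simp only [Fin.append_left, Fin.append_right, enorm_neg]
    exact (add_le_add h1 h1).trans (by norm_num)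
  · refine Fin.addCases (fun l => ?_) (fun l => ?_) l
    · rw [Fin.append_left]; exact (hg l).isLayered_max
    · rw [Fin.append_right]; exact (hg l).neg.isLayered_max
  · funext y
    rw [comb, Fin.sum_univ_add]
    simp only [Fin.append_left, Fin.append_right]
    rw [← Finset.sum_add_distrib]
    refine Finset.sum_congr rfl fun l _ => ?_
    rcases le_total (g l y) 0 with h | h
    · rw [max_eq_right h, max_eq_left (by linarith)]; ring
    · rw [max_eq_left h, max_eq_right (by linarith)]; ring

end Monotone

section Closure
variable {Ω : Type*} {F₀ : MeasurableSpace Ω} [mΩ : MeasurableSpace Ω] {P : Measure Ω}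
  [IsProbabilityMeasure P] {T : Ω ≃ᵐ Ω} {Y₀ : Ω → ℝ} {H : ℝ≥0 → ℝ} {f : ℝ → ℝ}

omit [IsProbabilityMeasure P] in
theorem Standing.measurePreserving_shifted (S : Standing F₀ P T Y₀ H) (i : ℤ) :
    MeasurePreserving (shifted T Y₀ i) P (P.map Y₀) :=
  ((S.meas.mono S.le le_rfl).measurePreserving P).comp (measurePreserving_flow S.preserving i)

/-- The Fuk–Nagaev type inequality passes to the `L¹` closure, since its constant is uniform over
the combinations. -/
theorem exists_measureReal_maxEvent_le (S : Standing F₀ P T Y₀ H)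
    (hQ : ∫⁻ u in Icc (0 : ℝ) 1, quantile H u ≠ ⊤) (hf : MemF H (P.map Y₀) f) (m : ℕ) {s a : ℝ}
    (hs1 : 1 ≤ s) (hs2 : s ≤ 2) (ha : 1 ≤ a)
    (hD : ∫⁻ u in Icc (0 : ℝ) 1, quantile H u * R F₀ P (shifted T Y₀) H u ^ (s - 1) ≠ ⊤) :
    ∃ A : ℝ, 0 < A ∧ ∀ (n : ℕ), ∀ y > 0,
      P.real (maxEvent (obs P (shifted T Y₀) f) n y) ≤
        A * devBound F₀ P (shifted T Y₀) H m s a n y := by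
  obtain ⟨A, hA0, hA⟩ := exists_measureReal_maxEvent_comb_le S hQ m hs1 hs2 ha hD
  obtain ⟨E, hE⟩ := exists_nat_ge (max (s * a) (m + 1 : ℝ))
  have hsE : s * a ≤ E := (le_max_left _ _).trans hE
  have hmE : m + 1 ≤ E := by
    have : (m + 1 : ℝ) ≤ E := (le_max_right _ _).trans hE
    exact_mod_cast this
  refine ⟨A * 2 ^ E, by positivity, fun n y hy => le_of_forall_pos_le_add fun δ hδ => ?_⟩
  set ε := δ / (4 * (n / y + 1)) with hε
  have hε0 : 0 < ε := by positivity
  obtain ⟨L, c, g, hc, hg, happ⟩ := hf.2 (ENNReal.ofReal ε) (ENNReal.ofReal_pos.2 hε0)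
  obtain ⟨b, h, hcomb, hbh⟩ := exists_isComb hc hg
  have hfi : ∀ i, Integrable (fun ω => f (shifted T Y₀ i ω)) P := fun i =>
    (S.measurePreserving_shifted i).integrable_comp_of_integrable hf.1
  have hci := integrable_comb S hQ hcomb
  have hle : ∀ i, ∫ ω, |f (shifted T Y₀ i ω) - comb b h (shifted T Y₀ i ω)| ∂P ≤ ε := by
    intro i
    have hm : AEStronglyMeasurable (fun y => f y - comb b h y) (P.map Y₀) :=
      hf.1.aestronglyMeasurable.sub
        (measurable_comb fun l => (hcomb.layered l).measurable).aestronglyMeasurable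
    have h1 := eLpNorm_comp_measurePreserving (p := 1) hm (S.measurePreserving_shifted i)
    rw [hbh] at h1
    have h2 := h1.trans_lt happ
    rw [← hbh, eLpNorm_one_eq_lintegral_enorm] at h2
    have h3 := integral_norm_eq_lintegral_enorm ((hfi i).sub (hci i)).aestronglyMeasurable
    refine le_trans (le_of_eq h3) ?_
    exact ENNReal.toReal_le_of_le_ofReal hε0.le h2.le
  have hcmp := measureReal_maxEvent_le_add (n := n) hy hfi hci hle
  have hdev := hA n _ b h hcomb (y / 2) (by positivity)
  have hdiv := devBound_div_le (F₀ := F₀) (P := P) (Y := shifted T Y₀) (H := H) hQ hsE hmE n 1 hy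
  rw [pow_one] at hdiv
  have herr : 4 * (n / y * ε) ≤ δ := by
    have : n / y * ε ≤ (n / y + 1) * ε := mul_le_mul_of_nonneg_right (by linarith) hε0.le
    have h4 : 4 * ((n / y + 1) * ε) = δ := by
      have : (0 : ℝ) < n / y + 1 := by positivity
      rw [hε]; field_simp
    linarith
  have hfin := mul_le_mul_of_nonneg_left hdiv hA0.le
  rw [← mul_assoc] at hfin
  linarith

omit mΩ in
theorem deviation_eq_maxEvent {X : ℤ → Ω → ℝ} {n : ℕ} (hn : 1 ≤ n) {x : ℝ} (hx : 0 < x) :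
    deviation X n x = maxEvent X n (n * x) := by
  have hn0 : (0 : ℝ) < n := by exact_mod_cast hn
  ext ω
  show x ≤ 1 / (n : ℝ) * maxPartialSum X n ω ↔ ∃ k ∈ Finset.Icc 1 n, n * x ≤ |partialSum X k ω|
  have hnx : (0 : ℝ) < n * x := by positivity
  have h1 : x ≤ 1 / (n : ℝ) * maxPartialSum X n ω ↔ n * x ≤ maxPartialSum X n ω := by
    rw [one_div_mul_eq_div, le_div_iff₀ hn0, mul_comm]
  have h2 : n * x ≤ maxPartialSum X n ω ↔
      (n * x).toNNReal ≤ (Finset.Icc 1 n).sup fun k => ‖partialSum X k ω‖₊ := by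
    rw [maxPartialSum, Real.toNNReal_le_iff_le_coe]
  rw [h1, h2, Finset.le_sup_iff (Real.toNNReal_pos.2 hnx)]
  simp only [Real.toNNReal_le_iff_le_coe, coe_nnnorm, Real.norm_eq_abs]

end Closure

/-! ### Consequences of the integrability conditions on `R` -/

section Dyadic

/-- A power is dominated by a sum over the dyadic levels below. -/
theorem rpow_le_tsum_dyadic {c : ℝ} (hc : 0 < c) (r : ℝ≥0∞) :
    r ^ c ≤ 1 + ∑' k : ℕ, (2 : ℝ≥0∞) ^ ((k + 1) * c) * (Ioi (2 ^ (k : ℝ))).indicator 1 r := by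
  rcases le_or_gt r 1 with h1 | h1
  · exact (ENNReal.rpow_le_one h1 hc.le).trans le_self_add
  refine le_add_left ?_
  rcases eq_or_ne r ⊤ with rfl | hr
  · refine (le_top.trans (ENNReal.tsum_const_eq_top_of_ne_zero (α := ℕ) one_ne_zero).ge).trans
      (ENNReal.tsum_le_tsum fun k => ?_)
    rw [indicator_of_mem (mem_Ioi.2
      (ENNReal.rpow_lt_top_of_nonneg k.cast_nonneg (by simp : (2 : ℝ≥0∞) ≠ ⊤)))]
    simp only [Pi.one_apply, mul_one]
    exact ENNReal.one_le_rpow (by norm_num) (by positivity)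
  · have hex : ∃ k : ℕ, r ≤ 2 ^ ((k : ℝ) + 1) := by
      obtain ⟨k, hk⟩ := ENNReal.exists_nat_gt hr
      refine ⟨k, hk.le.trans ?_⟩
      have h2 : (k : ℝ≥0∞) ≤ 2 ^ (k + 1) := by
        exact_mod_cast (Nat.lt_two_pow_self.le.trans (Nat.pow_le_pow_right (by norm_num) k.le_succ) :
          k ≤ 2 ^ (k + 1))
      rw [← ENNReal.rpow_natCast] at h2
      exact_mod_cast h2
    classical
    have hk := Nat.find_spec hex
    have hmin := fun j => Nat.find_min (H := hex) (m := j)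
    set k := Nat.find hex
    have hlt : 2 ^ (k : ℝ) < r := by
      rcases Nat.eq_zero_or_pos k with h0 | h0
      · rw [h0]; simpa using h1
      · have := not_le.1 (hmin (k - 1) (by omega))
        rwa [Nat.cast_sub h0, Nat.cast_one, sub_add_cancel] at this
    refine le_trans ?_ (ENNReal.le_tsum k)
    rw [indicator_of_mem (mem_Ioi.2 hlt), Pi.one_apply, mul_one, ENNReal.rpow_mul]
    exact ENNReal.rpow_le_rpow hk hc.le

/-- A truncated power is dominated by a sum over the dyadic levels below `y`. -/
theorem min_pow_le_tsum_dyadic {m : ℕ} (hm : m ≠ 0) (r : ℝ≥0∞) {y : ℝ} (hy : 0 < y) :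
    min 1 (r / ENNReal.ofReal y) ^ m ≤
      ∑' k : ℕ, (2 : ℝ≥0∞) ^ (-(k : ℝ) * m) *
        (Ioi (ENNReal.ofReal y * 2 ^ (-((k : ℝ) + 1)))).indicator 1 r := by
  have hy0 : ENNReal.ofReal y ≠ 0 := (ENNReal.ofReal_pos.2 hy).ne'
  rcases eq_or_ne r 0 with rfl | hr
  · simp [hm]
  have hex : ∃ k : ℕ, ENNReal.ofReal y * 2 ^ (-((k : ℝ) + 1)) < r := by
    have hr' : r / ENNReal.ofReal y ≠ 0 := by simp [hr]
    obtain ⟨k, hk⟩ := ENNReal.exists_inv_two_pow_lt hr'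
    refine ⟨k, ?_⟩
    rw [ENNReal.lt_div_iff_mul_lt (Or.inl hy0) (Or.inl ENNReal.ofReal_ne_top), mul_comm] at hk
    refine lt_of_le_of_lt (mul_le_mul' le_rfl ?_) hk
    rw [ENNReal.rpow_neg, ← ENNReal.inv_pow, ENNReal.inv_le_inv, ← ENNReal.rpow_natCast]
    exact ENNReal.rpow_le_rpow_of_exponent_le (by norm_num) (by linarith)
  classical
  have hk := Nat.find_spec hex
  have hmin := fun j => Nat.find_min (H := hex) (m := j)
  set k := Nat.find hex
  refine le_trans ?_ (ENNReal.le_tsum k)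
  rw [indicator_of_mem (mem_Ioi.2 hk), Pi.one_apply, mul_one, ENNReal.rpow_mul, ENNReal.rpow_natCast]
  refine pow_le_pow_left' ?_ m
  rcases Nat.eq_zero_or_pos k with h0 | h0
  · rw [h0]; simp
  · have := not_lt.1 (hmin (k - 1) (by omega))
    rw [Nat.cast_sub h0, Nat.cast_one, sub_add_cancel] at this
    refine (min_le_right _ _).trans ?_
    rw [ENNReal.div_le_iff_le_mul (Or.inl hy0) (Or.inl ENNReal.ofReal_ne_top), mul_comm]
    exact this

theorem tsum_two_rpow_lt_top {e : ℝ} (he : e < 0) : ∑' k : ℕ, (2 : ℝ≥0∞) ^ (k * e) < ⊤ := by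
  have h : ∀ k : ℕ, (2 : ℝ≥0∞) ^ (k * e) = (2 ^ e) ^ k := fun k => by
    rw [mul_comm, ENNReal.rpow_mul, ENNReal.rpow_natCast]
  simp_rw [h]
  rw [ENNReal.tsum_geometric]
  refine ENNReal.inv_lt_top.2 (tsub_pos_of_lt ?_)
  exact ENNReal.rpow_lt_one_of_one_lt_of_neg (by norm_num) he

end Dyadic

section Weak
variable {Ω : Type*} {F₀ : MeasurableSpace Ω} [mΩ : MeasurableSpace Ω] {P : Measure Ω}
  {Y : ℤ → Ω → ℝ} {H : ℝ≥0 → ℝ} {p : ℝ}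

/-- The weak condition at an arbitrary extended level, in terms of `z^(-(p-1))`. -/
theorem WeakCond.exists_le (hW : WeakCond F₀ P Y H p) : ∃ K : ℝ≥0∞, K ≠ ⊤ ∧ ∀ z : ℝ≥0∞,
    z ≠ 0 → z ≠ ⊤ →
      ∫⁻ u in Icc (0 : ℝ) 1, quantile H u * (Ioi z).indicator 1 (R F₀ P Y H u) ≤
        K * z ^ (-(p - 1)) := by
  refine ⟨_, hW.ne, fun z hz0 hzt => ?_⟩
  have hx : 0 < z.toReal := ENNReal.toReal_pos hz0 hzt
  have h1 := le_iSup₂ (f := fun (x : ℝ) (_ : 0 < x) => ENNReal.ofReal (x ^ (p - 1)) *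
    ∫⁻ u in Icc (0 : ℝ) 1,
      {v | ENNReal.ofReal x < R F₀ P Y H v}.indicator (quantile H) u) z.toReal hx
  rw [← ENNReal.ofReal_rpow_of_pos hx, ENNReal.ofReal_toReal hzt] at h1
  have e : ∀ u, quantile H u * (Ioi z).indicator 1 (R F₀ P Y H u) =
      {v | z < R F₀ P Y H v}.indicator (quantile H) u := by
    intro u
    by_cases hu : z < R F₀ P Y H u
    · rw [indicator_of_mem (mem_Ioi.2 hu), indicator_of_mem (by exact hu)]; simp
    · rw [indicator_of_notMem (by exact hu), indicator_of_notMem (by exact hu), mul_zero]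
  simp_rw [e]
  rw [ENNReal.rpow_neg, ← div_eq_mul_inv, ENNReal.le_div_iff_mul_le
    (Or.inl (by simp [ENNReal.rpow_eq_zero_iff, hz0, hzt]))
    (Or.inl (by simp [ENNReal.rpow_eq_top_iff, hz0, hzt])), mul_comm]
  exact h1

theorem measurable_mul_indicator (z : ℝ≥0∞) :
    Measurable fun u => quantile H u * (Ioi z).indicator 1 (R F₀ P Y H u) :=
  (measurable_quantile H).mul ((measurable_one.indicator measurableSet_Ioi).comp measurable_R)

theorem WeakCond.lintegral_lt_top (hQ : ∫⁻ u in Icc (0 : ℝ) 1, quantile H u ≠ ⊤)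
    (hW : WeakCond F₀ P Y H p) {c : ℝ} (hc : 0 < c) (hcp : c < p - 1) :
    ∫⁻ u in Icc (0 : ℝ) 1, quantile H u * R F₀ P Y H u ^ c < ⊤ := by
  have h2 : (2 : ℝ≥0∞) ^ c < ⊤ := ENNReal.rpow_lt_top_of_nonneg hc.le (by simp)
  obtain ⟨K, hK, hle⟩ := hW.exists_le
  calc ∫⁻ u in Icc (0 : ℝ) 1, quantile H u * R F₀ P Y H u ^ c
      ≤ ∫⁻ u in Icc (0 : ℝ) 1, (quantile H u + ∑' k : ℕ, (2 : ℝ≥0∞) ^ ((k + 1) * c) *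
          (quantile H u * (Ioi (2 ^ (k : ℝ))).indicator 1 (R F₀ P Y H u))) := by
        refine lintegral_mono fun u => ?_
        refine (mul_le_mul' le_rfl (rpow_le_tsum_dyadic hc _)).trans (le_of_eq ?_)
        rw [mul_add, mul_one, ← ENNReal.tsum_mul_left]
        simp only [mul_left_comm]
    _ = (∫⁻ u in Icc (0 : ℝ) 1, quantile H u) + ∑' k : ℕ, (2 : ℝ≥0∞) ^ ((k + 1) * c) *
          ∫⁻ u in Icc (0 : ℝ) 1,
            quantile H u * (Ioi (2 ^ (k : ℝ))).indicator 1 (R F₀ P Y H u) := by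
        rw [lintegral_add_left (measurable_quantile H), lintegral_tsum fun k =>
          ((measurable_mul_indicator _).const_mul _).aemeasurable]
        exact congrArg _ (tsum_congr fun k => lintegral_const_mul _ (measurable_mul_indicator _))
    _ ≤ (∫⁻ u in Icc (0 : ℝ) 1, quantile H u) +
          ∑' k : ℕ, K * 2 ^ c * 2 ^ (k * (c - (p - 1))) := by
        refine add_le_add le_rfl (ENNReal.tsum_le_tsum fun k => ?_)
        refine (mul_le_mul' le_rfl (hle _ (by simp) (by simp))).trans (le_of_eq ?_)
        rw [← ENNReal.rpow_mul, mul_left_comm, mul_assoc, ← ENNReal.rpow_add _ _ (by simp) (by simp),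
          ← ENNReal.rpow_add _ _ (by simp) (by simp)]
        ring_nf
    _ < ⊤ := by
        rw [ENNReal.tsum_mul_left]
        exact ENNReal.add_lt_top.2 ⟨hQ.lt_top, ENNReal.mul_lt_top
          (ENNReal.mul_lt_top hK.lt_top h2) (tsum_two_rpow_lt_top (by linarith))⟩

/-- The weak condition is inherited by the tail integral, as soon as its power `m` is greater than
`p - 1`. -/
theorem WeakCond.exists_tailInt_le (hW : WeakCond F₀ P Y H p) {m : ℕ} (hm0 : m ≠ 0)
    (hm : p - 1 < m) : ∃ C : ℝ, 0 ≤ C ∧ ∀ y > 0,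
      (tailInt F₀ P Y H m y).toReal ≤ C * y ^ (-(p - 1)) := by
  obtain ⟨K, hK, hle⟩ := hW.exists_le
  set G : ℝ≥0∞ := ∑' k : ℕ, 2 ^ (k * ((p - 1) - m)) with hG
  have hGt : G < ⊤ := tsum_two_rpow_lt_top (by linarith)
  have h2 : (2 : ℝ≥0∞) ^ (p - 1) < ⊤ := lt_top_iff_ne_top.2 (by simp [ENNReal.rpow_eq_top_iff])
  have hCt : K * 2 ^ (p - 1) * G ≠ ⊤ :=
    (ENNReal.mul_lt_top (ENNReal.mul_lt_top hK.lt_top h2) hGt).ne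
  refine ⟨(K * 2 ^ (p - 1) * G).toReal, ENNReal.toReal_nonneg, fun y hy => ?_⟩
  have hz0 : ENNReal.ofReal y ≠ 0 := (ENNReal.ofReal_pos.2 hy).ne'
  have key : tailInt F₀ P Y H m y ≤ K * 2 ^ (p - 1) * G * ENNReal.ofReal y ^ (-(p - 1)) := by
    calc tailInt F₀ P Y H m y
        ≤ ∫⁻ u in Icc (0 : ℝ) 1, ∑' k : ℕ, (2 : ℝ≥0∞) ^ (-(k : ℝ) * m) * (quantile H u *
            (Ioi (ENNReal.ofReal y * 2 ^ (-((k : ℝ) + 1)))).indicator 1 (R F₀ P Y H u)) := by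
          refine lintegral_mono fun u => ?_
          refine (mul_le_mul' le_rfl (min_pow_le_tsum_dyadic hm0 _ hy)).trans (le_of_eq ?_)
          rw [← ENNReal.tsum_mul_left]
          simp only [mul_left_comm]
      _ = ∑' k : ℕ, (2 : ℝ≥0∞) ^ (-(k : ℝ) * m) * ∫⁻ u in Icc (0 : ℝ) 1, quantile H u *
            (Ioi (ENNReal.ofReal y * 2 ^ (-((k : ℝ) + 1)))).indicator 1 (R F₀ P Y H u) := by
          rw [lintegral_tsum fun k => ((measurable_mul_indicator _).const_mul _).aemeasurable]
          exact tsum_congr fun k => lintegral_const_mul _ (measurable_mul_indicator _)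
      _ ≤ ∑' k : ℕ, K * 2 ^ (p - 1) * ENNReal.ofReal y ^ (-(p - 1)) *
            2 ^ (k * ((p - 1) - m)) := by
          refine ENNReal.tsum_le_tsum fun k => ?_
          refine (mul_le_mul' le_rfl (hle _ (mul_ne_zero hz0 (by simp))
            (ENNReal.mul_ne_top ENNReal.ofReal_ne_top (by simp)))).trans (le_of_eq ?_)
          rw [ENNReal.mul_rpow_of_ne_top ENNReal.ofReal_ne_top (by simp), ← ENNReal.rpow_mul]
          have e : (2 : ℝ≥0∞) ^ (-(k : ℝ) * m) * 2 ^ (-((k : ℝ) + 1) * -(p - 1)) =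
              2 ^ (p - 1) * 2 ^ (k * ((p - 1) - m)) := by
            rw [← ENNReal.rpow_add _ _ (by simp) (by simp),
              ← ENNReal.rpow_add _ _ (by simp) (by simp)]
            ring_nf
          calc _ = K * ENNReal.ofReal y ^ (-(p - 1)) *
                ((2 : ℝ≥0∞) ^ (-(k : ℝ) * m) * 2 ^ (-((k : ℝ) + 1) * -(p - 1))) := by ring
            _ = _ := by rw [e]; ring
      _ = _ := by rw [ENNReal.tsum_mul_left]; ring
  have hzt : ENNReal.ofReal y ^ (-(p - 1)) ≠ ⊤ := by
    simp [ENNReal.rpow_eq_top_iff, hy]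
  have h3 := ENNReal.toReal_mono (ENNReal.mul_ne_top hCt hzt) key
  rwa [ENNReal.toReal_mul, ← ENNReal.toReal_rpow, ENNReal.toReal_ofReal hy.le] at h3

end Weak

section Strong
variable {Ω : Type*} {F₀ : MeasurableSpace Ω} [mΩ : MeasurableSpace Ω] {P : Measure Ω}
  {Y : ℤ → Ω → ℝ} {H : ℝ≥0 → ℝ} {p : ℝ}

theorem StrongCond.lintegral_lt_top (hS : StrongCond F₀ P Y H p) (hp : 1 ≤ p) :
    ∫⁻ u in Icc (0 : ℝ) 1, quantile H u * R F₀ P Y H u ^ (p - 1) < ⊤ := by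
  refine lt_of_le_of_lt (lintegral_mono fun u => le_of_eq ?_) hS
  rw [R, ENNReal.mul_rpow_of_nonneg _ _ (by linarith), mul_left_comm]
  congr 1
  conv_rhs => rw [show p = 1 + (p - 1) by ring,
    ENNReal.rpow_add_of_nonneg _ _ zero_le_one (by linarith), ENNReal.rpow_one]

/-- The bound `min (1, ρ / n) ≤ 2 ρ / (n + ρ)` makes the sum of the squares telescope. -/
theorem sum_range_sq_min_le {ρ : ℝ} (hρ : 0 < ρ) (N : ℕ) :
    ∑ n ∈ Finset.range N, min 1 (ρ / (n + 1)) ^ 2 ≤ 4 * ρ := by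
  have h : ∑ n ∈ Finset.range N, min 1 (ρ / (n + 1)) ^ 2 ≤
      4 * ρ ^ 2 * (1 / ρ - 1 / (N + ρ)) := by
    induction N with
    | zero => simp
    | succ N ih =>
      rw [Finset.sum_range_succ]
      have h1 : min 1 (ρ / (N + 1)) ≤ 2 * ρ / (N + 1 + ρ) := by
        rw [le_div_iff₀ (by positivity)]
        rcases le_total ρ (N + 1) with h | h
        · calc min 1 (ρ / (N + 1)) * (N + 1 + ρ) ≤ ρ / (N + 1) * ((N + 1) + (N + 1)) := by
                gcongr; exact min_le_right _ _
            _ = 2 * ρ := by field_simp; ring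
        · calc min 1 (ρ / (N + 1)) * (N + 1 + ρ) ≤ 1 * (ρ + ρ) := by
                gcongr; exact min_le_left _ _
            _ = 2 * ρ := by ring
      have h2 : min 1 (ρ / (N + 1)) ^ 2 ≤ 4 * ρ ^ 2 * (1 / (N + ρ) - 1 / (N + 1 + ρ)) := by
        calc min 1 (ρ / (N + 1)) ^ 2 ≤ (2 * ρ / (N + 1 + ρ)) ^ 2 :=
              pow_le_pow_left₀ (by positivity) h1 2
          _ = 4 * ρ ^ 2 * (1 / ((N + 1 + ρ) * (N + 1 + ρ))) := by field_simp; ring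
          _ ≤ 4 * ρ ^ 2 * (1 / ((N + ρ) * (N + 1 + ρ))) := by gcongr; linarith
          _ = _ := by field_simp; ring
      push_cast
      linarith
  refine h.trans ?_
  have h3 : 0 ≤ 1 / ((N : ℝ) + ρ) := by positivity
  calc 4 * ρ ^ 2 * (1 / ρ - 1 / (N + ρ)) ≤ 4 * ρ ^ 2 * (1 / ρ) := by gcongr; linarith
    _ = 4 * ρ := by field_simp

theorem tsum_sq_min_le (ρ : ℝ≥0∞) :
    ∑' n : ℕ, min 1 (ρ / ((n + 1 : ℕ) : ℝ≥0∞)) ^ 2 ≤ 4 * ρ := by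
  rcases eq_or_ne ρ ⊤ with rfl | hρ
  · simp
  rcases eq_or_ne ρ 0 with rfl | hρ0
  · simp
  have hr : 0 < ρ.toReal := ENNReal.toReal_pos hρ0 hρ
  refine ENNReal.tsum_le_of_sum_range_le fun N => ?_
  have e : ∀ n : ℕ, min 1 (ρ / ((n + 1 : ℕ) : ℝ≥0∞)) ^ 2 =
      ENNReal.ofReal (min 1 (ρ.toReal / (n + 1)) ^ 2) := by
    intro n
    rw [ENNReal.ofReal_pow (by positivity), ENNReal.ofReal_min, ENNReal.ofReal_one,
      ENNReal.ofReal_div_of_pos (by positivity), ENNReal.ofReal_toReal hρ]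
    congr 3
    rw [← Nat.cast_succ, ENNReal.ofReal_natCast]
  simp_rw [e]
  rw [← ENNReal.ofReal_sum_of_nonneg fun n _ => by positivity]
  refine (ENNReal.ofReal_le_ofReal (sum_range_sq_min_le hr N)).trans (le_of_eq ?_)
  rw [ENNReal.ofReal_mul (by norm_num), ENNReal.ofReal_toReal hρ]
  norm_num

theorem tsum_rpow_mul_min_pow_le (hp : 2 ≤ p) {m : ℕ} (hm : p ≤ m) (ρ : ℝ≥0∞) :
    ∑' n : ℕ, ((n + 1 : ℕ) : ℝ≥0∞) ^ (p - 2) * min 1 (ρ / ((n + 1 : ℕ) : ℝ≥0∞)) ^ m ≤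
      4 * ρ ^ (p - 1) := by
  calc _ ≤ ∑' n : ℕ, ρ ^ (p - 2) * min 1 (ρ / ((n + 1 : ℕ) : ℝ≥0∞)) ^ 2 := by
        refine ENNReal.tsum_le_tsum fun n => ?_
        set t := min 1 (ρ / ((n + 1 : ℕ) : ℝ≥0∞)) with ht
        have hn0 : ((n + 1 : ℕ) : ℝ≥0∞) ≠ 0 := by simp
        have hn1 : ((n + 1 : ℕ) : ℝ≥0∞) ≠ ⊤ := ENNReal.natCast_ne_top _
        have h1 : t ^ m ≤ t ^ (p - 2) * t ^ 2 := by
          rw [← ENNReal.rpow_natCast, ← ENNReal.rpow_natCast,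
            ← ENNReal.rpow_add_of_nonneg _ _ (by linarith) (by norm_num)]
          exact ENNReal.rpow_le_rpow_of_exponent_ge (min_le_left _ _) (by push_cast; linarith)
        refine (mul_le_mul' le_rfl h1).trans ?_
        rw [← mul_assoc, ← ENNReal.mul_rpow_of_nonneg _ _ (by linarith)]
        refine mul_le_mul' (ENNReal.rpow_le_rpow ?_ (by linarith)) le_rfl
        calc ((n + 1 : ℕ) : ℝ≥0∞) * t ≤ ((n + 1 : ℕ) : ℝ≥0∞) * (ρ / ((n + 1 : ℕ) : ℝ≥0∞)) :=
              mul_le_mul' le_rfl (min_le_right _ _)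
          _ = ρ := ENNReal.mul_div_cancel hn0 hn1
    _ ≤ ρ ^ (p - 2) * (4 * ρ) := by
        rw [ENNReal.tsum_mul_left]
        exact mul_le_mul' le_rfl (tsum_sq_min_le ρ)
    _ = _ := by
        rw [mul_left_comm, show p - 1 = (p - 2) + 1 by ring,
          ENNReal.rpow_add_of_nonneg _ _ (by linarith) zero_le_one, ENNReal.rpow_one]

theorem tsum_rpow_mul_tailInt_le (hp : 2 ≤ p) {m : ℕ} (hm : p ≤ m) (x : ℝ) :
    ∑' n : ℕ, ((n + 1 : ℕ) : ℝ≥0∞) ^ (p - 2) * tailInt F₀ P Y H m ((n + 1 : ℕ) * x) ≤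
      4 * ENNReal.ofReal x ^ (-(p - 1)) *
        ∫⁻ u in Icc (0 : ℝ) 1, quantile H u * R F₀ P Y H u ^ (p - 1) := by
  have hm' : ∀ y : ℝ, Measurable fun u =>
      quantile H u * min 1 (R F₀ P Y H u / ENNReal.ofReal y) ^ m := fun y =>
    (measurable_quantile H).mul ((measurable_const.min (measurable_R.div_const _)).pow_const m)
  have hR : Measurable fun u => quantile H u * R F₀ P Y H u ^ (p - 1) :=
    (measurable_quantile H).mul (measurable_R.pow_const _)
  have hτ : ∀ n : ℕ, ((n + 1 : ℕ) : ℝ≥0∞) ^ (p - 2) * tailInt F₀ P Y H m ((n + 1 : ℕ) * x) =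
      ∫⁻ u in Icc (0 : ℝ) 1, ((n + 1 : ℕ) : ℝ≥0∞) ^ (p - 2) * (quantile H u *
        min 1 (R F₀ P Y H u / ENNReal.ofReal ((n + 1 : ℕ) * x)) ^ m) := fun n =>
    (lintegral_const_mul _ (hm' _)).symm
  rw [← lintegral_const_mul _ hR, tsum_congr hτ,
    ← lintegral_tsum fun n => ((hm' _).const_mul _).aemeasurable]
  refine lintegral_mono fun u => ?_
  have e : ∀ n : ℕ, R F₀ P Y H u / ENNReal.ofReal ((n + 1 : ℕ) * x) =
      R F₀ P Y H u / ENNReal.ofReal x / ((n + 1 : ℕ) : ℝ≥0∞) := by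
    intro n
    rw [ENNReal.ofReal_mul (by positivity), ENNReal.ofReal_natCast, div_eq_mul_inv, div_eq_mul_inv,
      div_eq_mul_inv, ENNReal.mul_inv (Or.inl (by simp)) (Or.inl (ENNReal.natCast_ne_top _)),
      mul_assoc, mul_comm (((n + 1 : ℕ) : ℝ≥0∞)⁻¹)]
  simp_rw [e, mul_left_comm _ (quantile H u)]
  rw [ENNReal.tsum_mul_left]
  refine mul_le_mul' le_rfl ((tsum_rpow_mul_min_pow_le hp hm _).trans (le_of_eq ?_))
  rw [ENNReal.div_rpow_of_nonneg _ _ (by linarith), ENNReal.rpow_neg, div_eq_mul_inv]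
  ring

end Strong

/-! ### Deviation inequalities -/

section Deviation
variable {Ω : Type*} {F₀ : MeasurableSpace Ω} [mΩ : MeasurableSpace Ω] {P : Measure Ω}
  [IsProbabilityMeasure P] {T : Ω ≃ᵐ Ω} {Y₀ : Ω → ℝ} {H : ℝ≥0 → ℝ} {f : ℝ → ℝ} {p a : ℝ}

theorem div_mul_rpow_rpow {n x : ℝ} (hn : 0 < n) (hx : 0 < x) (c a : ℝ) :
    (n / (n * x) ^ (1 + c)) ^ a = 1 / (n ^ (a * c) * x ^ (a * (1 + c))) := by
  have e : n / (n * x) ^ (1 + c) = (n ^ c * x ^ (1 + c))⁻¹ := by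
    rw [Real.mul_rpow hn.le hx.le, Real.rpow_add hn, Real.rpow_one]
    field_simp
  rw [e, Real.inv_rpow (by positivity), Real.mul_rpow (by positivity) (by positivity),
    ← Real.rpow_mul hn.le, ← Real.rpow_mul hx.le, mul_comm c a, mul_comm (1 + c) a, one_div]

/-- The deviation inequality under the weak condition, with an interpolation parameter `c` which may
be `1` if `p > 2`, and must be less than `1` if `p = 2`. -/
theorem WeakCond.exists_deviation_le (hW : WeakCond F₀ P (shifted T Y₀) H p)
    (S : Standing F₀ P T Y₀ H) (hQ : ∫⁻ u in Icc (0 : ℝ) 1, quantile H u ≠ ⊤)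
    (hf : MemF H (P.map Y₀) f) (ha : 1 ≤ a) {c : ℝ} (hc0 : 0 < c) (hc1 : c ≤ 1)
    (hcp : c < p - 1) :
    ∃ C : ℝ, 0 < C ∧ ∀ n : ℕ, 1 ≤ n → ∀ x : ℝ, 0 < x →
      P.real (deviation (obs P (shifted T Y₀) f) n x) ≤
        C * (1 / ((n : ℝ) ^ (a * c) * x ^ (a * (1 + c))) + 1 / ((n : ℝ) ^ (p - 1) * x ^ p)) := by
  obtain ⟨m, hm⟩ := exists_nat_ge p
  have hm0 : m ≠ 0 := by
    rintro rfl
    norm_num at hm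
    linarith
  obtain ⟨A, hA0, hA⟩ := exists_measureReal_maxEvent_le S hQ hf m (s := 1 + c) (a := a)
    (by linarith) (by linarith) ha
    (by rw [add_sub_cancel_left]; exact (hW.lintegral_lt_top hQ hc0 hcp).ne)
  obtain ⟨B, hB0, hB⟩ := hW.exists_tailInt_le hm0 (by linarith)
  refine ⟨A * (1 + B), by positivity, fun n hn x hx => ?_⟩
  have hn0 : (0 : ℝ) < n := by exact_mod_cast hn
  have hnx : 0 < n * x := by positivity
  rw [deviation_eq_maxEvent hn hx]
  refine (hA n _ hnx).trans ?_
  rw [devBound, div_mul_rpow_rpow hn0 hx, mul_assoc]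
  refine mul_le_mul_of_nonneg_left ?_ hA0.le
  have e : n / (n * x) * (B * (n * x) ^ (-(p - 1))) = B * (1 / ((n : ℝ) ^ (p - 1) * x ^ p)) := by
    rw [Real.rpow_neg hnx.le, Real.mul_rpow hn0.le hx.le,
      show x ^ p = x ^ (p - 1) * x by rw [← Real.rpow_add_one hx.ne', sub_add_cancel]]
    field_simp
  have h1 := mul_le_mul_of_nonneg_left (hB _ hnx) (by positivity : 0 ≤ n / (n * x))
  rw [e] at h1
  have h2 : 0 ≤ 1 / ((n : ℝ) ^ (a * c) * x ^ (a * (1 + c))) := by positivity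
  have h3 : 0 ≤ 1 / ((n : ℝ) ^ (p - 1) * x ^ p) := by positivity
  nlinarith

theorem StrongCond.exists_tsum_deviation_le (hS : StrongCond F₀ P (shifted T Y₀) H p)
    (S : Standing F₀ P T Y₀ H) (hQ : ∫⁻ u in Icc (0 : ℝ) 1, quantile H u ≠ ⊤)
    (hf : MemF H (P.map Y₀) f) (hp : 2 ≤ p) (ha : p - 1 < a) :
    ∃ C : ℝ, 0 < C ∧ ∀ x : ℝ, 0 < x →
      ∑' n : ℕ+, ENNReal.ofReal (((n : ℕ) : ℝ) ^ (p - 2)) *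
          P (deviation (obs P (shifted T Y₀) f) n x) ≤
        ENNReal.ofReal (C * (1 / x ^ (2 * a) + 1 / x ^ p)) := by
  obtain ⟨m, hm⟩ := exists_nat_ge p
  have hI := hS.lintegral_lt_top (by linarith)
  set I := ∫⁻ u in Icc (0 : ℝ) 1, quantile H u * R F₀ P (shifted T Y₀) H u ^ (p - 1) with hIdef
  have hD : ∫⁻ u in Icc (0 : ℝ) 1, quantile H u * R F₀ P (shifted T Y₀) H u ^ ((2 : ℝ) - 1) ≠ ⊤ := by
    refine ne_top_of_le_ne_top (ENNReal.add_ne_top.2 ⟨hQ, hI.ne⟩) ?_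
    rw [hIdef, ← lintegral_add_left (measurable_quantile H)]
    refine lintegral_mono fun u => ?_
    rw [← mul_one_add]
    refine mul_le_mul' le_rfl ?_
    rcases le_total (R F₀ P (shifted T Y₀) H u) 1 with h | h
    · exact (ENNReal.rpow_le_one h (by norm_num)).trans le_self_add
    · exact (ENNReal.rpow_le_rpow_of_exponent_le h (by linarith)).trans le_add_self
  obtain ⟨A, hA0, hA⟩ := exists_measureReal_maxEvent_le S hQ hf m (s := 2) (a := a)
    (by norm_num) le_rfl (by linarith) hD
  -- The exponent `p - 2 - a` is less than `-1`.
  have hsum : Summable fun n : ℕ => ((n + 1 : ℕ) : ℝ) ^ (p - 2 - a) :=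
    (summable_nat_add_iff 1).2 (Real.summable_nat_rpow.2 (by linarith))
  set G := ∑' n : ℕ, ((n + 1 : ℕ) : ℝ) ^ (p - 2 - a) with hG
  have hG0 : 0 ≤ G := tsum_nonneg fun n => by positivity
  refine ⟨A * (G + 4 * I.toReal + 1), by positivity, fun x hx => ?_⟩
  have hterm : ∀ n : ℕ, ENNReal.ofReal (((n + 1 : ℕ) : ℝ) ^ (p - 2)) *
      P (deviation (obs P (shifted T Y₀) f) (n + 1) x) ≤
      ENNReal.ofReal (A * (1 / x ^ (2 * a))) * ENNReal.ofReal (((n + 1 : ℕ) : ℝ) ^ (p - 2 - a)) +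
      ENNReal.ofReal (A / x) * (((n + 1 : ℕ) : ℝ≥0∞) ^ (p - 2) *
        tailInt F₀ P (shifted T Y₀) H m ((n + 1 : ℕ) * x)) := by
    intro n
    have hn0 : (0 : ℝ) < (n + 1 : ℕ) := by positivity
    have hnx : 0 < (n + 1 : ℕ) * x := by positivity
    have h1 := hA (n + 1) _ hnx
    rw [← deviation_eq_maxEvent (by omega) hx, devBound, show (2 : ℝ) = 1 + 1 by norm_num,
      div_mul_rpow_rpow hn0 hx, mul_one, show (1 : ℝ) + 1 = 2 by norm_num, mul_comm a 2] at h1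
    have hfin : tailInt F₀ P (shifted T Y₀) H m ((n + 1 : ℕ) * x) ≠ ⊤ :=
      ne_top_of_le_ne_top hQ (tailInt_le m _)
    rw [← ENNReal.ofReal_toReal (measure_ne_top P (deviation _ (n + 1) x)),
      ← ENNReal.ofReal_toReal hfin, ← ENNReal.ofReal_natCast (n + 1),
      ENNReal.ofReal_rpow_of_pos hn0, ← ENNReal.ofReal_mul (by positivity),
      ← ENNReal.ofReal_mul (by positivity), ← ENNReal.ofReal_mul (by positivity),
      ← ENNReal.ofReal_mul (by positivity), ← ENNReal.ofReal_add (by positivity) (by positivity)]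
    refine ENNReal.ofReal_le_ofReal
      ((mul_le_mul_of_nonneg_left h1 (by positivity)).trans (le_of_eq ?_))
    rw [Real.rpow_sub hn0 (p - 2) a]
    field_simp
  have hgauss : ∑' n : ℕ, ENNReal.ofReal (((n + 1 : ℕ) : ℝ) ^ (p - 2 - a)) = ENNReal.ofReal G :=
    (ENNReal.ofReal_tsum_of_nonneg (fun n => by positivity) hsum).symm
  have htail := tsum_rpow_mul_tailInt_le (F₀ := F₀) (P := P) (Y := shifted T Y₀) (H := H) hp hm x
  rw [← hIdef, ← ENNReal.ofReal_toReal hI.ne, ENNReal.ofReal_rpow_of_pos hx,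
    show (4 : ℝ≥0∞) = ENNReal.ofReal 4 by norm_num, ← ENNReal.ofReal_mul (by norm_num),
    ← ENNReal.ofReal_mul (by positivity)] at htail
  rw [tsum_pnat_eq_tsum_succ (f := fun n : ℕ => ENNReal.ofReal ((n : ℝ) ^ (p - 2)) *
    P (deviation (obs P (shifted T Y₀) f) n x))]
  refine (ENNReal.tsum_le_tsum hterm).trans ?_
  rw [ENNReal.tsum_add, ENNReal.tsum_mul_left, ENNReal.tsum_mul_left, hgauss]
  refine (add_le_add le_rfl (mul_le_mul' le_rfl htail)).trans ?_
  rw [← ENNReal.ofReal_mul (by positivity), ← ENNReal.ofReal_mul (by positivity),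
    ← ENNReal.ofReal_add (by positivity) (by positivity)]
  refine ENNReal.ofReal_le_ofReal ?_
  have e : A / x * (4 * x ^ (-(p - 1)) * I.toReal) = A * (4 * I.toReal * (1 / x ^ p)) := by
    rw [Real.rpow_neg hx.le,
      show x ^ p = x ^ (p - 1) * x by rw [← Real.rpow_add_one hx.ne', sub_add_cancel]]
    field_simp
  rw [e, mul_assoc A, mul_assoc A (G + 4 * I.toReal + 1), ← mul_add]
  refine mul_le_mul_of_nonneg_left ?_ hA0.le
  have h2 : 0 ≤ 1 / x ^ (2 * a) := by positivity
  have h3 : 0 ≤ 1 / x ^ p := by positivity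
  have h4 : 0 ≤ I.toReal := ENNReal.toReal_nonneg
  nlinarith [mul_nonneg h4 h2, mul_nonneg hG0 h3]

end Deviation

end AlphaDep

end

theorem theorem3p2 {Ω : Type*} (F₀ : MeasurableSpace Ω) [mΩ : MeasurableSpace Ω]
    (P : Measure Ω) [IsProbabilityMeasure P]
    (T : Ω ≃ᵐ Ω) (hT : MeasurePreserving T P P)
    (hF₀ : F₀ ≤ mΩ) (hF₀T : F₀ ≤ MeasurableSpace.comap T F₀)
    (Y₀ : Ω → ℝ) (hY₀ : Measurable[F₀] Y₀) (hY₀int : Integrable Y₀ P)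
    (H : ℝ≥0 → ℝ) (hH : AlphaDep.IsTailFunction H)
    (hQ : (∫⁻ u in Icc (0 : ℝ) 1, AlphaDep.quantile H u) < ∞)
    (f : ℝ → ℝ) (hf : AlphaDep.MemF H (P.map Y₀) f)
    (Y X : ℤ → Ω → ℝ) (hY : Y = AlphaDep.shifted T Y₀) (hX : X = AlphaDep.obs P Y f) :
    (∀ p : ℝ, 2 < p → AlphaDep.WeakCond F₀ P Y H p →
      ∀ a ∈ Ioo (p - 1) p, ∃ C : ℝ, 0 < C ∧ ∀ n : ℕ, 1 ≤ n → ∀ x : ℝ, 0 < x →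
        P.real (AlphaDep.deviation X n x) ≤
          C * (1 / ((n : ℝ) ^ a * x ^ (2 * a)) + 1 / ((n : ℝ) ^ (p - 1) * x ^ p))) ∧
    (AlphaDep.WeakCond F₀ P Y H 2 →
      ∀ a ∈ Ioo (1 : ℝ) 2, ∀ c ∈ Ioo (0 : ℝ) 1,
        ∃ C : ℝ, 0 < C ∧ ∀ n : ℕ, 1 ≤ n → ∀ x : ℝ, 0 < x →
        P.real (AlphaDep.deviation X n x) ≤
          C * (1 / ((n : ℝ) ^ (a * c) * x ^ (a * (1 + c))) + 1 / ((n : ℝ) * x ^ 2))) ∧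
    (∀ p : ℝ, 2 ≤ p → AlphaDep.StrongCond F₀ P Y H p →
      ∀ a ∈ Ioo (p - 1) p, ∃ C : ℝ, 0 < C ∧ ∀ x : ℝ, 0 < x →
        ∑' n : ℕ+, ENNReal.ofReal (((n : ℕ) : ℝ) ^ (p - 2)) *
            P (AlphaDep.deviation X n x) ≤
          ENNReal.ofReal (C * (1 / x ^ (2 * a) + 1 / x ^ p))) := by
  subst hX hY
  have S : AlphaDep.Standing F₀ P T Y₀ H := ⟨hT, hF₀, hF₀T, hY₀, hH⟩
  refine ⟨fun p hp hW a ha => ?_, fun hW a ha c hc => ?_, fun p hp hS a ha =>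
    hS.exists_tsum_deviation_le S hQ.ne hf hp ha.1⟩
  · obtain ⟨C, hC0, hC⟩ := hW.exists_deviation_le S hQ.ne hf (a := a) (by linarith [ha.1])
      one_pos le_rfl (by linarith)
    refine ⟨C, hC0, fun n hn x hx => (hC n hn x hx).trans (le_of_eq ?_)⟩
    rw [mul_one, show a * (1 + 1) = 2 * a by ring]
  · obtain ⟨C, hC0, hC⟩ := hW.exists_deviation_le S hQ.ne hf ha.1.le hc.1 hc.2.le
      (by linarith [hc.2])
    refine ⟨C, hC0, fun n hn x hx => (hC n hn x hx).trans (le_of_eq ?_)⟩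
    rw [show (2 : ℝ) - 1 = 1 by norm_num, Real.rpow_one, Real.rpow_two]
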